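/- Let $\mathbb G_m$ act on $\mathbb A^2_{\mathbb Z_{(2)}}\setminus\{(0,0)\}$, with coordinates $A,B$, by $A\mapsto\lambda A$, $B\mapsto\lambda^3B$, and let $$\overline{\mathcal M}_1(3)=\overline{\mathcal M}_1(3)_{(2)}\cong\left[(\mathbb A^2_{\mathbb Z_{(2)}}\setminus\{(0,0)\})\,/\!/\,\mathbb G_m\right]$$ be the quotient stack (the 2-localized compactified moduli stack of elliptic curves with $\Gamma_1(3)$-structure). For $n\in\mathbb Z$ let $\mathcal O(n)$ be the line bundle whose sections over an object $(P\to S,\ P\to\mathbb A^2\setminus\{(0,0)\})$, consisting of a $\mathbb G_m$-torsor and an equivariant map, are the functions of weight $n$ on $P$; thus $A$ and $B$ are global sections of $\mathcal O(1)$ and $\mathcal O(3)$. Let $H^i(\overline{\mathcal M}_1(3),\mathcal O(n))$ denote étale sheaf cohomology. Grade $\mathbb Z_{(2)}[A,B]$ by $|A|=1$, $|B|=3$. Then: 1. $H^i(\overline{\mathcal M}_1(3),\mathcal O(n))=0$ for all $i\ge 2$ and all $n\in\mathbb Z$. 2. Sending a homogeneous polynomial $f$ of degree $n$ to the global section $f(A,B)$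 of $\mathcal O(n)$ defines an isomorphism of graded rings $\mathbb Z_{(2)}[A,B]\cong H^0(\overline{\mathcal M}_1(3),\mathcal O(*))$. 3. There is an isomorphism of graded $\mathbb Z_{(2)}[A,B]$-modules $$\mathbb Z_{(2)}[A,B]/(A^\infty,B^\infty)\;\cong\; H^1(\overline{\mathcal M}_1(3),\mathcal O(*)),$$ where $\mathbb Z_{(2)}[A,B]/(A^\infty,B^\infty)$ is the quotient of $\mathbb Z_{(2)}[A,B][1/(AB)]$ by $\mathbb Z_{(2)}[A,B][1/A]+\mathbb Z_{(2)}[A,B][1/B]$. Let $D\in H^1(\overline{\mathcal M}_1(3),\mathcal O(-4))$ be the image of the class of $1/(AB)$, so that the module consists of the $\mathbb Z_{(2)}$-linear combinations of the elements $A^{-n}B^{-m}D$ with $n,m\ge 0$. Then $AD=0$ and $BD=0$, and $D$ is a duality class: for every $n$ and every additive map $\varphi\colon H^0(\overline{\mathcal M}_1(3),\mathcal O(n))\to H^1(\overline{\mathcal M}_1(3),\mathcal O(-4))$ there is a unique $y\in H^1(\overline{\mathcal M}_1(3),\mathcal O(-4-n))$ with $\varphi(x)=xy$ for all $x$. -/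

import Mathlib

open CategoryTheory Opposite TensorProduct

noncomputable section

namespace StackCohomology

theorem span_two_isPrime : (Ideal.span {(2 : ℤ)}).IsPrime :=
  (Ideal.span_singleton_prime two_ne_zero).2 Int.prime_two

/-- The ring `ℤ_(2)` of integers localized at the prime ideal `(2)`. -/
abbrev Z2 : Type := @Localization.AtPrime ℤ _ (Ideal.span {(2 : ℤ)}) span_two_isPrime

/-- A graded ring map between strongly `ℤ`-graded rings exhibits the target as the base change of
the source along the map of degree zero parts. -/
theorem isPushout_of_graded {R T R' T' : Type*} [CommRing R] [CommRing T] [CommRing R']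
    [CommRing T'] [Algebra R T] [Algebra R R'] [Algebra R T'] [Algebra T T'] [Algebra R' T']
    [IsScalarTower R T T'] [IsScalarTower R R' T']
    (𝒯 : ℤ → Submodule R T) [GradedAlgebra 𝒯] (𝒯' : ℤ → Submodule R' T') [GradedAlgebra 𝒯']
    (hinj : Function.Injective (algebraMap R' T'))
    (hz : ∀ t ∈ 𝒯 0, ∃ r, algebraMap R T r = t)
    (hz' : ∀ t ∈ 𝒯' 0, ∃ r, algebraMap R' T' r = t)
    (hone : ∀ n, (1 : T) ∈ 𝒯 n * 𝒯 (-n))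
    (hmap : ∀ n, ∀ t ∈ 𝒯 n, algebraMap T T' t ∈ 𝒯' n) :
    Algebra.IsPushout R R' T T' := by
  let μ : R' ⊗[R] T →ₐ[R'] T' :=
    Algebra.TensorProduct.lift (Algebra.ofId R' T') (IsScalarTower.toAlgHom R T T')
      (fun _ _ => mul_comm _ _)
  have hμ : ∀ r t, μ (r ⊗ₜ t) = algebraMap R' T' r * algebraMap T T' t := by
    intro r t; exact Algebra.TensorProduct.lift_tmul _ _ _ r t
  have key : ∀ n, ∀ u ∈ 𝒯 n, ∀ v ∈ 𝒯 (-n), ∀ z ∈ (𝒯 n).baseChange R',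
      ∃ r' : R', algebraMap R' T' r' = algebraMap T T' v * μ z ∧
        ((1 : R') ⊗ₜ[R] (u * v)) * z = r' • ((1 : R') ⊗ₜ[R] u) := by
    intro n u hu v hv z hz0
    rw [Submodule.baseChange_eq_span] at hz0
    induction hz0 using Submodule.span_induction with
    | mem x hx =>
      obtain ⟨t, ht, rfl⟩ := hx
      have h0 : v * t ∈ 𝒯 0 := by
        have := SetLike.mul_mem_graded hv ht
        simpa using this
      obtain ⟨s, hs⟩ := hz _ h0
      refine ⟨algebraMap R R' s, ?_, ?_⟩
      · simp only [TensorProduct.mk_apply, hμ, map_one, one_mul]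
        rw [← map_mul, ← hs, ← IsScalarTower.algebraMap_apply, ← IsScalarTower.algebraMap_apply]
      · simp only [TensorProduct.mk_apply, Algebra.TensorProduct.tmul_mul_tmul, mul_one]
        rw [mul_assoc, ← hs, TensorProduct.smul_tmul', mul_comm u, ← Algebra.smul_def,
          TensorProduct.tmul_smul, TensorProduct.smul_tmul', smul_eq_mul, mul_one,
          Algebra.smul_def, mul_one]
    | zero => exact ⟨0, by simp, by simp⟩
    | add x y _ _ hx hy =>
      obtain ⟨a, ha, ha'⟩ := hx
      obtain ⟨b, hb, hb'⟩ := hy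
      exact ⟨a + b, by simp [ha, hb, mul_add], by rw [mul_add, ha', hb', add_smul]⟩
    | smul c x _ hx =>
      obtain ⟨a, ha, ha'⟩ := hx
      refine ⟨c * a, ?_, ?_⟩
      · rw [map_mul, ha, map_smul, Algebra.smul_def]; ring
      · rw [mul_smul_comm, ha', mul_smul]
  have hhom : ∀ n, ∀ z ∈ (𝒯 n).baseChange R', μ z = 0 → z = 0 := by
    intro n z hzn h0
    have : ∀ w ∈ 𝒯 n * 𝒯 (-n), ((1 : R') ⊗ₜ[R] w) * z = 0 := by
      intro w hw
      induction hw using Submodule.mul_induction_on' with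
      | mem_mul_mem u hu v hv =>
        obtain ⟨r', h1, h2⟩ := key n u hu v hv z hzn
        rw [h0, mul_zero] at h1
        rw [h2, hinj (h1.trans (map_zero _).symm), zero_smul]
      | add x _ y _ hx hy => rw [TensorProduct.tmul_add, add_mul, hx, hy, add_zero]
    have h := this 1 (hone n)
    rwa [← Algebra.TensorProduct.one_def, one_mul] at h
  have hmem : ∀ n, ∀ z ∈ (𝒯 n).baseChange R', μ z ∈ 𝒯' n := by
    intro n z hzn
    rw [Submodule.baseChange_eq_span] at hzn
    induction hzn using Submodule.span_induction with
    | mem x hx => obtain ⟨t, ht, rfl⟩ := hx; simpa [hμ] using hmap n t ht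
    | zero => simp
    | add x y _ _ hx hy => rw [map_add]; exact add_mem hx hy
    | smul c x _ hx => rw [map_smul]; exact Submodule.smul_mem _ _ hx
  have hsurj : ∀ n, ∀ t' ∈ 𝒯' n, t' ∈ Set.range μ := by
    intro n t' ht'
    have : ∀ w ∈ 𝒯 n * 𝒯 (-n), algebraMap T T' w * t' ∈ μ.range := by
      intro w hw
      induction hw using Submodule.mul_induction_on' with
      | mem_mul_mem u hu v hv =>
        have h0 : algebraMap T T' v * t' ∈ 𝒯' 0 := by
          have := SetLike.mul_mem_graded (hmap _ v hv) ht'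
          simpa using this
        obtain ⟨s, hs⟩ := hz' _ h0
        refine ⟨s ⊗ₜ u, ?_⟩
        change μ (s ⊗ₜ u) = _
        rw [hμ, hs, map_mul]; ring
      | add x _ y _ hx hy => rw [map_add, add_mul]; exact add_mem hx hy
    have h := this 1 (hone n)
    rw [map_one, one_mul] at h
    exact h
  have hbij : Function.Bijective μ := by
    constructor
    · rw [injective_iff_map_eq_zero]
      intro z h0
      classical
      rw [← DirectSum.sum_support_decompose (fun i => (𝒯 i).baseChange R') z]
      refine Finset.sum_eq_zero fun n _ => hhom n _ (SetLike.coe_mem _) ?_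
      have hcomp : ∀ y : R' ⊗[R] T, ∀ n, μ (DirectSum.decompose (fun i => (𝒯 i).baseChange R') y n)
          = DirectSum.decompose 𝒯' (μ y) n := by
        intro y n
        induction y using DirectSum.Decomposition.inductionOn (fun i => (𝒯 i).baseChange R') with
        | zero => simp
        | @homogeneous i m =>
          have hm := hmem i m m.2
          by_cases h : i = n
          · subst h
            rw [DirectSum.decompose_coe, DirectSum.of_eq_same, DirectSum.decompose_of_mem_same _ hm]
          · rw [DirectSum.decompose_of_mem_ne (fun i => (𝒯 i).baseChange R') m.2 h,
              DirectSum.decompose_of_mem_ne _ hm h, map_zero]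
        | add x y hx hy => simp [DirectSum.decompose_add, hx, hy]
      rw [hcomp, h0]; simp
    · intro t'
      classical
      rw [← DirectSum.sum_support_decompose 𝒯' t']
      change _ ∈ μ.range
      exact sum_mem fun n _ => hsurj n _ (SetLike.coe_mem _)
  refine ⟨IsBaseChange.of_equiv (AlgEquiv.ofBijective μ hbij).toLinearEquiv fun t => ?_⟩
  simp [hμ]


/-- The quotient stack `M = [(𝔸² ∖ {0}) // 𝔾ₘ]` over `ℤ_(2)`, where `𝔾ₘ` acts on `𝔸² ∖ {0}` by
`(A, B) ↦ (λ A, λ³ B)`, as a category fibred in groupoids over affine `ℤ_(2)`-schemes.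

An object over `Spec R` is a `𝔾ₘ`-torsor `P → Spec R` with a `𝔾ₘ`-equivariant map
`P → 𝔸² ∖ {0}`. The torsor is affine, `P = Spec T`. The action of `𝔾ₘ` is a `ℤ`-grading of the
`R`-algebra `T`, and `P` is a torsor if and only if `R = T₀` and `Tₙ T₋ₙ = T₀` for all `n`. The
equivariant map to `𝔸²` is a pair `A ∈ T₁`, `B ∈ T₃`, and it avoids the origin if and only if
`A` and `B` generate the unit ideal. -/
structure Mbar where
  /-- The base of the torsor is `Spec R`. -/
  R : Type
  /-- The total space of the torsor is `Spec T`. -/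
  T : Type
  [ringR : CommRing R]
  [algR : Algebra Z2 R]
  [ringT : CommRing T]
  [algT : Algebra R T]
  grading : ℤ → Submodule R T
  [graded : GradedAlgebra grading]
  algebraMap_injective : Function.Injective (algebraMap R T)
  exists_of_mem_zero : ∀ t ∈ grading 0, ∃ r, algebraMap R T r = t
  one_mem_mul : ∀ n, (1 : T) ∈ grading n * grading (-n)
  A : T
  B : T
  A_mem : A ∈ grading 1
  B_mem : B ∈ grading 3
  span_eq_top : Ideal.span {A, B} = ⊤

namespace Mbar

attribute [instance] ringR algR ringT algT graded

/-- A morphism `X ⟶ Y` of the stack: a map of base schemes `Spec X.R ⟶ Spec Y.R` covered by a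
`𝔾ₘ`-equivariant map of total spaces which is compatible with the maps to `𝔸²`. (Any such map of
torsors is cartesian.) -/
@[ext]
structure Hom (X Y : Mbar) where
  base : Y.R →ₐ[Z2] X.R
  total : Y.T →+* X.T
  total_algebraMap : ∀ r, total (algebraMap Y.R Y.T r) = algebraMap X.R X.T (base r)
  total_mem : ∀ n, ∀ t ∈ Y.grading n, total t ∈ X.grading n
  total_A : total Y.A = X.A
  total_B : total Y.B = X.B

instance : Category Mbar where
  Hom := Hom
  id X := ⟨AlgHom.id _ _, RingHom.id _, fun _ => rfl, fun _ _ h => h, rfl, rfl⟩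
  comp f g := ⟨f.base.comp g.base, f.total.comp g.total,
    fun r => by simp [g.total_algebraMap, f.total_algebraMap],
    fun n t h => f.total_mem n _ (g.total_mem n t h),
    by simp [g.total_A, f.total_A], by simp [g.total_B, f.total_B]⟩

theorem comp_base {X Y Z : Mbar} (f : X ⟶ Y) (g : Y ⟶ Z) :
    (f ≫ g).base = f.base.comp g.base := rfl

theorem comp_total {X Y Z : Mbar} (f : X ⟶ Y) (g : Y ⟶ Z) :
    (f ≫ g).total = f.total.comp g.total := rfl

theorem hom_ext {X Y : Mbar} (f g : X ⟶ Y) (h : f.total = g.total) : f = g := by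
  refine Hom.ext (AlgHom.ext fun r => X.algebraMap_injective ?_) h
  rw [← f.total_algebraMap, ← g.total_algebraMap, h]

theorem exists_retraction (X : Mbar) :
    ∃ ρ : X.T →ₗ[X.R] X.R, ∀ r, ρ (algebraMap X.R X.T r) = r := by
  have hm : ∀ r, Algebra.linearMap X.R X.T r ∈ X.grading 0 := fun r =>
    SetLike.algebraMap_mem_graded X.grading r
  let f : X.R →ₗ[X.R] X.grading 0 := (Algebra.linearMap X.R X.T).codRestrict _ hm
  have hf : Function.Bijective f := by
    refine ⟨fun a b h => X.algebraMap_injective (congrArg Subtype.val h), fun t => ?_⟩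
    obtain ⟨r, hr⟩ := X.exists_of_mem_zero t t.2
    exact ⟨r, Subtype.ext hr⟩
  let e := LinearEquiv.ofBijective f hf
  refine ⟨e.symm.toLinearMap ∘ₗ DirectSum.component X.R ℤ (fun n => X.grading n) 0 ∘ₗ
    (DirectSum.decomposeLinearEquiv X.grading).toLinearMap, fun r => ?_⟩
  apply e.injective
  have h := DirectSum.decompose_of_mem X.grading (hm r)
  simp only [Algebra.linearMap_apply] at h
  simp only [LinearMap.comp_apply, LinearEquiv.coe_coe, LinearEquiv.apply_symm_apply,
    DirectSum.decomposeLinearEquiv_apply]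
  rw [h]
  exact DirectSum.of_eq_same (β := fun n => X.grading n) 0 _

/-- The pullback of a torsor along `Spec S ⟶ Spec X.R`. -/
def baseChange (X : Mbar) (S : Type) [CommRing S] [Algebra Z2 S] [Algebra X.R S]
    [IsScalarTower Z2 X.R S] : Mbar where
  R := S
  T := S ⊗[X.R] X.T
  grading n := (X.grading n).baseChange S
  algebraMap_injective := by
    obtain ⟨ρ, hρ⟩ := X.exists_retraction
    have hcomp : ∀ s : S, TensorProduct.rid X.R S (ρ.lTensor S (algebraMap S (S ⊗[X.R] X.T) s)) = s := by
      intro s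
      have h1 : ρ 1 = 1 := by simpa using hρ 1
      simp [Algebra.TensorProduct.algebraMap_apply, h1]
    intro a b hab
    rw [← hcomp a, ← hcomp b, hab]
  exists_of_mem_zero := by
    intro t ht
    rw [Submodule.baseChange_eq_span] at ht
    induction ht using Submodule.span_induction with
    | mem x hx =>
      obtain ⟨t, ht, rfl⟩ := hx
      obtain ⟨s, rfl⟩ := X.exists_of_mem_zero t ht
      refine ⟨algebraMap X.R S s, ?_⟩
      simp only [TensorProduct.mk_apply, Algebra.TensorProduct.algebraMap_apply,
        Algebra.algebraMap_self, RingHom.id_apply]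
      rw [Algebra.algebraMap_eq_smul_one, Algebra.algebraMap_eq_smul_one, TensorProduct.smul_tmul]
    | zero => exact ⟨0, map_zero _⟩
    | add x y _ _ hx hy =>
      obtain ⟨a, rfl⟩ := hx
      obtain ⟨b, rfl⟩ := hy
      exact ⟨a + b, map_add _ _ _⟩
    | smul c x _ hx =>
      obtain ⟨a, rfl⟩ := hx
      exact ⟨c * a, by rw [map_mul, Algebra.smul_def]⟩
  one_mem_mul n := by
    have : ∀ w ∈ X.grading n * X.grading (-n), (1 : S) ⊗ₜ[X.R] w ∈
        (X.grading n).baseChange S * (X.grading (-n)).baseChange S := by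
      intro w hw
      induction hw using Submodule.mul_induction_on' with
      | mem_mul_mem u hu v hv =>
        have := Submodule.mul_mem_mul (Submodule.tmul_mem_baseChange_of_mem (1 : S) hu)
          (Submodule.tmul_mem_baseChange_of_mem (1 : S) hv)
        simpa using this
      | add x _ y _ hx hy => rw [TensorProduct.tmul_add]; exact add_mem hx hy
    exact this 1 (X.one_mem_mul n)
  A := 1 ⊗ₜ X.A
  B := 1 ⊗ₜ X.B
  A_mem := Submodule.tmul_mem_baseChange_of_mem _ X.A_mem
  B_mem := Submodule.tmul_mem_baseChange_of_mem _ X.B_mem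
  span_eq_top := by
    have h := congrArg (Ideal.map (Algebra.TensorProduct.includeRight : X.T →ₐ[X.R] S ⊗[X.R] X.T))
      X.span_eq_top
    rw [Ideal.map_span, Ideal.map_top, Set.image_pair] at h
    exact h



end Mbar

theorem exists_common_field {R R₁ R₂ : Type} [CommRing R] [CommRing R₁] [CommRing R₂]
    (f₁ : R →+* R₁) (f₂ : R →+* R₂) (x₁ : PrimeSpectrum R₁) (x₂ : PrimeSpectrum R₂)
    (h : PrimeSpectrum.comap f₁ x₁ = PrimeSpectrum.comap f₂ x₂) :
    ∃ (Ω : Type) (_ : Field Ω) (g₁ : R₁ →+* Ω) (g₂ : R₂ →+* Ω),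
      g₁.comp f₁ = g₂.comp f₂ ∧ RingHom.ker g₁ = x₁.asIdeal := by
  let x := PrimeSpectrum.comap f₁ x₁
  let k₁ := Ideal.ResidueField.map x.asIdeal x₁.asIdeal f₁ rfl
  let k₂ := Ideal.ResidueField.map x.asIdeal x₂.asIdeal f₂ (congrArg PrimeSpectrum.asIdeal h)
  let _ := k₁.toAlgebra
  let _ := k₂.toAlgebra
  let K := x.asIdeal.ResidueField
  let W := x₁.asIdeal.ResidueField ⊗[K] x₂.asIdeal.ResidueField
  obtain ⟨M, hM⟩ := Ideal.exists_maximal W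
  let j₁ : x₁.asIdeal.ResidueField →+* W := Algebra.TensorProduct.includeLeftRingHom
  let j₂ : x₂.asIdeal.ResidueField →+* W := (Algebra.TensorProduct.includeRight : _ →ₐ[K] W).toRingHom
  have hj : j₁.comp k₁ = j₂.comp k₂ := Algebra.TensorProduct.includeLeftRingHom_comp_algebraMap
  let _ : Field (W ⧸ M) := Ideal.Quotient.field M
  let π := Ideal.Quotient.mk M
  refine ⟨W ⧸ M, inferInstance, (π.comp j₁).comp (algebraMap R₁ x₁.asIdeal.ResidueField),
    (π.comp j₂).comp (algebraMap R₂ x₂.asIdeal.ResidueField), ?_, ?_⟩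
  · ext r
    have h1 : algebraMap R₁ x₁.asIdeal.ResidueField (f₁ r) = k₁ (algebraMap R K r) :=
      (Ideal.ResidueField.map_algebraMap ..).symm
    have h2 : algebraMap R₂ x₂.asIdeal.ResidueField (f₂ r) = k₂ (algebraMap R K r) :=
      (Ideal.ResidueField.map_algebraMap ..).symm
    simp only [RingHom.comp_apply, h1, h2]
    exact congrArg π (RingHom.congr_fun hj _)
  · ext r
    rw [RingHom.mem_ker, RingHom.comp_apply, map_eq_zero_iff _ (RingHom.injective (π.comp j₁)),
      Ideal.algebraMap_residueField_eq_zero]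

theorem exists_pullback_ringHom {R R₁ R₂ T T₁ T₂ : Type*} [CommRing R] [CommRing R₁] [CommRing R₂]
    [CommRing T] [CommRing T₁] [CommRing T₂] [Algebra R R₁] [Algebra R R₂] [Algebra R T]
    [Algebra R T₁] [Algebra R T₂] [Algebra T T₁] [Algebra T T₂] [Algebra R₁ T₁] [Algebra R₂ T₂]
    [IsScalarTower R R₁ T₁] [IsScalarTower R R₂ T₂] [IsScalarTower R T T₁] [IsScalarTower R T T₂]
    [Algebra.IsPushout R R₂ T T₂] :
    ∃ q : T₂ →+* (R₁ ⊗[R] R₂) ⊗[R₁] T₁,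
      (∀ r, q (algebraMap R₂ T₂ r) = ((1 : R₁) ⊗ₜ[R] r) ⊗ₜ[R₁] (1 : T₁)) ∧
      (∀ t, q (algebraMap T T₂ t) = (1 : R₁ ⊗[R] R₂) ⊗ₜ[R₁] algebraMap T T₁ t) ∧
      ∀ t₁ t₂, (1 : R₁ ⊗[R] R₂) ⊗ₜ[R₁] t₁ = q t₂ → t₁ ⊗ₜ[T] (1 : T₂) = (1 : T₁) ⊗ₜ[T] t₂ := by
  let W := (R₁ ⊗[R] R₂) ⊗[R₁] T₁
  let a : R₂ →ₐ[R] W :=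
    { (Algebra.TensorProduct.includeLeftRingHom : (R₁ ⊗[R] R₂) →+* W).comp
        (Algebra.TensorProduct.includeRight : R₂ →ₐ[R] R₁ ⊗[R] R₂).toRingHom with
      commutes' := fun r => by
        change ((1 : R₁) ⊗ₜ[R] (algebraMap R R₂ r)) ⊗ₜ[R₁] (1 : T₁) = _
        rw [← Algebra.TensorProduct.algebraMap_apply']
        rfl }
  let b : T →ₐ[R] W :=
    { (Algebra.TensorProduct.includeRight : T₁ →ₐ[R₁] W).toRingHom.comp (algebraMap T T₁) with
      commutes' := fun r => by
        change (Algebra.TensorProduct.includeRight : T₁ →ₐ[R₁] W)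
          (algebraMap T T₁ (algebraMap R T r)) = _
        rw [← IsScalarTower.algebraMap_apply R T T₁, IsScalarTower.algebraMap_apply R R₁ T₁,
          AlgHom.commutes]
        rfl }
  let q : T₂ →ₐ[R] W := Algebra.pushoutDesc T₂ a b fun _ _ => mul_comm _ _
  let C := T₁ ⊗[T] T₂
  let c : R₂ →ₐ[R] C :=
    { (Algebra.TensorProduct.includeRight : T₂ →ₐ[T] C).toRingHom.comp (algebraMap R₂ T₂) with
      commutes' := fun r => by
        change (Algebra.TensorProduct.includeRight : T₂ →ₐ[T] C)
          (algebraMap R₂ T₂ (algebraMap R R₂ r)) = _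
        rw [← IsScalarTower.algebraMap_apply R R₂ T₂, IsScalarTower.algebraMap_apply R T T₂,
          AlgHom.commutes, Algebra.TensorProduct.algebraMap_apply,
          Algebra.TensorProduct.algebraMap_apply, ← IsScalarTower.algebraMap_apply R T T₁] }
  let ψ₀ : R₁ ⊗[R] R₂ →ₐ[R₁] C :=
    Algebra.TensorProduct.lift (Algebra.ofId R₁ C) c fun _ _ => mul_comm _ _
  let ψ : W →ₐ[R₁] C := Algebra.TensorProduct.lift ψ₀
    (Algebra.TensorProduct.includeLeft : T₁ →ₐ[R₁] C) fun _ _ => mul_comm _ _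
  have h1 : ∀ r, q (algebraMap R₂ T₂ r) = ((1 : R₁) ⊗ₜ[R] r) ⊗ₜ[R₁] (1 : T₁) :=
    fun r => Algebra.pushoutDesc_left _ _ _ _ r
  have h2 : ∀ t, q (algebraMap T T₂ t) = (1 : R₁ ⊗[R] R₂) ⊗ₜ[R₁] algebraMap T T₁ t :=
    fun t => Algebra.pushoutDesc_right _ _ _ _ t
  have hψ1 : ∀ t₁ : T₁, ψ ((1 : R₁ ⊗[R] R₂) ⊗ₜ[R₁] t₁) = t₁ ⊗ₜ[T] (1 : T₂) := by
    intro t₁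
    refine (Algebra.TensorProduct.lift_tmul _ _ _ _ _).trans ?_
    rw [map_one, one_mul]
    rfl
  have hψ2 : ∀ r : R₂, ψ (((1 : R₁) ⊗ₜ[R] r) ⊗ₜ[R₁] (1 : T₁)) = (1 : T₁) ⊗ₜ[T] algebraMap R₂ T₂ r := by
    intro r
    refine (Algebra.TensorProduct.lift_tmul _ _ _ _ _).trans ?_
    rw [map_one, mul_one]
    refine (Algebra.TensorProduct.lift_tmul _ _ _ _ _).trans ?_
    rw [map_one, one_mul]
    rfl
  refine ⟨q.toRingHom, h1, h2, fun t₁ t₂ h => ?_⟩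
  have hq : ∀ t₂, ψ (q t₂) = (1 : T₁) ⊗ₜ[T] t₂ := by
    have : (ψ.restrictScalars R).comp q =
        ((Algebra.TensorProduct.includeRight : T₂ →ₐ[T] C).restrictScalars R) := by
      apply Algebra.IsPushout.algHom_ext (R := R) (S := R₂) (R' := T)
      · ext t
        change ψ (q (algebraMap T T₂ t)) = (1 : T₁) ⊗ₜ[T] (algebraMap T T₂ t)
        rw [h2, hψ1]
        simp [Algebra.algebraMap_eq_smul_one, TensorProduct.smul_tmul]
      · ext r
        change ψ (q (algebraMap R₂ T₂ r)) = (1 : T₁) ⊗ₜ[T] (algebraMap R₂ T₂ r)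
        rw [h1, hψ2]
    exact fun t => DFunLike.congr_fun this t
  rw [← hψ1, ← hq, h]
  rfl

namespace Mbar

theorem exists_pullback {X X₁ X₂ : Mbar} (f : X₁ ⟶ X) (g : X₂ ⟶ X) :
    ∃ (Z : Mbar) (p : Z ⟶ X₁) (q : Z ⟶ X₂), p ≫ f = q ≫ g ∧
      (g.base.toRingHom.Etale → p.base.toRingHom.Etale) ∧
      (∀ (x₁ : PrimeSpectrum X₁.R) (x₂ : PrimeSpectrum X₂.R),
        PrimeSpectrum.comap f.base.toRingHom x₁ = PrimeSpectrum.comap g.base.toRingHom x₂ →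
        ∃ z : PrimeSpectrum Z.R, PrimeSpectrum.comap p.base.toRingHom z = x₁) ∧
      (letI := f.total.toAlgebra; letI := g.total.toAlgebra;
        ∀ t₁ t₂, p.total t₁ = q.total t₂ →
          t₁ ⊗ₜ[X.T] (1 : X₂.T) = (1 : X₁.T) ⊗ₜ[X.T] t₂) := by
  let _ : Algebra X.R X₁.R := f.base.toRingHom.toAlgebra
  let _ : Algebra X.R X₂.R := g.base.toRingHom.toAlgebra
  let _ : Algebra X.T X₁.T := f.total.toAlgebra
  let _ : Algebra X.T X₂.T := g.total.toAlgebra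
  let _ : Algebra X.R X₁.T := ((algebraMap X₁.R X₁.T).comp (algebraMap X.R X₁.R)).toAlgebra
  let _ : Algebra X.R X₂.T := ((algebraMap X₂.R X₂.T).comp (algebraMap X.R X₂.R)).toAlgebra
  have : IsScalarTower X.R X₁.R X₁.T := .of_algebraMap_eq fun _ => rfl
  have : IsScalarTower X.R X₂.R X₂.T := .of_algebraMap_eq fun _ => rfl
  have : IsScalarTower X.R X.T X₁.T := .of_algebraMap_eq fun r => (f.total_algebraMap r).symm
  have : IsScalarTower X.R X.T X₂.T := .of_algebraMap_eq fun r => (g.total_algebraMap r).symm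
  have : IsScalarTower Z2 X.R X₁.R := .of_algebraMap_eq fun r => (f.base.commutes r).symm
  have : IsScalarTower Z2 X.R X₂.R := .of_algebraMap_eq fun r => (g.base.commutes r).symm
  have hpo : Algebra.IsPushout X.R X₂.R X.T X₂.T :=
    isPushout_of_graded X.grading X₂.grading X₂.algebraMap_injective X.exists_of_mem_zero
      X₂.exists_of_mem_zero X.one_mem_mul g.total_mem
  obtain ⟨φ, hφ₁, hφ₂, hφ⟩ := exists_pullback_ringHom (R := X.R) (R₁ := X₁.R) (R₂ := X₂.R)
    (T := X.T) (T₁ := X₁.T) (T₂ := X₂.T)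
  let p : X₁.baseChange (X₁.R ⊗[X.R] X₂.R) ⟶ X₁ :=
    { base := IsScalarTower.toAlgHom Z2 X₁.R (X₁.R ⊗[X.R] X₂.R)
      total := (Algebra.TensorProduct.includeRight :
        X₁.T →ₐ[X₁.R] (X₁.R ⊗[X.R] X₂.R) ⊗[X₁.R] X₁.T).toRingHom
      total_algebraMap := fun r => by
        refine (AlgHom.commutes (Algebra.TensorProduct.includeRight :
          X₁.T →ₐ[X₁.R] (X₁.R ⊗[X.R] X₂.R) ⊗[X₁.R] X₁.T) r).trans ?_
        rfl
      total_mem := fun n t ht => Submodule.tmul_mem_baseChange_of_mem _ ht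
      total_A := rfl
      total_B := rfl }
  let q : X₁.baseChange (X₁.R ⊗[X.R] X₂.R) ⟶ X₂ :=
    { base := (Algebra.TensorProduct.includeRight :
        X₂.R →ₐ[X.R] X₁.R ⊗[X.R] X₂.R).restrictScalars Z2
      total := φ
      total_algebraMap := hφ₁
      total_mem := fun n t ht => by
        have : ∀ w ∈ X.grading n * X.grading (-n), φ (algebraMap X.T X₂.T w * t) ∈
            (X₁.baseChange (X₁.R ⊗[X.R] X₂.R)).grading n := by
          intro w hw
          induction hw using Submodule.mul_induction_on' with
          | mem_mul_mem u hu v hv =>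
            have h0 : algebraMap X.T X₂.T v * t ∈ X₂.grading 0 := by
              have := SetLike.mul_mem_graded (g.total_mem _ v hv) ht
              rw [neg_add_cancel] at this
              exact this
            obtain ⟨s, hs⟩ := X₂.exists_of_mem_zero _ h0
            have h1 : φ (algebraMap X.T X₂.T (u * v) * t) =
                (((1 : X₁.R) ⊗ₜ[X.R] s) ⊗ₜ[X₁.R] (1 : X₁.T)) *
                  ((1 : X₁.R ⊗[X.R] X₂.R) ⊗ₜ[X₁.R] algebraMap X.T X₁.T u) := by
              rw [map_mul (algebraMap X.T X₂.T), mul_assoc, ← hs, map_mul, hφ₁, hφ₂, mul_comm]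
            rw [h1]
            have hu' : (1 : X₁.R ⊗[X.R] X₂.R) ⊗ₜ[X₁.R] algebraMap X.T X₁.T u ∈
                (X₁.grading n).baseChange (X₁.R ⊗[X.R] X₂.R) :=
              Submodule.tmul_mem_baseChange_of_mem _ (f.total_mem n u hu)
            have := Submodule.smul_mem _ ((1 : X₁.R) ⊗ₜ[X.R] s) hu'
            have h2 : ((1 : X₁.R) ⊗ₜ[X.R] s) •
                ((1 : X₁.R ⊗[X.R] X₂.R) ⊗ₜ[X₁.R] algebraMap X.T X₁.T u) =
                (((1 : X₁.R) ⊗ₜ[X.R] s) ⊗ₜ[X₁.R] (1 : X₁.T)) *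
                  ((1 : X₁.R ⊗[X.R] X₂.R) ⊗ₜ[X₁.R] algebraMap X.T X₁.T u) := by
              rw [TensorProduct.smul_tmul', Algebra.TensorProduct.tmul_mul_tmul, smul_eq_mul,
                one_mul]
            rw [← h2]
            exact this
          | add x _ y _ hx hy => rw [map_add, add_mul, map_add]; exact add_mem hx hy
        have h := this 1 (X.one_mem_mul n)
        rwa [map_one, one_mul] at h
      total_A := by
        rw [← g.total_A]
        refine (hφ₂ _).trans ?_
        change _ ⊗ₜ f.total X.A = _ ⊗ₜ X₁.A
        rw [f.total_A]
      total_B := by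
        rw [← g.total_B]
        refine (hφ₂ _).trans ?_
        change _ ⊗ₜ f.total X.B = _ ⊗ₜ X₁.B
        rw [f.total_B] }
  refine ⟨_, p, q, ?_, ?_, ?_, ?_⟩
  · apply hom_ext
    ext t
    exact (hφ₂ t).symm
  · intro h
    exact RingHom.Etale.isStableUnderBaseChange.tensorProduct X₁.R h
  · intro x₁ x₂ h
    obtain ⟨Ω, _, g₁, g₂, hg, hker⟩ := exists_common_field f.base.toRingHom g.base.toRingHom x₁ x₂ h
    let _ : Algebra X₁.R Ω := g₁.toAlgebra
    let _ : Algebra X.R Ω := (g₁.comp f.base.toRingHom).toAlgebra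
    have : IsScalarTower X.R X₁.R Ω := .of_algebraMap_eq fun _ => rfl
    let g₂' : X₂.R →ₐ[X.R] Ω :=
      { g₂ with commutes' := fun r => (RingHom.congr_fun hg r).symm }
    let l : X₁.R ⊗[X.R] X₂.R →ₐ[X₁.R] Ω :=
      Algebra.TensorProduct.lift (Algebra.ofId _ _) g₂' fun _ _ => mul_comm _ _
    refine ⟨⟨RingHom.ker l.toRingHom, RingHom.ker_isPrime _⟩, ?_⟩
    ext r
    rw [← hker]
    change l (algebraMap X₁.R (X₁.R ⊗[X.R] X₂.R) r) = 0 ↔ g₁ r = 0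
    rw [AlgHom.commutes]
    rfl
  · intro t₁ t₂ h
    exact hφ t₁ t₂ h


theorem isPushout_hom {X Y : Mbar} (f : Y ⟶ X) [Algebra X.R Y.R] [Algebra X.R Y.T]
    [Algebra X.T Y.T] [IsScalarTower X.R X.T Y.T] [IsScalarTower X.R Y.R Y.T]
    (h : algebraMap X.T Y.T = f.total) : Algebra.IsPushout X.R Y.R X.T Y.T :=
  isPushout_of_graded X.grading Y.grading Y.algebraMap_injective X.exists_of_mem_zero
    Y.exists_of_mem_zero X.one_mem_mul (by rw [h]; exact f.total_mem)

theorem flat_total {X Y : Mbar} (f : Y ⟶ X) (hf : f.base.toRingHom.Etale) : f.total.Flat := by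
  let _ : Algebra X.R Y.R := f.base.toRingHom.toAlgebra
  let _ : Algebra X.T Y.T := f.total.toAlgebra
  let _ : Algebra X.R Y.T := ((algebraMap Y.R Y.T).comp (algebraMap X.R Y.R)).toAlgebra
  have : IsScalarTower X.R Y.R Y.T := .of_algebraMap_eq fun _ => rfl
  have : IsScalarTower X.R X.T Y.T := .of_algebraMap_eq fun r => (f.total_algebraMap r).symm
  have hpo := isPushout_hom f rfl
  have : Module.Flat X.R Y.R := (RingHom.Etale.iff_flat_and_formallyUnramified.1 hf).1
  exact Module.Flat.isBaseChange X.R X.T Y.R Y.T hpo.symm.out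

theorem exists_comap_total {X Y : Mbar} (f : Y ⟶ X) (x : PrimeSpectrum X.T)
    (y : PrimeSpectrum Y.R) (h : PrimeSpectrum.comap (algebraMap X.R X.T) x =
      PrimeSpectrum.comap f.base.toRingHom y) :
    ∃ z : PrimeSpectrum Y.T, PrimeSpectrum.comap f.total z = x := by
  let _ : Algebra X.R Y.R := f.base.toRingHom.toAlgebra
  let _ : Algebra X.T Y.T := f.total.toAlgebra
  let _ : Algebra X.R Y.T := ((algebraMap Y.R Y.T).comp (algebraMap X.R Y.R)).toAlgebra
  have : IsScalarTower X.R Y.R Y.T := .of_algebraMap_eq fun _ => rfl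
  have : IsScalarTower X.R X.T Y.T := .of_algebraMap_eq fun r => (f.total_algebraMap r).symm
  have hpo := isPushout_hom f rfl
  obtain ⟨Ω, _, g₁, g₂, hg, hker⟩ := exists_common_field _ _ x y h
  let _ : Algebra X.R Ω := (g₁.comp (algebraMap X.R X.T)).toAlgebra
  let g₁' : X.T →ₐ[X.R] Ω := { g₁ with commutes' := fun r => rfl }
  let g₂' : Y.R →ₐ[X.R] Ω := { g₂ with commutes' := fun r => (RingHom.congr_fun hg r).symm }
  let l : Y.T →ₐ[X.R] Ω := Algebra.pushoutDesc Y.T g₂' g₁' fun _ _ => mul_comm _ _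
  refine ⟨⟨RingHom.ker l.toRingHom, RingHom.ker_isPrime _⟩, ?_⟩
  ext r
  rw [← hker]
  change l (algebraMap X.T Y.T r) = 0 ↔ g₁ r = 0
  rw [show l (algebraMap X.T Y.T r) = g₁ r from Algebra.pushoutDesc_right _ _ _ _ r]

/-- A family of morphisms `Y i ⟶ X` of the stack is an étale cover if the maps of base schemes
`Spec (Y i).R ⟶ Spec X.R` are étale and jointly surjective. -/
structure IsEtaleCover {X : Mbar} {ι : Type} (Y : ι → Mbar) (f : ∀ i, Y i ⟶ X) : Prop where
  etale : ∀ i, (f i).base.toRingHom.Etale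
  surjective : ∀ x : PrimeSpectrum X.R, ∃ i, ∃ y : PrimeSpectrum (Y i).R,
    PrimeSpectrum.comap (f i).base.toRingHom y = x

theorem existsUnique_glue {X : Mbar} {ι : Type} [Finite ι] (Y : ι → Mbar) (f : ∀ i, Y i ⟶ X)
    (hf : IsEtaleCover Y f) (t : ∀ i, (Y i).T)
    (ht : ∀ i j (Z : Mbar) (p : Z ⟶ Y i) (q : Z ⟶ Y j), p ≫ f i = q ≫ f j →
      p.total (t i) = q.total (t j)) :
    ∃! s : X.T, ∀ i, (f i).total s = t i := by
  classical
  have := Fintype.ofFinite ι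
  let _ : ∀ i, Algebra X.T (Y i).T := fun i => (f i).total.toAlgebra
  let P := ∀ i, (Y i).T
  have : ∀ i, Module.Flat X.T (Y i).T := fun i => flat_total (f i) (hf.etale i)
  have : Module.Flat X.T P :=
    Module.Flat.of_linearEquiv (DirectSum.linearEquivFunOnFintype X.T ι (fun i => (Y i).T)).symm
  have hs : Function.Surjective (PrimeSpectrum.comap (algebraMap X.T P)) := by
    intro x
    obtain ⟨i, y, hy⟩ := hf.surjective (PrimeSpectrum.comap (algebraMap X.R X.T) x)
    obtain ⟨z, hz⟩ := exists_comap_total (f i) x y hy.symm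
    exact ⟨PrimeSpectrum.comap (Pi.evalRingHom _ i) z, hz⟩
  have hff : Module.FaithfullyFlat X.T P := Module.FaithfullyFlat.of_comap_surjective hs
  have hinj : Function.Injective (algebraMap X.T P) := FaithfulSMul.algebraMap_injective _ _
  have hij : ∀ i j, t i ⊗ₜ[X.T] (1 : (Y j).T) = (1 : (Y i).T) ⊗ₜ[X.T] t j := by
    intro i j
    obtain ⟨Z, p, q, hpq, -, -, h⟩ := exists_pullback (f i) (f j)
    exact h _ _ (ht i j Z p q hpq)
  have heq : t ⊗ₜ[X.T] (1 : P) = (1 : P) ⊗ₜ[X.T] t := by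
    have hsum : ∀ u v : P, u ⊗ₜ[X.T] v = ∑ i, ∑ j,
        TensorProduct.map (LinearMap.single X.T (fun i => (Y i).T) i)
          (LinearMap.single X.T (fun i => (Y i).T) j) (u i ⊗ₜ v j) := by
      intro u v
      conv_lhs => rw [← Finset.univ_sum_single u, ← Finset.univ_sum_single v]
      rw [TensorProduct.sum_tmul]
      refine Finset.sum_congr rfl fun i _ => ?_
      rw [TensorProduct.tmul_sum]
      rfl
    rw [hsum, hsum]
    refine Finset.sum_congr rfl fun i _ => Finset.sum_congr rfl fun j _ => ?_
    exact congrArg _ (hij i j)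
  have hex : t ∈ Set.range (algebraMap X.T P) := by
    rw [← (Algebra.IsEffective.of_faithfullyFlat X.T P).eqLocus_includeLeft_includeRight]
    exact heq
  obtain ⟨s, hs⟩ := hex
  refine ⟨s, fun i => congrFun hs i, fun s' hs' => hinj ?_⟩
  rw [hs]
  exact funext hs'

theorem total_decompose {X Y : Mbar} (f : Y ⟶ X) (t : X.T) (n : ℤ) :
    f.total (DirectSum.decompose X.grading t n) = DirectSum.decompose Y.grading (f.total t) n := by
  induction t using DirectSum.Decomposition.inductionOn X.grading with
  | zero => simp
  | @homogeneous i m =>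
    have hm := f.total_mem i m m.2
    by_cases h : i = n
    · subst h
      rw [DirectSum.decompose_of_mem_same _ m.2, DirectSum.decompose_of_mem_same _ hm]
    · rw [DirectSum.decompose_of_mem_ne _ m.2 h, DirectSum.decompose_of_mem_ne _ hm h, map_zero]
  | add x y hx hy => simp [DirectSum.decompose_add, hx, hy]

/-- The big (affine) étale site of the stack: the topology on the fibred category which is
inherited from the étale topology on affine schemes. A sieve is covering if it contains a finite
étale cover (affine schemes are quasi-compact, so that finite families suffice). -/
def etaleTopology : GrothendieckTopology Mbar where
  sieves X := {S | ∃ (ι : Type) (_ : Finite ι) (Y : ι → Mbar) (f : ∀ i, Y i ⟶ X),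
    IsEtaleCover Y f ∧ ∀ i, S (f i)}
  top_mem' X := ⟨Unit, inferInstance, fun _ => X, fun _ => 𝟙 X,
    ⟨fun _ => RingHom.Etale.of_bijective Function.bijective_id, fun x => ⟨(), x, rfl⟩⟩,
    fun _ => trivial⟩
  pullback_stable' X Y S g := by
    rintro ⟨ι, _, U, f, hf, hS⟩
    choose Z p q hpq het hsu _ using fun i => exists_pullback g (f i)
    refine ⟨ι, inferInstance, Z, p, ⟨fun i => het i (hf.etale i), fun y => ?_⟩, fun i => ?_⟩
    · obtain ⟨i, u, hu⟩ := hf.surjective (PrimeSpectrum.comap g.base.toRingHom y)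
      exact ⟨i, hsu i y u hu.symm⟩
    · change S (p i ≫ g)
      rw [hpq]
      exact S.downward_closed (hS i) _
  transitive' X S := by
    rintro ⟨ι, _, U, f, hf, hS⟩ S' h
    choose κ hκ V g hg hgS using fun i => h (hS i)
    refine ⟨Σ i, κ i, inferInstance, fun a => V a.1 a.2, fun a => g a.1 a.2 ≫ f a.1,
      ⟨fun a => ?_, fun x => ?_⟩, fun a => hgS a.1 a.2⟩
    · exact RingHom.Etale.stableUnderComposition _ _ (hf.etale a.1) ((hg a.1).etale a.2)
    · obtain ⟨i, u, rfl⟩ := hf.surjective x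
      obtain ⟨j, v, rfl⟩ := (hg i).surjective u
      exact ⟨⟨i, j⟩, v, rfl⟩


/-- Restriction of sections of degree `n` along a morphism of the stack. -/
def restrict (n : ℤ) {X Y : Mbar} (f : X ⟶ Y) : Y.grading n →+ X.grading n where
  toFun t := ⟨f.total t, f.total_mem n t t.2⟩
  map_zero' := Subtype.ext (map_zero f.total)
  map_add' _ _ := Subtype.ext (map_add f.total _ _)

/-- The line bundle `𝒪(n)` as a presheaf on the site of the stack: its sections over
`(Spec T ⟶ Spec R, A, B)` are the functions of weight `n` on the torsor, that is `Tₙ`. In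
particular `A` and `B` are sections of `𝒪(1)` and `𝒪(3)`. (The sections are lifted to `Type 1`
since the site is a category of rings in `Type`.) -/
def twistPresheaf (n : ℤ) : Mbarᵒᵖ ⥤ AddCommGrpCat.{1} where
  obj X := AddCommGrpCat.of (ULift.{1} (X.unop.grading n))
  map f := AddCommGrpCat.ofHom
    (AddEquiv.ulift.symm.toAddMonoidHom.comp ((restrict n f.unop).comp AddEquiv.ulift.toAddMonoidHom))

theorem twistPresheaf_isSheaf (n : ℤ) : Presheaf.IsSheaf etaleTopology (twistPresheaf n) := by
  rw [Presheaf.isSheaf_iff_isSheaf_forget _ _ (forget AddCommGrpCat.{1}), isSheaf_iff_isSheaf_of_type]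
  rintro X S ⟨ι, _, Y, f, hf, hS⟩ x hx
  have hmap : ∀ {U V : Mbar} (g : U ⟶ V) (t : V.grading n),
      ((((twistPresheaf n ⋙ forget AddCommGrpCat.{1}).map g.op) (ULift.up t)).down : U.T) =
        g.total t := fun _ _ => rfl
  have hpull : ∀ {U V : Mbar} (k : V ⟶ X) (hk : S k) (g : U ⟶ V),
      g.total (x k hk).down.1 = (x (g ≫ k) (S.downward_closed hk g)).down.1 := by
    intro U V k hk g
    have := hx g (𝟙 U) hk (S.downward_closed hk g) (by simp)
    have := congrArg (fun z => (ULift.down z).1) this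
    exact this
  have hcongr : ∀ {U : Mbar} (k k' : U ⟶ X) (hk : S k) (hk' : S k'), k = k' →
      (x k hk).down.1 = (x k' hk').down.1 := by
    rintro U k _ hk hk' rfl
    rfl
  obtain ⟨s, hs, huniq⟩ := existsUnique_glue Y f hf (fun i => (x (f i) (hS i)).down.1) (by
    intro i j Z p q hpq
    rw [hpull, hpull]
    exact hcongr _ _ _ _ hpq)
  have hsn : s ∈ X.grading n := by
    have : (DirectSum.decompose X.grading s n : X.T) = s := by
      apply huniq
      intro i
      rw [total_decompose, hs]
      exact DirectSum.decompose_of_mem_same _ (x (f i) (hS i)).down.2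
    rw [← this]
    exact SetLike.coe_mem _
  refine ⟨ULift.up ⟨s, hsn⟩, fun U g hg => ?_, fun y hy => ?_⟩
  · apply ULift.ext
    apply Subtype.ext
    change g.total s = (x g hg).down.1
    choose Z p q hpq het hsu _ using fun i => exists_pullback g (f i)
    have hcov : IsEtaleCover Z p := by
      refine ⟨fun i => het i (hf.etale i), fun y => ?_⟩
      obtain ⟨i, u, hu⟩ := hf.surjective (PrimeSpectrum.comap g.base.toRingHom y)
      exact ⟨i, hsu i y u hu.symm⟩
    obtain ⟨_, _, hu⟩ := existsUnique_glue Z p hcov (fun i => (p i).total (x g hg).down.1) (by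
      intro i j W a b hab
      have := congrArg (fun h => h.total (x g hg).down.1) hab
      exact this)
    refine (hu _ fun i => ?_).trans (hu _ fun i => rfl).symm
    have h1 : (p i).total (g.total s) = (q i).total ((f i).total s) :=
      congrArg (fun h => h.total s) (hpq i)
    rw [h1, hs, hpull, hpull]
    exact hcongr _ _ _ _ (hpq i).symm
  · apply ULift.ext
    apply Subtype.ext
    refine huniq _ fun i => ?_
    exact congrArg (fun z => (ULift.down z).1) (hy (f i) (hS i))

/-- The sheaf `𝒪(n)` on the étale site of the stack. -/
def twist (n : ℤ) : Sheaf etaleTopology AddCommGrpCat.{1} :=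
  ⟨twistPresheaf n, twistPresheaf_isSheaf n⟩


instance : IsGrothendieckAbelian.{1} (Sheaf etaleTopology AddCommGrpCat.{1}) := by
  have : EssentiallySmall.{1} Mbar := inferInstance
  exact Sheaf.isGrothendieckAbelian_of_essentiallySmall etaleTopology AddCommGrpCat.{1}

/-- The sheaf cohomology group `Hⁱ(M, 𝒪(n))`. -/
abbrev H (i : ℕ) (n : ℤ) : Type 1 := Sheaf.H (twist n) i

/-- `s` is a global section of `𝒪(m)`: a compatible family of sections over all objects. -/
structure IsGlobalSection (m : ℤ) (s : ∀ X : Mbar, X.T) : Prop where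
  mem : ∀ X, s X ∈ X.grading m
  total : ∀ {X Y : Mbar} (f : X ⟶ Y), f.total (s Y) = s X

/-- Multiplication by a global section of `𝒪(m)`, as a map of sheaves `𝒪(n) ⟶ 𝒪(m + n)`. -/
def mulSection {m n k : ℤ} (h : m + n = k) {s : ∀ X : Mbar, X.T} (hs : IsGlobalSection m s) :
    twist n ⟶ twist k where
  hom :=
    { app := fun X => AddCommGrpCat.ofHom
        { toFun := fun t => ULift.up ⟨s X.unop * t.down.1,
            h ▸ SetLike.mul_mem_graded (hs.mem X.unop) t.down.2⟩
          map_zero' := ULift.ext _ _ (Subtype.ext (mul_zero _))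
          map_add' := fun _ _ => ULift.ext _ _ (Subtype.ext (mul_add _ _ _)) }
      naturality := fun X Y f => by
        ext t
        apply ULift.ext
        apply Subtype.ext
        change s Y.unop * f.unop.total t.down.1 = f.unop.total (s X.unop * t.down.1)
        rw [map_mul, hs.total] }

/-- The global section of `𝒪(m)` that corresponds to a class in `H⁰(M, 𝒪(m))`. -/
def sectionOf {m : ℤ} (x : H 0 m) (X : Mbar) : X.T :=
  (((twist m).ΓRes (op X)) ((constantSheafΓAdj etaleTopology AddCommGrpCat.{1}).homEquiv _ _
    (Abelian.Ext.addEquiv₀ x) (ULift.up (1 : ℤ)))).down.1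

theorem isGlobalSection_sectionOf {m : ℤ} (x : H 0 m) : IsGlobalSection m (sectionOf x) where
  mem X := Subtype.prop _
  total {X Y} f := by
    have h := ConcreteCategory.congr_hom ((twist m).ΓRes_map f.op)
      ((constantSheafΓAdj etaleTopology AddCommGrpCat.{1}).homEquiv _ _
        (Abelian.Ext.addEquiv₀ x) (ULift.up (1 : ℤ)))
    exact congrArg (fun z => (ULift.down z).1) h

/-- The product `H⁰(M, 𝒪(m)) × Hⁱ(M, 𝒪(n)) → Hⁱ(M, 𝒪(m + n))`: the map induced on `Hⁱ` by
multiplication with a global section. For `i = 0` it is the multiplication of the graded ring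
`H⁰(M, 𝒪(*))`, and in general it is the module structure over this ring. -/
def cup {i : ℕ} {m n k : ℤ} (h : m + n = k) (x : H 0 m) (y : H i n) : H i k :=
  Sheaf.H.map (mulSection h (isGlobalSection_sectionOf x)) i y

theorem sectionOf_cup {m n k : ℤ} (h : m + n = k) (x : H 0 m) (y : H 0 n) (X : Mbar) :
    sectionOf (cup h x y) X = sectionOf x X * sectionOf y X := by
  conv_lhs => unfold sectionOf cup
  rw [Sheaf.H.addEquiv₀_map, Adjunction.homEquiv_naturality_right]
  have := ConcreteCategory.congr_hom
    (Sheaf.ΓRes_naturality (mulSection h (isGlobalSection_sectionOf x)) (op X))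
    ((constantSheafΓAdj etaleTopology AddCommGrpCat.{1}).homEquiv _ _
      (Abelian.Ext.addEquiv₀ y) (ULift.up (1 : ℤ)))
  exact congrArg (fun z => (ULift.down z).1) this

end Mbar

/-- The polynomial ring `ℤ_(2)[A, B]`, where `A = X 0` and `B = X 1`. -/
abbrev PolyAB : Type := MvPolynomial (Fin 2) Z2

namespace PolyAB
open MvPolynomial

/-- The polynomials of degree `n`, where `|A| = 1` and `|B| = 3`. It is zero for `n < 0`. -/
abbrev homogeneous (n : ℤ) : Submodule Z2 PolyAB :=
  weightedHomogeneousSubmodule Z2 (![1, 3] : Fin 2 → ℤ) n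

theorem mul_mem {m n k : ℤ} (h : m + n = k) {f g : PolyAB} (hf : f ∈ homogeneous m)
    (hg : g ∈ homogeneous n) : f * g ∈ homogeneous k :=
  h ▸ IsWeightedHomogeneous.mul hf hg

theorem A_mem : (X 0 : PolyAB) ∈ homogeneous 1 := isWeightedHomogeneous_X Z2 ![1, 3] 0
theorem B_mem : (X 1 : PolyAB) ∈ homogeneous 3 := isWeightedHomogeneous_X Z2 ![1, 3] 1

/-- The value `f(A, B)` of a polynomial at the tautological sections `A` and `B`. -/
def eval (f : PolyAB) (X : Mbar) : X.T :=
  f.eval₂ ((algebraMap X.R X.T).comp (algebraMap Z2 X.R)) ![X.A, X.B]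

/-- The ring `ℤ_(2)[A, B][1/(AB)]`. -/
abbrev Fractions : Type := Localization.Away (X 0 * X 1 : PolyAB)

/-- The submodule `ℤ_(2)[A, B][1/A] + ℤ_(2)[A, B][1/B]` of `ℤ_(2)[A, B][1/(AB)]`. -/
def partialFractions : Submodule PolyAB Fractions :=
  Submodule.span PolyAB
    ({x | ∃ (k : ℕ) (r : PolyAB), (X 0 ^ k : PolyAB) • x = algebraMap PolyAB Fractions r} ∪
     {x | ∃ (k : ℕ) (r : PolyAB), (X 1 ^ k : PolyAB) • x = algebraMap PolyAB Fractions r})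

/-- The module `ℤ_(2)[A, B]/(A^∞, B^∞)`, that is `ℤ_(2)[A, B][1/(AB)]` modulo
`ℤ_(2)[A, B][1/A] + ℤ_(2)[A, B][1/B]`. It is free over `ℤ_(2)` on the classes of
`A⁻ⁱ B⁻ʲ · 1/(AB)` for `i, j ≥ 0`. -/
abbrev TorsionQuotient : Type := Fractions ⧸ partialFractions

/-- The degree `n` part of `ℤ_(2)[A, B]/(A^∞, B^∞)`: the classes of the fractions `f/(AB)ᵏ` with `f`
homogeneous of degree `n + 4k`. -/
def torsionPiece (n : ℤ) : AddSubgroup TorsionQuotient :=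
  AddSubgroup.closure {q | ∃ (x : Fractions) (k : ℕ) (f : PolyAB), f ∈ homogeneous (n + 4 * k) ∧
    ((X 0 * X 1 : PolyAB) ^ k) • x = algebraMap PolyAB Fractions f ∧
    Submodule.Quotient.mk x = q}

theorem smul_mem {m n k : ℤ} (h : m + n = k) {f : PolyAB} (hf : f ∈ homogeneous m)
    {q : TorsionQuotient} (hq : q ∈ torsionPiece n) : f • q ∈ torsionPiece k := by
  induction hq using AddSubgroup.closure_induction with
  | mem q hq =>
    obtain ⟨x, l, g, hg, hx, rfl⟩ := hq
    refine AddSubgroup.subset_closure ⟨f • x, l, f * g, mul_mem (by lia) hf hg, ?_, rfl⟩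
    rw [smul_comm, hx, Algebra.smul_def, map_mul]
  | zero => rw [smul_zero]; exact zero_mem _
  | add x y _ _ hx hy => rw [smul_add]; exact add_mem hx hy
  | neg x _ hx => rw [smul_neg]; exact neg_mem hx

/-- The class of `1/(AB)`. -/
def invAB : TorsionQuotient :=
  Submodule.Quotient.mk (IsLocalization.Away.invSelf (X 0 * X 1 : PolyAB))

theorem invAB_mem : invAB ∈ torsionPiece (-4) := by
  refine AddSubgroup.subset_closure ⟨_, 1, 1, ?_, ?_, rfl⟩
  · exact isWeightedHomogeneous_one Z2 _
  · rw [pow_one, Algebra.smul_def, IsLocalization.Away.mul_invSelf, map_one]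

end PolyAB
end StackCohomology

end

open StackCohomology

/-!
The cohomology of `𝒪(n)` is computed by the Mayer–Vietoris sequence of the two open substacks where
`A`, respectively `B`, is invertible. They cover the stack since `A` and `B` generate the unit ideal,
and only the following has to be known about them: the sections of `𝒪(n)` over each of them and over
their intersection are the homogeneous elements of degree `n` of `ℤ_(2)[A, B][1/A]`,
`ℤ_(2)[A, B][1/B]` and `ℤ_(2)[A, B][1/(AB)]`, and `𝒪(n)` has no higher cohomology there.

Open substacks are treated as presheaves of sets on the site of the stack: the functor of points
`GradedPair.points` of a graded ring with elements `A` and `B`. Where `A` is invertible, the substack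
is affine, hence representable. Where `B` is invertible, the étale cover that adjoins a cube root of
`B` (this uses that `3` is invertible in `ℤ_(2)`) is representable, because a homogeneous unit of
degree `1` trivializes the torsor. The map of graded rings that describes the cover is pure, even
split, so that its Amitsur complex is exact (`CechModel.exists_of_d_eq_zero`). Taking homogeneous
parts, the Čech complexes of `𝒪(n)` for such covers are exact in positive degrees
(`GradedPair.cechExact_twist`), and the sections of `𝒪(n)` over the substack are as stated
(`GradedPair.toSection_surjective`).

The passage from Čech complexes to derived functors is Cartan's criterion
`IsCechClass.subsingleton_ext`, in the following form. Take a class of locally surjective maps of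
presheaves with representable fibre powers, such that lifts along epimorphisms of sheaves exist on
a cover in the class. If the Čech complexes of a sheaf `F` for the covers of the class are exact, the
same holds for the quotient of an injective sheaf by `F`, and dimension shifting shows that the
`Ext` groups from the free sheaf on the target of a cover to `F` vanish in positive degrees. The
class `torsorCover` consists of all pure and locally surjective maps from torsors to quotient stacks;
it has the lifting property since every finite étale cover can be replaced by the disjoint union of
its members, which is faithfully flat.

The Mayer–Vietoris sequence comes from the short exact sequence of sheaves
`0 → ℤ[U ∩ V] → ℤ[U] ⊞ ℤ[V] → ℤ → 0` (`IsSubterminalCover.shortExact`). It shows that the cohomology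
vanishes in degrees at least `2`, and leaves elementary statements about Laurent polynomials. A
global section is a Laurent polynomial without negative exponents of `A` and of `B`, that is a
polynomial (`polySection_bijective`). The first cohomology group consists of the Laurent polynomials
modulo those without monomials `Aⁱ Bʲ` with `i, j < 0`, which is the degree `n` part of
`ℤ_(2)[A, B]/(A^∞, B^∞)` (`exists_torsionPiece_equiv`). For the duality, the coefficient of
`A⁻¹ B⁻¹` identifies `H¹(𝒪(-4))` with `ℤ_(2)`, and the monomials `Aⁱ Bʲ` and `A⁻¹⁻ⁱ B⁻¹⁻ʲ` are dual
bases for the resulting pairing; additive maps between `ℤ_(2)`-modules are automatically linear.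
-/

/-! ### Sections of a presheaf of groups over a presheaf of sets -/

namespace StackCohomology

universe w v u

section Sections

variable {C : Type u} [Category.{v} C]

/-- The group of sections of a presheaf of abelian groups `G` over a presheaf of sets `Q`, that is
of the natural families of maps `Q(Z) → G(Z)`. -/
def sections (Q : Cᵒᵖ ⥤ Type w) (G : Cᵒᵖ ⥤ AddCommGrpCat.{w}) :
    AddSubgroup (∀ Z : Cᵒᵖ, Q.obj Z → G.obj Z) where
  carrier := {s | ∀ ⦃Z W : Cᵒᵖ⦄ (f : Z ⟶ W) (q : Q.obj Z), G.map f (s Z q) = s W (Q.map f q)}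
  add_mem' ha hb Z W f q := by simp [ha f q, hb f q]
  zero_mem' := by simp
  neg_mem' ha Z W f q := by simp [ha f q]

namespace sections

variable {P Q R : Cᵒᵖ ⥤ Type w} {G G' G'' : Cᵒᵖ ⥤ AddCommGrpCat.{w}}

theorem map_apply (s : sections Q G) {Z W : Cᵒᵖ} (f : Z ⟶ W) (q : Q.obj Z) :
    G.map f (s.1 Z q) = s.1 W (Q.map f q) := s.2 f q

theorem ext {s t : sections Q G} (h : ∀ Z q, s.1 Z q = t.1 Z q) : s = t :=
  Subtype.ext (funext fun Z => funext fun q => h Z q)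

/-- Pullback of sections along a map of presheaves of sets. -/
def pullback (G : Cᵒᵖ ⥤ AddCommGrpCat.{w}) (π : P ⟶ Q) : sections Q G →+ sections P G where
  toFun s := ⟨fun Z p => s.1 Z (π.app Z p), fun Z W f p => by
    exact (map_apply s f _).trans (congrArg (s.1 W) (NatTrans.naturality_apply π f p).symm)⟩
  map_zero' := rfl
  map_add' _ _ := rfl

/-- The image of sections under a map of presheaves of abelian groups. -/
def push (Q : Cᵒᵖ ⥤ Type w) (g : G ⟶ G') : sections Q G →+ sections Q G' where
  toFun s := ⟨fun Z q => g.app Z (s.1 Z q), fun Z W f q => by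
    exact (NatTrans.naturality_apply g f _).symm.trans (congrArg (g.app W) (map_apply s f q))⟩
  map_zero' := ext fun Z q => map_zero (g.app Z).hom
  map_add' _ _ := ext fun Z q => map_add (g.app Z).hom _ _

@[simp] theorem pullback_apply (π : P ⟶ Q) (s : sections Q G) (Z : Cᵒᵖ) (p : P.obj Z) :
    (pullback G π s).1 Z p = s.1 Z (π.app Z p) := rfl

@[simp] theorem push_apply (g : G ⟶ G') (s : sections Q G) (Z : Cᵒᵖ) (q : Q.obj Z) :
    (push Q g s).1 Z q = g.app Z (s.1 Z q) := rfl

/-- Sections over `Q` are the maps out of the free presheaf of abelian groups on `Q`. -/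
def freeEquiv (Q : Cᵒᵖ ⥤ Type w) (G : Cᵒᵖ ⥤ AddCommGrpCat.{w}) :
    (Q ⋙ AddCommGrpCat.free ⟶ G) ≃+ sections Q G where
  toFun φ := ⟨fun Z q => φ.app Z (FreeAbelianGroup.of q), fun Z W f q => by
    have h := NatTrans.naturality_apply φ f (FreeAbelianGroup.of q)
    exact h.symm.trans (congrArg (φ.app W) (FreeAbelianGroup.map_of_apply q))⟩
  invFun s :=
    { app := fun Z => AddCommGrpCat.ofHom (FreeAbelianGroup.lift (s.1 Z))
      naturality := fun Z W f => by
        refine AddCommGrpCat.hom_ext (FreeAbelianGroup.lift_ext _ _ fun q => ?_)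
        change FreeAbelianGroup.lift (s.1 W) (FreeAbelianGroup.map _ (FreeAbelianGroup.of q)) =
          G.map f (FreeAbelianGroup.lift (s.1 Z) (FreeAbelianGroup.of q))
        rw [FreeAbelianGroup.map_of_apply, FreeAbelianGroup.lift_apply_of,
          FreeAbelianGroup.lift_apply_of, map_apply] }
  left_inv φ := by
    refine NatTrans.ext (funext fun Z => ?_)
    exact AddCommGrpCat.hom_ext (FreeAbelianGroup.lift_ext _ _ fun q =>
      FreeAbelianGroup.lift_apply_of _ _)
  right_inv s := ext fun Z q => FreeAbelianGroup.lift_apply_of _ _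
  map_add' _ _ := rfl

theorem freeEquiv_apply (φ : Q ⋙ AddCommGrpCat.free ⟶ G) (Z : Cᵒᵖ) (q : Q.obj Z) :
    (freeEquiv Q G φ).1 Z q = φ.app Z (FreeAbelianGroup.of q) := rfl

/-- `p` is a universal element of the presheaf of sets `P`: every element is the restriction of `p`
along a unique morphism. -/
def IsUniversal {Y : C} (p : P.obj (op Y)) : Prop :=
  ∀ ⦃Z : C⦄ (q : P.obj (op Z)), ∃! f : Z ⟶ Y, P.map f.op p = q

/-- Evaluation at a universal element is bijective. -/
theorem IsUniversal.exists_section {Y : C} {p : P.obj (op Y)} (hp : IsUniversal p)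
    (x : G.obj (op Y)) : ∃ s : sections P G, s.1 (op Y) p = x := by
  choose f hf hu using hp
  refine ⟨⟨fun Z q => G.map (f (Z := Z.unop) q).op x, fun Z W g q => ?_⟩, ?_⟩
  · have := hu (Z := W.unop) (P.map g q) (g.unop ≫ f (Z := Z.unop) q) (by
      change P.map ((f (Z := Z.unop) q).op ≫ g) p = _
      rw [P.map_comp, ConcreteCategory.comp_apply]
      exact congrArg _ (hf (Z := Z.unop) q))
    change _ = G.map (f (Z := W.unop) (P.map g q)).op x
    rw [← this]
    change G.map g (G.map _ x) = G.map ((f (Z := Z.unop) q).op ≫ g) x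
    rw [G.map_comp, ConcreteCategory.comp_apply]
  · change G.map (f p).op x = x
    rw [← hu p (𝟙 Y) (by simp)]
    simp

theorem IsUniversal.ext {Y : C} {p : P.obj (op Y)} (hp : IsUniversal p)
    {s t : sections P G} (h : s.1 (op Y) p = t.1 (op Y) p) : s = t := by
  refine sections.ext fun Z q => ?_
  obtain ⟨f, hf, -⟩ := hp (Z := Z.unop) q
  have hf' : P.map f.op p = q := hf
  rw [← hf', ← map_apply, ← map_apply, h]

/-- Sections over a presheaf with a universal element lift along objectwise surjections. -/
theorem IsUniversal.push_surjective {Y : C} {p : P.obj (op Y)} (hp : IsUniversal p) (g : G ⟶ G')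
    (hg : Function.Surjective (g.app (op Y))) : Function.Surjective (push P g) := by
  intro s
  obtain ⟨x, hx⟩ := hg (s.1 _ p)
  obtain ⟨t, ht⟩ := hp.exists_section x
  exact ⟨t, hp.ext (by rw [push_apply, ht, hx])⟩

/-- Left exactness of sections for an objectwise left exact sequence. -/
theorem exists_of_push_eq_zero (f : G ⟶ G') (g : G' ⟶ G'')
    (hf : ∀ Z, Function.Injective (f.app Z))
    (hfg : ∀ Z (x : G'.obj Z), g.app Z x = 0 → ∃ y, f.app Z y = x) (s : sections Q G')
    (hs : push Q g s = 0) : ∃ t : sections Q G, push Q f t = s := by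
  have h : ∀ Z q, ∃ y, f.app Z y = s.1 Z q := fun Z q =>
    hfg Z _ (congrFun (congrFun (congrArg Subtype.val hs) Z) q)
  choose t ht using h
  refine ⟨⟨t, fun Z W φ q => hf W ?_⟩, ext fun Z q => ht Z q⟩
  rw [NatTrans.naturality_apply f φ, ht, ht, map_apply]

theorem push_injective (f : G ⟶ G') (hf : ∀ Z, Function.Injective (f.app Z)) :
    Function.Injective (push Q f) := fun _ _ h => ext fun Z q =>
  hf Z (congrFun (congrFun (congrArg Subtype.val h) Z) q)

end sections

end Sections

/-! ### Čech cochains of a map of presheaves of sets -/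

section Cech

variable {C : Type u} [Category.{v} C] {P Q : Cᵒᵖ ⥤ Type w}

/-- The presheaf of `m`-tuples of elements of `P` over the same element of `Q`: the `m`-fold fibre
power of `P` over `Q`. For `m = 0` it is `Q`. -/
def fibrePower (π : P ⟶ Q) (m : ℕ) : Cᵒᵖ ⥤ Type w where
  obj Z := {x : Q.obj Z × (Fin m → P.obj Z) // ∀ i, π.app Z (x.2 i) = x.1}
  map {_ _} f := ↾fun x => ⟨(Q.map f x.1.1, fun i => P.map f (x.1.2 i)), fun i => by
    rw [← x.2 i, NatTrans.naturality_apply π f]⟩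
  map_id Z := by ext x <;> simp
  map_comp f g := by ext x <;> simp

namespace fibrePower

variable {π : P ⟶ Q} {m : ℕ}

theorem hext {Z : Cᵒᵖ} {x y : (fibrePower π m).obj Z} (h₁ : x.1.1 = y.1.1)
    (h₂ : ∀ i, x.1.2 i = y.1.2 i) : x = y :=
  Subtype.ext (Prod.ext h₁ (funext h₂))

/-- Omitting the `i`-th element of a tuple. -/
def face (π : P ⟶ Q) (m : ℕ) (i : Fin (m + 1)) : fibrePower π (m + 1) ⟶ fibrePower π m where
  app _ := ↾fun x => ⟨(x.1.1, fun j => x.1.2 (i.succAbove j)), fun _ => x.2 _⟩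
  naturality _ _ _ := rfl

/-- Adding an element at the front of a tuple. -/
def cons {Z : Cᵒᵖ} (p : P.obj Z) (x : (fibrePower π m).obj Z) (h : π.app Z p = x.1.1) :
    (fibrePower π (m + 1)).obj Z :=
  ⟨(x.1.1, Fin.cons p x.1.2), fun i => by
    refine Fin.cases ?_ (fun j => ?_) i
    · exact h
    · exact x.2 j⟩

theorem face_succ_cons {Z : Cᵒᵖ} (i : Fin (m + 1)) (p : P.obj Z)
    (x : (fibrePower π (m + 1)).obj Z) (h : π.app Z p = x.1.1) :
    (face π (m + 1) i.succ).app Z (cons p x h) = cons p ((face π m i).app Z x) h := by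
  refine hext rfl fun j => ?_
  change (Fin.cons p x.1.2 : Fin (m + 2) → P.obj Z) (i.succ.succAbove j) =
    (Fin.cons p (fun k => x.1.2 (i.succAbove k)) : Fin (m + 1) → P.obj Z) j
  refine Fin.cases ?_ (fun k => ?_) j
  · rfl
  · rw [Fin.succ_succAbove_succ, Fin.cons_succ, Fin.cons_succ]

end fibrePower

open fibrePower sections

/-- The Čech differential, the alternating sum of the pullbacks along the face maps. -/
def cechD (π : P ⟶ Q) (G : Cᵒᵖ ⥤ AddCommGrpCat.{w}) (m : ℕ) :
    sections (fibrePower π m) G →+ sections (fibrePower π (m + 1)) G :=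
  ∑ i : Fin (m + 1), (-1 : ℤ) ^ (i : ℕ) • pullback G (face π m i)

theorem sections.sum_apply {Q : Cᵒᵖ ⥤ Type w} {G : Cᵒᵖ ⥤ AddCommGrpCat.{w}} {ι : Type*}
    (s : Finset ι) (f : ι → sections Q G) (Z : Cᵒᵖ) (q : Q.obj Z) :
    (∑ i ∈ s, f i).1 Z q = ∑ i ∈ s, (f i).1 Z q := by
  rw [AddSubgroup.val_finsetSum, Finset.sum_apply, Finset.sum_apply]

theorem cechD_apply {π : P ⟶ Q} {G : Cᵒᵖ ⥤ AddCommGrpCat.{w}} {m : ℕ}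
    (c : sections (fibrePower π m) G) (Z : Cᵒᵖ) (x : (fibrePower π (m + 1)).obj Z) :
    (cechD π G m c).1 Z x =
      ∑ i : Fin (m + 1), (-1 : ℤ) ^ (i : ℕ) • c.1 Z ((face π m i).app Z x) := by
  rw [cechD, AddMonoidHom.finsetSum_apply, sections.sum_apply]
  rfl

theorem cechD_push {π : P ⟶ Q} {G G' : Cᵒᵖ ⥤ AddCommGrpCat.{w}} (g : G ⟶ G') {m : ℕ}
    (c : sections (fibrePower π m) G) : cechD π G' m (push _ g c) = push _ g (cechD π G m c) := by
  refine sections.ext fun Z x => ?_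
  rw [cechD_apply, push_apply, cechD_apply, map_sum]
  simp

/-- The Čech complex of `G` is exact at all tuples of positive length. -/
def CechExact (π : P ⟶ Q) (G : Cᵒᵖ ⥤ AddCommGrpCat.{w}) : Prop :=
  ∀ (m : ℕ) (c : sections (fibrePower π (m + 1)) G), cechD π G (m + 1) c = 0 →
    ∃ b : sections (fibrePower π m) G, cechD π G m b = c

/-- The alternating sum of all faces, as a map of free presheaves of abelian groups. -/
def freeD (π : P ⟶ Q) (m : ℕ) :
    fibrePower π (m + 1) ⋙ AddCommGrpCat.free ⟶ fibrePower π m ⋙ AddCommGrpCat.free :=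
  (freeEquiv _ _).symm (cechD π _ m (freeEquiv _ _ (𝟙 _)))

theorem freeEquiv_freeD_comp {π : P ⟶ Q} {G : Cᵒᵖ ⥤ AddCommGrpCat.{w}} {m : ℕ}
    (φ : fibrePower π m ⋙ AddCommGrpCat.free ⟶ G) :
    freeEquiv _ _ (freeD π m ≫ φ) = cechD π G m (freeEquiv _ _ φ) := by
  have h1 : ∀ {P : Cᵒᵖ ⥤ Type w} {G G' : Cᵒᵖ ⥤ AddCommGrpCat.{w}}
      (ψ : P ⋙ AddCommGrpCat.free ⟶ G) (φ : G ⟶ G'),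
      freeEquiv _ _ (ψ ≫ φ) = push _ φ (freeEquiv _ _ ψ) := fun _ _ => rfl
  rw [h1, freeD, AddEquiv.apply_symm_apply, ← cechD_push, ← h1, Category.id_comp]

/-- The simplicial identity `d ∘ d = 0` for functions on tuples. -/
theorem alternatingSum_succAbove_succAbove {E A : Type*} [AddCommGroup A] (m : ℕ)
    (c : (Fin m → E) → A) (x : Fin (m + 2) → E) :
    ∑ i : Fin (m + 2), (-1 : ℤ) ^ (i : ℕ) • ∑ j : Fin (m + 1), (-1 : ℤ) ^ (j : ℕ) •
      c (fun k => x (i.succAbove (j.succAbove k))) = 0 := by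
  induction m with
  | zero =>
    have h : ∀ a b : Fin 0 → E, c a = c b := fun a b => congrArg c (Subsingleton.elim a b)
    simp only [h _ Fin.elim0]
    simp
  | succ m ih =>
    rw [Fin.sum_univ_succ]
    have h := ih (fun t => c (Fin.cons (x 0) t)) (fun i => x i.succ)
    have key : ∀ i : Fin (m + 2), ∑ j : Fin (m + 2), (-1 : ℤ) ^ (j : ℕ) •
        c (fun k => x (i.succ.succAbove (j.succAbove k))) =
        c (fun k => x (i.succAbove k).succ) - ∑ j : Fin (m + 1), (-1 : ℤ) ^ (j : ℕ) •
          c (Fin.cons (x 0) fun k => x (i.succAbove (j.succAbove k)).succ) := by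
      intro i
      rw [Fin.sum_univ_succ, sub_eq_add_neg, ← Finset.sum_neg_distrib]
      congr 1
      · simp
      · refine Finset.sum_congr rfl fun j _ => ?_
        rw [Fin.val_succ, pow_succ, mul_neg_one, neg_smul]
        congr 3
        funext k
        refine Fin.cases ?_ (fun l => ?_) k
        · simp
        · simp [Fin.succ_succAbove_succ]
    simp only [key, smul_sub, Finset.sum_sub_distrib, Fin.val_succ, pow_succ, mul_neg_one,
      neg_smul, Finset.sum_neg_distrib, h]
    simp

theorem cechD_cechD {π : P ⟶ Q} {G : Cᵒᵖ ⥤ AddCommGrpCat.{w}} {m : ℕ}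
    (c : sections (fibrePower π m) G) : cechD π G (m + 1) (cechD π G m c) = 0 := by
  classical
  refine sections.ext fun Z x => ?_
  let c' : (Fin m → P.obj Z) → G.obj Z := fun t =>
    if h : ∀ i, π.app Z (t i) = x.1.1 then c.1 Z ⟨(x.1.1, t), h⟩ else 0
  have h := alternatingSum_succAbove_succAbove m c' x.1.2
  simp only [cechD_apply]
  refine Eq.trans ?_ h
  refine Finset.sum_congr rfl fun i _ => congrArg _ (Finset.sum_congr rfl fun j _ => ?_)
  have : ∀ k, π.app Z (x.1.2 (i.succAbove (j.succAbove k))) = x.1.1 := fun k => x.2 _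
  simp only [c', dif_pos this]
  rfl

theorem freeD_app_of (π : P ⟶ Q) (m : ℕ) (Z : Cᵒᵖ) (x : (fibrePower π (m + 1)).obj Z) :
    (freeD π m).app Z (FreeAbelianGroup.of x) =
      ∑ i : Fin (m + 1), (-1 : ℤ) ^ (i : ℕ) • FreeAbelianGroup.of ((face π m i).app Z x) := by
  rw [← freeEquiv_apply, freeD, AddEquiv.apply_symm_apply, cechD_apply]
  rfl

theorem freeD_freeD (π : P ⟶ Q) (m : ℕ) : freeD π (m + 1) ≫ freeD π m = 0 := by
  apply (freeEquiv _ _).injective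
  have h := freeEquiv_freeD_comp (freeD π m ≫ 𝟙 _)
  rw [Category.comp_id] at h
  rw [h, ← Category.comp_id (freeD π m), freeEquiv_freeD_comp, cechD_cechD, map_zero]

/-- The complex of free abelian groups on the tuples in the fibres of a map of sets is contractible
in positive length: put a fixed element of the fibre at the front of a tuple. -/
theorem exists_freeD_eq (π : P ⟶ Q) (m : ℕ) (Z : Cᵒᵖ)
    (x : FreeAbelianGroup ((fibrePower π (m + 1)).obj Z)) (hx : (freeD π m).app Z x = 0) :
    ∃ y : FreeAbelianGroup ((fibrePower π (m + 2)).obj Z), (freeD π (m + 1)).app Z y = x := by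
  classical
  let s : ∀ q : Q.obj Z, (∃ p, π.app Z p = q) → P.obj Z := fun q h => h.choose
  have hs : ∀ q h, π.app Z (s q h) = q := fun q h => h.choose_spec
  let c : ∀ k, (fibrePower π k).obj Z → FreeAbelianGroup ((fibrePower π (k + 1)).obj Z) :=
    fun k x => if h : ∃ p, π.app Z p = x.1.1 then .of (cons (s _ h) x (hs _ h)) else 0
  let D : ∀ k, FreeAbelianGroup ((fibrePower π (k + 1)).obj Z) →+
    FreeAbelianGroup ((fibrePower π k).obj Z) := fun k => ((freeD π k).app Z).hom
  have key : (D (m + 1)).comp (FreeAbelianGroup.lift (c (m + 1))) =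
      AddMonoidHom.id _ - (FreeAbelianGroup.lift (c m)).comp (D m) := by
    refine FreeAbelianGroup.lift_ext _ _ fun x => ?_
    have h : ∃ p, π.app Z p = x.1.1 := ⟨x.1.2 0, x.2 0⟩
    have h1 : D m (.of x) = _ := freeD_app_of π m Z x
    have h2 : D (m + 1) (.of (cons (s _ h) x (hs _ h))) = _ := freeD_app_of π (m + 1) Z _
    rw [AddMonoidHom.comp_apply, FreeAbelianGroup.lift_apply_of, AddMonoidHom.sub_apply,
      AddMonoidHom.comp_apply, h1, map_sum, AddMonoidHom.id_apply]
    simp only [c, dif_pos h]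
    rw [h2, Fin.sum_univ_succ, sub_eq_add_neg, ← Finset.sum_neg_distrib]
    congr 1
    · refine Finset.sum_congr rfl fun i _ => ?_
      rw [face_succ_cons, map_zsmul, FreeAbelianGroup.lift_apply_of, Fin.val_succ, pow_succ,
        mul_neg_one, neg_smul]
      rw [dif_pos (show ∃ p, π.app Z p = ((face π m i).app Z x).1.1 from h)]
      rfl
  refine ⟨FreeAbelianGroup.lift (c (m + 1)) x, ?_⟩
  have h1 := DFunLike.congr_fun key x
  have h2 : D m x = 0 := hx
  rw [AddMonoidHom.sub_apply, AddMonoidHom.comp_apply, AddMonoidHom.comp_apply, h2, map_zero,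
    sub_zero] at h1
  exact h1

/-- The Čech complex of an injective presheaf is exact. -/
theorem cechExact_of_injective (π : P ⟶ Q) (G : Cᵒᵖ ⥤ AddCommGrpCat.{w}) [Injective G] :
    CechExact π G := by
  intro m c hc
  let S : ShortComplex (Cᵒᵖ ⥤ AddCommGrpCat.{w}) := .mk _ _ (freeD_freeD π m)
  have hS : S.Exact := by
    rw [ShortComplex.exact_iff_isZero_homology]
    refine Functor.isZero _ fun Z => ?_
    have hZ : (S.map ((evaluation _ _).obj Z)).Exact := by
      rw [ShortComplex.ab_exact_iff]
      exact fun x hx => exists_freeD_eq π m Z x hx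
    exact ((ShortComplex.exact_iff_isZero_homology _).1 hZ).of_iso
      (S.mapHomologyIso ((evaluation _ _).obj Z)).symm
  let φ := (freeEquiv _ G).symm c
  have hφ : S.f ≫ φ = 0 := by
    apply (freeEquiv _ _).injective
    rw [map_zero]
    refine (freeEquiv_freeD_comp φ).trans ?_
    rw [AddEquiv.apply_symm_apply, hc]
  refine ⟨freeEquiv _ _ (hS.descToInjective φ hφ), ?_⟩
  rw [← freeEquiv_freeD_comp]
  exact ((congrArg _ (hS.comp_descToInjective φ hφ)).trans ((freeEquiv _ G).apply_symm_apply c))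

end Cech
end StackCohomology

/-! ### Vanishing of cohomology from exactness of Čech complexes -/

namespace StackCohomology

universe w' w v u

open fibrePower sections

section Cohomology

variable {C : Type u} [Category.{v} C] {J : GrothendieckTopology C}

section Sheafify

variable [HasSheafify J AddCommGrpCat.{w}]

variable (J) in
/-- The free sheaf of abelian groups on a presheaf of sets. -/
noncomputable def freeSheaf (Q : Cᵒᵖ ⥤ Type w) : Sheaf J AddCommGrpCat.{w} :=
  (presheafToSheaf J _).obj (Q ⋙ AddCommGrpCat.free)

/-- Maps out of the free sheaf on `Q` are sections over `Q`. -/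
noncomputable def freeSheafEquiv (Q : Cᵒᵖ ⥤ Type w) (G : Sheaf J AddCommGrpCat.{w}) :
    (freeSheaf J Q ⟶ G) ≃+ sections Q G.obj :=
  ((sheafificationAdjunction J AddCommGrpCat.{w}).homAddEquiv _ G).trans (freeEquiv Q G.obj)

theorem freeSheafEquiv_comp {Q : Cᵒᵖ ⥤ Type w} {G G' : Sheaf J AddCommGrpCat.{w}}
    (φ : freeSheaf J Q ⟶ G) (g : G ⟶ G') :
    freeSheafEquiv Q G' (φ ≫ g) = push Q g.hom (freeSheafEquiv Q G φ) := by
  have h := (sheafificationAdjunction J AddCommGrpCat.{w}).homEquiv_naturality_right φ g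
  exact congrArg (freeEquiv Q G'.obj) h

variable (J) in
/-- The map of free sheaves induced by a map of presheaves of sets. -/
noncomputable def freeSheafMap {P Q : Cᵒᵖ ⥤ Type w} (π : P ⟶ Q) : freeSheaf J P ⟶ freeSheaf J Q :=
  (presheafToSheaf J _).map (Functor.whiskerRight π _)

theorem freeSheafEquiv_map_comp {P Q : Cᵒᵖ ⥤ Type w} {G : Sheaf J AddCommGrpCat.{w}} (π : P ⟶ Q)
    (φ : freeSheaf J Q ⟶ G) :
    freeSheafEquiv P G (freeSheafMap J π ≫ φ) = pullback G.obj π (freeSheafEquiv Q G φ) := by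
  have h := (sheafificationAdjunction J AddCommGrpCat.{w}).homEquiv_naturality_left
    (Functor.whiskerRight π AddCommGrpCat.free) φ
  refine (congrArg (freeEquiv P G.obj) h).trans (sections.ext fun Z p => ?_)
  exact congrArg (((sheafificationAdjunction J AddCommGrpCat.{w}).homEquiv _ _ φ).app Z)
    (FreeAbelianGroup.map_of_apply p)

/-- The terminal presheaf of sets. -/
abbrev terminalPresheaf : Cᵒᵖ ⥤ Type w := (Functor.const _).obj PUnit

/-- The map to the terminal presheaf. -/
def toTerminal (Q : Cᵒᵖ ⥤ Type w) : Q ⟶ terminalPresheaf where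
  app _ := ↾fun _ => PUnit.unit

/-- Maps out of the constant sheaf `ℤ` are global sections. -/
noncomputable def constantSheafEquiv (G : Sheaf J AddCommGrpCat.{w}) :
    ((constantSheaf J AddCommGrpCat.{w}).obj (AddCommGrpCat.of (ULift ℤ)) ⟶ G) ≃+
      sections terminalPresheaf G.obj :=
  ((sheafificationAdjunction J AddCommGrpCat.{w}).homAddEquiv _ G).trans
    { toFun := fun φ => ⟨fun Z _ => φ.app Z (ULift.up 1), fun Z W f _ =>
        (NatTrans.naturality_apply φ f (ULift.up (1 : ℤ))).symm⟩
      invFun := fun s =>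
        { app := fun Z => AddCommGrpCat.ofHom
            ((zmultiplesHom _ (s.1 Z PUnit.unit)).comp AddEquiv.ulift.toAddMonoidHom)
          naturality := fun Z W f => by
            refine AddCommGrpCat.hom_ext (AddMonoidHom.ext fun n => ?_)
            change n.down • s.1 W PUnit.unit = G.obj.map f (n.down • s.1 Z PUnit.unit)
            rw [map_zsmul, map_apply]
            rfl }
      left_inv := fun φ => by
        refine NatTrans.ext (funext fun Z => AddCommGrpCat.hom_ext (AddMonoidHom.ext fun n => ?_))
        change n.down • φ.app Z (ULift.up 1) = φ.app Z n
        rw [← map_zsmul]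
        exact congrArg (φ.app Z) (ULift.ext _ _ (mul_one n.down))
      right_inv := fun s => sections.ext fun Z q => one_zsmul _
      map_add' := fun _ _ => rfl }

theorem constantSheafEquiv_comp {G G' : Sheaf J AddCommGrpCat.{w}}
    (φ : (constantSheaf J AddCommGrpCat.{w}).obj (AddCommGrpCat.of (ULift ℤ)) ⟶ G) (g : G ⟶ G') :
    constantSheafEquiv G' (φ ≫ g) = push _ g.hom (constantSheafEquiv G φ) := by
  have h := (sheafificationAdjunction J AddCommGrpCat.{w}).homEquiv_naturality_right φ g
  exact sections.ext fun Z _ => congrArg (fun ψ => ψ.app Z (ULift.up (1 : ℤ))) h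

end Sheafify

/-- Sections of a sheaf over `Q` are determined by their pullback along a locally surjective map. -/
theorem sections.pullback_injective {P Q : Cᵒᵖ ⥤ Type w} (π : P ⟶ Q)
    [Presheaf.IsLocallySurjective J π] (G : Sheaf J AddCommGrpCat.{w}) :
    Function.Injective (pullback G.obj π) := by
  intro s t h
  refine sections.ext fun Z q => ?_
  refine G.isSeparated (Z.unop) _ (Presheaf.imageSieve_mem J π q) _ _ fun W f hf => ?_
  obtain ⟨p, hp⟩ := hf
  have hp' : π.app (op W) p = Q.map f.op q := hp
  have h1 := congrFun (congrFun (congrArg Subtype.val h) (op W)) p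
  rw [pullback_apply, pullback_apply, hp'] at h1
  exact (map_apply s f.op q).trans (h1.trans (map_apply t f.op q).symm)

section Exact

variable [HasSheafify J AddCommGrpCat.{w}]

theorem app_injective_of_mono {F G : Sheaf J AddCommGrpCat.{w}} (f : F ⟶ G) [Mono f] (Z : Cᵒᵖ) :
    Function.Injective (f.hom.app Z) := by
  have : Mono (((sheafToPresheaf J AddCommGrpCat.{w}) ⋙ (evaluation _ _).obj Z).map f) :=
    inferInstance
  exact (AddCommGrpCat.mono_iff_injective _).1 this

theorem exists_of_app_eq_zero {S : ShortComplex (Sheaf J AddCommGrpCat.{w})} (hS : S.ShortExact)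
    (Z : Cᵒᵖ) (x : S.X₂.obj.obj Z) (hx : S.g.hom.app Z x = 0) : ∃ y, S.f.hom.app Z y = x := by
  have := hS.mono_f
  have h := hS.exact.map_of_mono_of_preservesKernel
    (sheafToPresheaf J AddCommGrpCat.{w} ⋙ (evaluation _ _).obj Z) inferInstance inferInstance
  rw [ShortComplex.ab_exact_iff] at h
  exact h x hx

/-- A class of covers which computes cohomology: its members are locally surjective maps whose
fibre powers are representable, and local lifts along epimorphisms of sheaves can be found on a
cover from the class. -/
structure IsCechClass (J : GrothendieckTopology C) [HasSheafify J AddCommGrpCat.{w}]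
    (𝒦 : MorphismProperty (Cᵒᵖ ⥤ Type w)) : Prop where
  locallySurjective : ∀ ⦃P Q : Cᵒᵖ ⥤ Type w⦄ (π : P ⟶ Q), 𝒦 π → Presheaf.IsLocallySurjective J π
  exists_universal : ∀ ⦃P Q : Cᵒᵖ ⥤ Type w⦄ (π : P ⟶ Q), 𝒦 π → ∀ m, ∃ (Y : C)
    (p : (fibrePower π (m + 1)).obj (op Y)), IsUniversal p
  exists_lift : ∀ ⦃G G' : Sheaf J AddCommGrpCat.{w}⦄ (g : G ⟶ G') [Epi g] ⦃X : C⦄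
    (x : G'.obj.obj (op X)), ∃ (P Q : Cᵒᵖ ⥤ Type w) (π : P ⟶ Q) (_ : 𝒦 π) (q : Q.obj (op X))
    (t : sections Q G'.obj) (s : sections P G.obj), t.1 _ q = x ∧
      push P g.hom s = pullback G'.obj π t

/-- All Čech complexes of `F` for covers of the class `𝒦` are exact in positive degrees. -/
def IsCechAcyclic (𝒦 : MorphismProperty (Cᵒᵖ ⥤ Type w)) (F : Cᵒᵖ ⥤ AddCommGrpCat.{w}) : Prop :=
  ∀ ⦃P Q : Cᵒᵖ ⥤ Type w⦄ (π : P ⟶ Q), 𝒦 π → CechExact π F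

/-- The projection of the tuples of length one. -/
def fibrePower.ofOne {P Q : Cᵒᵖ ⥤ Type w} (π : P ⟶ Q) : fibrePower π 1 ⟶ P where
  app _ := ↾fun x => x.1.2 0
  naturality _ _ _ := rfl

/-- An element, as a tuple of length one. -/
def fibrePower.toOne {P Q : Cᵒᵖ ⥤ Type w} (π : P ⟶ Q) : P ⟶ fibrePower π 1 where
  app Z := ↾fun p => ⟨(π.app Z p, fun _ => p), fun _ => rfl⟩
  naturality Z W f := by
    ext p
    refine hext ?_ fun _ => rfl
    exact NatTrans.naturality_apply π f (p : P.obj Z)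

/-- The element of the base under a tuple. -/
def fibrePower.toBase {P Q : Cᵒᵖ ⥤ Type w} (π : P ⟶ Q) (m : ℕ) : fibrePower π m ⟶ Q where
  app _ := ↾fun x => x.1.1
  naturality _ _ _ := rfl

/-- An element of the base, as a tuple of length zero. -/
def fibrePower.toZero {P Q : Cᵒᵖ ⥤ Type w} (π : P ⟶ Q) : Q ⟶ fibrePower π 0 where
  app Z := ↾fun q => ⟨(q, Fin.elim0), fun i => i.elim0⟩
  naturality Z W f := by
    ext q
    exact hext rfl fun i => i.elim0

theorem cechD_zero_apply {P Q : Cᵒᵖ ⥤ Type w} {π : P ⟶ Q} {G : Cᵒᵖ ⥤ AddCommGrpCat.{w}}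
    (c : sections (fibrePower π 0) G) (Z : Cᵒᵖ) (x : (fibrePower π 1).obj Z) :
    (cechD π G 0 c).1 Z x = c.1 Z ((face π 0 0).app Z x) := by
  simp [cechD_apply]

/-- A section of the quotient of an injective sheaf by a Čech acyclic subsheaf lifts if it lifts
on a cover. -/
theorem exists_lift_of_pullback {P Q : Cᵒᵖ ⥤ Type w} (π : P ⟶ Q)
    [Presheaf.IsLocallySurjective J π] {S : ShortComplex (Sheaf J AddCommGrpCat.{w})}
    (hS : S.ShortExact) [Injective S.X₂] (hF : CechExact π S.X₁.obj) (t : sections Q S.X₃.obj)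
    (s : sections P S.X₂.obj) (h : push P S.g.hom s = pullback S.X₃.obj π t) :
    ∃ t' : sections Q S.X₂.obj, push Q S.g.hom t' = t := by
  have := hS.mono_f
  have hI : Injective S.X₂.obj :=
    Injective.injective_of_adjoint (sheafificationAdjunction J AddCommGrpCat.{w}) S.X₂
  have hzero : ∀ {R : Cᵒᵖ ⥤ Type w} (u : sections R S.X₁.obj),
      push R S.g.hom (push R S.f.hom u) = 0 := fun u => sections.ext fun Z q => by
    have := congrArg (fun k => k.hom.app Z (u.1 Z q)) S.zero
    exact this
  let s1 : sections (fibrePower π 1) S.X₂.obj := pullback _ (ofOne π) s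
  let t0 : sections (fibrePower π 0) S.X₃.obj := pullback _ (toBase π 0) t
  have hst : push _ S.g.hom s1 = cechD π _ 0 t0 := by
    refine sections.ext fun Z x => ?_
    rw [cechD_zero_apply]
    have h1 := congrFun (congrFun (congrArg Subtype.val h) Z) (x.1.2 0)
    refine h1.trans ?_
    change t.1 Z (π.app Z (x.1.2 0)) = t.1 Z x.1.1
    rw [x.2 0]
  obtain ⟨φ, hφ⟩ := exists_of_push_eq_zero S.f.hom S.g.hom (app_injective_of_mono S.f)
    (exists_of_app_eq_zero hS) (cechD π _ 1 s1) (by rw [← cechD_push, hst, cechD_cechD])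
  obtain ⟨ψ, hψ⟩ := hF 1 φ (push_injective S.f.hom (app_injective_of_mono S.f) (by
    rw [← cechD_push, hφ, cechD_cechD, map_zero]))
  obtain ⟨b, hb⟩ := cechExact_of_injective π S.X₂.obj 0 (s1 - push _ S.f.hom ψ) (by
    rw [map_sub, cechD_push, hψ, hφ, sub_self])
  refine ⟨pullback _ (toZero π) b, ?_⟩
  apply pullback_injective (J := J) π S.X₃
  refine sections.ext fun Z p => ?_
  have h2 : cechD π S.X₃.obj 0 (push _ S.g.hom b) = cechD π S.X₃.obj 0 t0 := by
    rw [cechD_push, hb, map_sub, hzero, sub_zero, hst]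
  have h3 := congrFun (congrFun (congrArg Subtype.val h2) Z) ((toOne π).app Z p)
  rw [cechD_zero_apply, cechD_zero_apply] at h3
  refine Eq.trans ?_ h3
  change S.g.hom.app Z (b.1 Z _) = S.g.hom.app Z (b.1 Z _)
  exact congrArg (fun y => S.g.hom.app Z (b.1 Z y)) (hext rfl fun i => i.elim0)

namespace IsCechClass

variable {𝒦 : MorphismProperty (Cᵒᵖ ⥤ Type w)}
  {S : ShortComplex (Sheaf J AddCommGrpCat.{w})} [Injective S.X₂]

theorem app_surjective (h𝒦 : IsCechClass J 𝒦) (hS : S.ShortExact)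
    (hF : IsCechAcyclic 𝒦 S.X₁.obj) (Z : Cᵒᵖ) : Function.Surjective (S.g.hom.app Z) := by
  intro x
  have := hS.epi_g
  obtain ⟨P, Q, π, hπ, q, t, s, rfl, hs⟩ := h𝒦.exists_lift S.g (X := Z.unop) x
  have := h𝒦.locallySurjective π hπ
  obtain ⟨t', ht'⟩ := exists_lift_of_pullback (J := J) π hS (hF π hπ) t s hs
  exact ⟨t'.1 Z q, congrFun (congrFun (congrArg Subtype.val ht') Z) q⟩

theorem push_surjective (h𝒦 : IsCechClass J 𝒦) (hS : S.ShortExact)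
    (hF : IsCechAcyclic 𝒦 S.X₁.obj) {P Q : Cᵒᵖ ⥤ Type w} (π : P ⟶ Q) (hπ : 𝒦 π) :
    Function.Surjective (push Q S.g.hom) := by
  intro t
  obtain ⟨Y, p, hp⟩ := h𝒦.exists_universal π hπ 0
  obtain ⟨s, hs⟩ := hp.push_surjective S.g.hom (h𝒦.app_surjective hS hF _)
    (pullback _ (toBase π 1) t)
  have := h𝒦.locallySurjective π hπ
  refine exists_lift_of_pullback (J := J) π hS (hF π hπ) t (pullback _ (toOne π) s) ?_
  exact sections.ext fun Z p =>
    congrFun (congrFun (congrArg Subtype.val hs) Z) ((toOne π).app Z p)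

/-- The quotient of an injective sheaf by a Čech acyclic subsheaf is Čech acyclic. -/
theorem isCechAcyclic_quotient (h𝒦 : IsCechClass J 𝒦) (hS : S.ShortExact)
    (hF : IsCechAcyclic 𝒦 S.X₁.obj) : IsCechAcyclic 𝒦 S.X₃.obj := by
  intro P Q π hπ m c hc
  have := hS.mono_f
  have hI : Injective S.X₂.obj :=
    Injective.injective_of_adjoint (sheafificationAdjunction J AddCommGrpCat.{w}) S.X₂
  obtain ⟨Y, p, hp⟩ := h𝒦.exists_universal π hπ m
  obtain ⟨c', hc'⟩ := hp.push_surjective S.g.hom (h𝒦.app_surjective hS hF _) c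
  obtain ⟨φ, hφ⟩ := exists_of_push_eq_zero S.f.hom S.g.hom (app_injective_of_mono S.f)
    (exists_of_app_eq_zero hS) (cechD π _ (m + 1) c') (by rw [← cechD_push, hc', hc])
  obtain ⟨ψ, hψ⟩ := hF π hπ (m + 1) φ (push_injective S.f.hom (app_injective_of_mono S.f) (by
    rw [← cechD_push, hφ, cechD_cechD, map_zero]))
  obtain ⟨b, hb⟩ := cechExact_of_injective π S.X₂.obj m (c' - push _ S.f.hom ψ) (by
    rw [map_sub, cechD_push, hψ, hφ, sub_self])
  refine ⟨push _ S.g.hom b, ?_⟩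
  rw [cechD_push, hb, map_sub, hc']
  have : push _ S.g.hom (push _ S.f.hom ψ) = 0 := sections.ext fun Z q =>
    congrArg (fun k => k.hom.app Z (ψ.1 Z q)) S.zero
  rw [this, sub_zero]

end IsCechClass

open Abelian

/-- Cartan's criterion: a Čech acyclic sheaf has no higher cohomology on the targets of covers. -/
theorem IsCechClass.subsingleton_ext {𝒦 : MorphismProperty (Cᵒᵖ ⥤ Type w)}
    (h𝒦 : IsCechClass J 𝒦) [HasExt.{w'} (Sheaf J AddCommGrpCat.{w})]
    [EnoughInjectives (Sheaf J AddCommGrpCat.{w})] {P Q : Cᵒᵖ ⥤ Type w} (π : P ⟶ Q) (hπ : 𝒦 π)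
    (i : ℕ) (F : Sheaf J AddCommGrpCat.{w}) (hF : IsCechAcyclic 𝒦 F.obj) :
    Subsingleton (Ext (freeSheaf J Q) F (i + 1)) := by
  induction i generalizing F with
  | zero =>
    let S := ShortComplex.mk (Injective.ι F) (Limits.cokernel.π (Injective.ι F))
      (Limits.cokernel.condition _)
    have hS : S.ShortExact := { exact := ShortComplex.exact_cokernel _ }
    have : Injective S.X₂ := inferInstanceAs (Injective (Injective.under F))
    refine subsingleton_of_forall_eq 0 fun x => ?_
    obtain ⟨y, rfl⟩ := Ext.covariant_sequence_exact₁ (freeSheaf J Q) hS x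
      (Ext.eq_zero_of_injective _) (zero_add 1)
    obtain ⟨φ, rfl⟩ := Ext.mk₀_bijective _ _ |>.2 y
    obtain ⟨s, hs⟩ := h𝒦.push_surjective hS hF π hπ (freeSheafEquiv Q _ φ)
    have : φ = (freeSheafEquiv Q _).symm s ≫ S.g := by
      apply (freeSheafEquiv Q _).injective
      rw [freeSheafEquiv_comp, AddEquiv.apply_symm_apply, hs]
    rw [this, ← Ext.mk₀_comp_mk₀, Ext.comp_assoc_of_second_deg_zero, hS.comp_extClass,
      Ext.comp_zero]
  | succ i ih =>
    let S := ShortComplex.mk (Injective.ι F) (Limits.cokernel.π (Injective.ι F))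
      (Limits.cokernel.condition _)
    have hS : S.ShortExact := { exact := ShortComplex.exact_cokernel _ }
    have : Injective S.X₂ := inferInstanceAs (Injective (Injective.under F))
    refine subsingleton_of_forall_eq 0 fun x => ?_
    obtain ⟨y, rfl⟩ := Ext.covariant_sequence_exact₁ (freeSheaf J Q) hS x
      (Ext.eq_zero_of_injective _) rfl
    have := ih S.X₃ (h𝒦.isCechAcyclic_quotient hS hF)
    rw [Subsingleton.elim y 0, Ext.zero_comp]

end Exact
end Cohomology
end StackCohomology

/-! ### The Mayer–Vietoris sequence of two subobjects of the terminal presheaf -/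

namespace StackCohomology

universe w' w v u

open fibrePower sections Abelian

section MayerVietoris

variable {C : Type u} [Category.{v} C] {J : GrothendieckTopology C}

/-- Two subobjects of the terminal presheaf, with their intersection, which cover the terminal
object locally. -/
structure IsSubterminalCover (J : GrothendieckTopology C) {Q₁₂ Q₁ Q₂ : Cᵒᵖ ⥤ Type w}
    (ι₁ : Q₁₂ ⟶ Q₁) (ι₂ : Q₁₂ ⟶ Q₂) : Prop where
  subsingleton₁ : ∀ Z, Subsingleton (Q₁.obj Z)
  subsingleton₂ : ∀ Z, Subsingleton (Q₂.obj Z)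
  subsingleton₁₂ : ∀ Z, Subsingleton (Q₁₂.obj Z)
  nonempty₁₂ : ∀ Z, Q₁.obj Z → Q₂.obj Z → Nonempty (Q₁₂.obj Z)
  exists_cover : ∀ X : C, ∃ S ∈ J X, ∀ ⦃W : C⦄ (f : W ⟶ X), S f →
    Nonempty (Q₁.obj (op W)) ∨ Nonempty (Q₂.obj (op W))

namespace IsSubterminalCover

variable {Q₁₂ Q₁ Q₂ : Cᵒᵖ ⥤ Type w} {ι₁ : Q₁₂ ⟶ Q₁} {ι₂ : Q₁₂ ⟶ Q₂}

theorem ext (h : IsSubterminalCover J ι₁ ι₂) (G : Sheaf J AddCommGrpCat.{w})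
    {s t : sections terminalPresheaf G.obj}
    (h₁ : pullback G.obj (toTerminal Q₁) s = pullback G.obj (toTerminal Q₁) t)
    (h₂ : pullback G.obj (toTerminal Q₂) s = pullback G.obj (toTerminal Q₂) t) : s = t := by
  refine sections.ext fun Z q => ?_
  obtain ⟨S, hS, hS'⟩ := h.exists_cover Z.unop
  refine G.isSeparated Z.unop _ hS _ _ fun W f hf => ?_
  refine (map_apply s f.op q).trans (Eq.trans ?_ (map_apply t f.op q).symm)
  obtain ⟨⟨p⟩⟩ | ⟨⟨p⟩⟩ := hS' f hf
  · exact congrFun (congrFun (congrArg Subtype.val h₁) (op W)) p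
  · exact congrFun (congrFun (congrArg Subtype.val h₂) (op W)) p

/-- Sections of a sheaf over the two pieces which agree on the intersection glue. -/
theorem exists_glue [J.HasSheafCompose (forget AddCommGrpCat.{w})]
    (h : IsSubterminalCover J ι₁ ι₂) (G : Sheaf J AddCommGrpCat.{w})
    (a : sections Q₁ G.obj) (b : sections Q₂ G.obj)
    (hab : pullback G.obj ι₁ a = pullback G.obj ι₂ b) :
    ∃ s : sections terminalPresheaf G.obj, pullback G.obj (toTerminal Q₁) s = a ∧
      pullback G.obj (toTerminal Q₂) s = b := by
  classical
  have := h.subsingleton₁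
  have := h.subsingleton₂
  have hab' : ∀ Z (p : Q₁.obj Z) (q : Q₂.obj Z), a.1 Z p = b.1 Z q := by
    intro Z p q
    obtain ⟨r⟩ := h.nonempty₁₂ Z p q
    have := congrFun (congrFun (congrArg Subtype.val hab) Z) r
    rw [pullback_apply, pullback_apply] at this
    rwa [Subsingleton.elim p (ι₁.app Z r), Subsingleton.elim q (ι₂.app Z r)]
  -- The common value of the two sections wherever one of them is defined.
  let y : ∀ Z, G.obj.obj Z := fun Z =>
    if h : Nonempty (Q₁.obj Z) then a.1 Z h.some else
      if h : Nonempty (Q₂.obj Z) then b.1 Z h.some else 0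
  have hya : ∀ Z (p : Q₁.obj Z), y Z = a.1 Z p := by
    intro Z p
    simp only [y, dif_pos (Nonempty.intro p)]
    rw [Subsingleton.elim (Nonempty.some _) p]
  have hyb : ∀ Z (p : Q₂.obj Z), y Z = b.1 Z p := by
    intro Z p
    by_cases hZ : Nonempty (Q₁.obj Z)
    · rw [hya Z hZ.some, hab']
    · simp only [y, dif_neg hZ, dif_pos (Nonempty.intro p)]
      rw [Subsingleton.elim (Nonempty.some _) p]
  have hy : ∀ {Z W} (f : Z ⟶ W), Nonempty (Q₁.obj Z) ∨ Nonempty (Q₂.obj Z) →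
      G.obj.map f (y Z) = y W := by
    rintro Z W f (⟨⟨p⟩⟩ | ⟨⟨p⟩⟩)
    · rw [hya Z p, map_apply, hya W]
    · rw [hyb Z p, map_apply, hyb W]
  have hG := (isSheaf_iff_isSheaf_of_type _ _).1
    (GrothendieckTopology.HasSheafCompose.isSheaf (F := forget AddCommGrpCat.{w}) G.obj G.2)
  have hex : ∀ X : C, ∃ x : G.obj.obj (op X), ∀ (W : C) (f : W ⟶ X),
      Nonempty (Q₁.obj (op W)) ∨ Nonempty (Q₂.obj (op W)) → G.obj.map f.op x = y (op W) := by
    intro X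
    obtain ⟨S, hS, hS'⟩ := h.exists_cover X
    obtain ⟨x, hx, -⟩ := hG S hS (fun W _ _ => y (op W)) (by
      intro W₁ W₂ V g₁ g₂ f₁ f₂ h₁ h₂ _
      exact (hy g₁.op (hS' f₁ h₁)).trans (hy g₂.op (hS' f₂ h₂)).symm)
    refine ⟨x, fun W f hf => ?_⟩
    refine G.isSeparated W _ (J.pullback_stable f hS) _ _ fun V g hg => ?_
    rw [← ConcreteCategory.comp_apply, ← G.obj.map_comp, hy _ hf]
    exact hx (g ≫ f) hg
  choose x hx using hex
  refine ⟨⟨fun Z _ => x Z.unop, fun Z W f _ => ?_⟩, sections.ext fun Z p => ?_,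
    sections.ext fun Z p => ?_⟩
  · obtain ⟨S, hS, hS'⟩ := h.exists_cover W.unop
    refine G.isSeparated W.unop _ hS _ _ fun V g hg => ?_
    have h1 := hx Z.unop V (g ≫ f.unop) (hS' g hg)
    rw [op_comp, G.obj.map_comp, ConcreteCategory.comp_apply] at h1
    exact h1.trans (hx W.unop V g (hS' g hg)).symm
  · have h1 := hx Z.unop Z.unop (𝟙 _) (Or.inl ⟨p⟩)
    rw [op_id, G.obj.map_id] at h1
    exact h1.trans (hya Z p)
  · have h1 := hx Z.unop Z.unop (𝟙 _) (Or.inr ⟨p⟩)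
    rw [op_id, G.obj.map_id] at h1
    exact h1.trans (hyb Z p)

variable [HasSheafify J AddCommGrpCat.{w}]

/-- The map from the free sheaf on `Q` to the constant sheaf `ℤ` that sends every generator
to `1`. -/
noncomputable def augmentation (J : GrothendieckTopology C) [HasSheafify J AddCommGrpCat.{w}]
    (Q : Cᵒᵖ ⥤ Type w) : freeSheaf J Q ⟶
      (constantSheaf J AddCommGrpCat.{w}).obj (AddCommGrpCat.of (ULift ℤ)) :=
  (freeSheafEquiv Q _).symm (pullback _ (toTerminal Q) (constantSheafEquiv _ (𝟙 _)))

theorem freeSheafEquiv_augmentation_comp (Q : Cᵒᵖ ⥤ Type w) {G : Sheaf J AddCommGrpCat.{w}}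
    (φ : (constantSheaf J AddCommGrpCat.{w}).obj (AddCommGrpCat.of (ULift ℤ)) ⟶ G) :
    freeSheafEquiv Q G (augmentation J Q ≫ φ) =
      pullback _ (toTerminal Q) (constantSheafEquiv G φ) := by
  rw [freeSheafEquiv_comp, augmentation, AddEquiv.apply_symm_apply]
  conv_rhs => rw [← Category.id_comp φ, constantSheafEquiv_comp]
  rfl

variable (J) in
/-- The Mayer–Vietoris complex `ℤ[Q₁₂] ⟶ ℤ[Q₁] ⊞ ℤ[Q₂] ⟶ ℤ`. -/
noncomputable abbrev shortComplex (h : IsSubterminalCover J ι₁ ι₂) :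
    ShortComplex (Sheaf J AddCommGrpCat.{w}) where
  X₁ := freeSheaf J Q₁₂
  X₂ := freeSheaf J Q₁ ⊞ freeSheaf J Q₂
  X₃ := (constantSheaf J AddCommGrpCat.{w}).obj (AddCommGrpCat.of (ULift ℤ))
  f := Limits.biprod.lift (freeSheafMap J ι₁) (-freeSheafMap J ι₂)
  g := Limits.biprod.desc (augmentation J Q₁) (augmentation J Q₂)
  zero := by
    have := h.subsingleton₁
    rw [Limits.biprod.lift_desc, Preadditive.neg_comp, ← sub_eq_add_neg, sub_eq_zero]
    apply (freeSheafEquiv _ _).injective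
    rw [freeSheafEquiv_map_comp, freeSheafEquiv_map_comp]
    simp only [augmentation, AddEquiv.apply_symm_apply]
    rfl

theorem shortExact [J.HasSheafCompose (forget AddCommGrpCat.{w})]
    (h : IsSubterminalCover J ι₁ ι₂) : (shortComplex J h).ShortExact := by
  have := h.subsingleton₁₂
  have hmono : Mono (shortComplex J h).f := by
    have h0 : Mono ι₁ := by
      rw [NatTrans.mono_iff_mono_app]
      intro Z
      rw [mono_iff_injective]
      exact fun a b _ => Subsingleton.elim a b
    have h1 : Mono (freeSheafMap J ι₁) := by
      have : Mono (Functor.whiskerRight ι₁ AddCommGrpCat.free.{w}) := by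
        rw [NatTrans.mono_iff_mono_app]
        intro Z
        have : Mono (ι₁.app Z) := (NatTrans.mono_iff_mono_app _).1 h0 Z
        exact inferInstanceAs (Mono (AddCommGrpCat.free.map (ι₁.app Z)))
      exact inferInstanceAs (Mono ((presheafToSheaf J _).map _))
    have h2 : Mono ((shortComplex J h).f ≫ Limits.biprod.fst) := by
      dsimp [shortComplex]
      rwa [Limits.biprod.lift_fst]
    exact mono_of_mono _ Limits.biprod.fst
  have hker : ∀ {G : Sheaf J AddCommGrpCat.{w}} (φ : freeSheaf J Q₁ ⊞ freeSheaf J Q₂ ⟶ G),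
      (shortComplex J h).f ≫ φ = 0 → ∃ s : sections terminalPresheaf G.obj,
        pullback G.obj (toTerminal Q₁) s = freeSheafEquiv _ _ (Limits.biprod.inl ≫ φ) ∧
        pullback G.obj (toTerminal Q₂) s = freeSheafEquiv _ _ (Limits.biprod.inr ≫ φ) := by
    intro G φ hφ
    apply h.exists_glue
    rw [← freeSheafEquiv_map_comp, ← freeSheafEquiv_map_comp]
    congr 1
    rw [← sub_eq_zero]
    refine Eq.trans ?_ hφ
    dsimp only [shortComplex]
    rw [Limits.biprod.lift_eq]
    simp [sub_eq_add_neg]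
  have hinl : ∀ {G : Sheaf J AddCommGrpCat.{w}} (ψ : (shortComplex J h).X₃ ⟶ G),
      freeSheafEquiv _ _ (Limits.biprod.inl ≫ (shortComplex J h).g ≫ ψ) =
        pullback G.obj (toTerminal Q₁) (constantSheafEquiv G ψ) := fun ψ => by
    dsimp only [shortComplex]
    rw [Limits.biprod.inl_desc_assoc, freeSheafEquiv_augmentation_comp]
  have hinr : ∀ {G : Sheaf J AddCommGrpCat.{w}} (ψ : (shortComplex J h).X₃ ⟶ G),
      freeSheafEquiv _ _ (Limits.biprod.inr ≫ (shortComplex J h).g ≫ ψ) =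
        pullback G.obj (toTerminal Q₂) (constantSheafEquiv G ψ) := fun ψ => by
    dsimp only [shortComplex]
    rw [Limits.biprod.inr_desc_assoc, freeSheafEquiv_augmentation_comp]
  have hdesc : ∀ {G : Sheaf J AddCommGrpCat.{w}} (φ : (shortComplex J h).X₂ ⟶ G),
      (shortComplex J h).f ≫ φ = 0 → ∃ ψ, (shortComplex J h).g ≫ ψ = φ := by
    intro G φ hφ
    obtain ⟨s, h₁, h₂⟩ := hker φ hφ
    refine ⟨(constantSheafEquiv _).symm s, Limits.biprod.hom_ext' _ _ ?_ ?_⟩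
    · apply (freeSheafEquiv _ _).injective
      rw [hinl, AddEquiv.apply_symm_apply, h₁]
    · apply (freeSheafEquiv _ _).injective
      rw [hinr, AddEquiv.apply_symm_apply, h₂]
  have huniq : ∀ {G : Sheaf J AddCommGrpCat.{w}} (ψ ψ' : (shortComplex J h).X₃ ⟶ G),
      (shortComplex J h).g ≫ ψ = (shortComplex J h).g ≫ ψ' → ψ = ψ' := by
    intro G ψ ψ' hψ
    apply (constantSheafEquiv G).injective
    apply h.ext
    · rw [← hinl, ← hinl, hψ]
    · rw [← hinr, ← hinr, hψ]
  have hcok : Nonempty (Limits.IsColimit (Limits.CokernelCofork.ofπ (shortComplex J h).g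
      (shortComplex J h).zero)) :=
    ⟨Limits.CokernelCofork.IsColimit.ofπ _ _ (fun φ hφ => (hdesc φ hφ).choose)
      (fun φ hφ => (hdesc φ hφ).choose_spec)
      (fun φ hφ m hm => huniq _ _ (hm.trans (hdesc φ hφ).choose_spec.symm))⟩
  obtain ⟨hex, hepi⟩ := (shortComplex J h).exact_and_epi_g_iff_g_is_cokernel.2 hcok
  exact { exact := hex }

variable [HasExt.{w'} (Sheaf J AddCommGrpCat.{w})]

/-- The connecting homomorphism from sections over the intersection to `H¹`. -/
noncomputable def connecting [J.HasSheafCompose (forget AddCommGrpCat.{w})]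
    (h : IsSubterminalCover J ι₁ ι₂) (G : Sheaf J AddCommGrpCat.{w}) :
    sections Q₁₂ G.obj →+ G.H 1 :=
  (h.shortExact.extClass.precomp G (add_zero 1)).comp
    (Ext.addEquiv₀.symm.toAddMonoidHom.comp (freeSheafEquiv Q₁₂ G).symm.toAddMonoidHom)

theorem connecting_apply [J.HasSheafCompose (forget AddCommGrpCat.{w})]
    (h : IsSubterminalCover J ι₁ ι₂) (G : Sheaf J AddCommGrpCat.{w}) (s : sections Q₁₂ G.obj) :
    h.connecting G s = h.shortExact.extClass.comp (Ext.mk₀ ((freeSheafEquiv Q₁₂ G).symm s))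
      (add_zero 1) := rfl

theorem connecting_push [J.HasSheafCompose (forget AddCommGrpCat.{w})]
    (h : IsSubterminalCover J ι₁ ι₂) {G G' : Sheaf J AddCommGrpCat.{w}} (g : G ⟶ G')
    (s : sections Q₁₂ G.obj) :
    h.connecting G' (push _ g.hom s) = Sheaf.H.map g 1 (h.connecting G s) := by
  refine Eq.trans ?_ (Ext.comp_assoc_of_third_deg_zero _ _ _ (add_zero 1)).symm
  have h1 : (Ext.addEquiv₀.symm.toAddMonoidHom.comp (freeSheafEquiv Q₁₂ G).symm.toAddMonoidHom) s =
    Ext.mk₀ ((freeSheafEquiv Q₁₂ G).symm s) := rfl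
  rw [connecting_apply, h1, Ext.mk₀_comp_mk₀]
  congr 2
  rw [AddEquiv.symm_apply_eq, freeSheafEquiv_comp, AddEquiv.apply_symm_apply]

theorem connecting_eq_zero_iff [J.HasSheafCompose (forget AddCommGrpCat.{w})]
    (h : IsSubterminalCover J ι₁ ι₂) (G : Sheaf J AddCommGrpCat.{w}) (s : sections Q₁₂ G.obj) :
    h.connecting G s = 0 ↔ ∃ (a : sections Q₁ G.obj) (b : sections Q₂ G.obj),
      pullback G.obj ι₁ a + pullback G.obj ι₂ b = s := by
  rw [connecting_apply]
  constructor
  · intro hs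
    obtain ⟨x, hx⟩ := Ext.contravariant_sequence_exact₁ h.shortExact G _ (add_zero 1) hs
    obtain ⟨φ, rfl⟩ := Ext.mk₀_bijective _ _ |>.2 x
    rw [Ext.mk₀_comp_mk₀] at hx
    have hx' := (Ext.mk₀_bijective _ _).1 hx
    refine ⟨freeSheafEquiv _ _ (Limits.biprod.inl ≫ φ),
      -freeSheafEquiv _ _ (Limits.biprod.inr ≫ φ), ?_⟩
    rw [← map_neg, ← freeSheafEquiv_map_comp, ← freeSheafEquiv_map_comp, ← map_add,
      ← AddEquiv.eq_symm_apply, ← hx']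
    dsimp only [shortComplex]
    rw [Limits.biprod.lift_eq]
    simp
  · rintro ⟨a, b, rfl⟩
    have : (freeSheafEquiv Q₁₂ G).symm (pullback G.obj ι₁ a + pullback G.obj ι₂ b) =
        (shortComplex J h).f ≫ Limits.biprod.desc ((freeSheafEquiv _ _).symm a)
          (-(freeSheafEquiv _ _).symm b) := by
      dsimp only [shortComplex]
      rw [Limits.biprod.lift_desc, AddEquiv.symm_apply_eq, Preadditive.neg_comp_neg, map_add,
        freeSheafEquiv_map_comp, freeSheafEquiv_map_comp, AddEquiv.apply_symm_apply,
        AddEquiv.apply_symm_apply]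
    rw [this, ← Ext.mk₀_comp_mk₀, ← Ext.comp_assoc_of_second_deg_zero, h.shortExact.extClass_comp,
      Ext.zero_comp]

theorem connecting_surjective [J.HasSheafCompose (forget AddCommGrpCat.{w})]
    (h : IsSubterminalCover J ι₁ ι₂) (G : Sheaf J AddCommGrpCat.{w})
    (h₁ : Subsingleton (Ext (freeSheaf J Q₁) G 1)) (h₂ : Subsingleton (Ext (freeSheaf J Q₂) G 1)) :
    Function.Surjective (h.connecting G) := by
  intro x
  obtain ⟨y, hy⟩ := Ext.contravariant_sequence_exact₃ h.shortExact G x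
    (Ext.biprod_ext (Subsingleton.elim (α := Ext (freeSheaf J Q₁) G 1) _ _)
      (Subsingleton.elim (α := Ext (freeSheaf J Q₂) G 1) _ _)) (add_zero 1)
  obtain ⟨φ, rfl⟩ := Ext.mk₀_bijective _ _ |>.2 y
  refine ⟨freeSheafEquiv _ _ φ, ?_⟩
  rw [connecting_apply, AddEquiv.symm_apply_apply]
  exact hy

theorem subsingleton_H [J.HasSheafCompose (forget AddCommGrpCat.{w})]
    (h : IsSubterminalCover J ι₁ ι₂) (G : Sheaf J AddCommGrpCat.{w}) (i : ℕ)
    (h₁₂ : Subsingleton (Ext (freeSheaf J Q₁₂) G (i + 1)))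
    (h₁ : Subsingleton (Ext (freeSheaf J Q₁) G (i + 2)))
    (h₂ : Subsingleton (Ext (freeSheaf J Q₂) G (i + 2))) :
    Subsingleton (G.H (i + 2)) := by
  refine subsingleton_of_forall_eq 0 fun x => ?_
  obtain ⟨y, rfl⟩ := Ext.contravariant_sequence_exact₃ h.shortExact G x
    (Ext.biprod_ext (Subsingleton.elim (α := Ext (freeSheaf J Q₁) G (i + 2)) _ _)
      (Subsingleton.elim (α := Ext (freeSheaf J Q₂) G (i + 2)) _ _))
    (show 1 + (i + 1) = i + 2 by lia)
  have hy : y = 0 := Subsingleton.elim (α := Ext (freeSheaf J Q₁₂) G (i + 1)) _ _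
  rw [hy, Ext.comp_zero]

end IsSubterminalCover

end MayerVietoris
end StackCohomology

/-! ### The grading of a tensor product of graded algebras over a graded ring -/

namespace StackCohomology

section TensorGrading

variable {R S M : Type*} [CommRing R] [CommRing S] [CommRing M] [Algebra R S] [Algebra R M]

/-- The total grading of `S ⊗[R] M`. -/
def tensorGrading (R : Type*) {S M : Type*} [CommRing R] [CommRing S] [CommRing M] [Algebra R S]
    [Algebra R M] (𝓢 : ℤ → AddSubgroup S) (𝓜 : ℤ → AddSubgroup M) (n : ℤ) :
    AddSubgroup (S ⊗[R] M) :=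
  AddSubgroup.closure {x | ∃ i j, i + j = n ∧ ∃ s ∈ 𝓢 i, ∃ m ∈ 𝓜 j, s ⊗ₜ[R] m = x}

variable {𝓡 : ℤ → AddSubgroup R} {𝓢 : ℤ → AddSubgroup S} {𝓜 : ℤ → AddSubgroup M}

theorem tmul_mem_tensorGrading {i j n : ℤ} (h : i + j = n) {s : S} (hs : s ∈ 𝓢 i) {m : M}
    (hm : m ∈ 𝓜 j) : s ⊗ₜ[R] m ∈ tensorGrading R 𝓢 𝓜 n :=
  AddSubgroup.subset_closure ⟨i, j, h, s, hs, m, hm, rfl⟩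

variable [GradedRing 𝓡] [GradedRing 𝓢] [GradedRing 𝓜]

instance tensorGrading.gradedMonoid : SetLike.GradedMonoid (tensorGrading R 𝓢 𝓜) where
  one_mem := by
    rw [Algebra.TensorProduct.one_def]
    exact tmul_mem_tensorGrading (zero_add 0) SetLike.GradedOne.one_mem SetLike.GradedOne.one_mem
  mul_mem := by
    intro a b x y hx hy
    induction hx using AddSubgroup.closure_induction with
    | mem x hx =>
      obtain ⟨i, j, rfl, s, hs, m, hm, rfl⟩ := hx
      induction hy using AddSubgroup.closure_induction with
      | mem y hy =>
        obtain ⟨i', j', rfl, s', hs', m', hm', rfl⟩ := hy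
        rw [Algebra.TensorProduct.tmul_mul_tmul]
        exact tmul_mem_tensorGrading (by ring) (SetLike.GradedMul.mul_mem hs hs')
          (SetLike.GradedMul.mul_mem hm hm')
      | zero => rw [mul_zero]; exact zero_mem _
      | add y z _ _ hy hz => rw [mul_add]; exact add_mem hy hz
      | neg y _ hy => rw [mul_neg]; exact neg_mem hy
    | zero => rw [zero_mul]; exact zero_mem _
    | add y z _ _ hy hz => rw [add_mul]; exact add_mem hy hz
    | neg y _ hy => rw [neg_mul]; exact neg_mem hy

/-- The product of homogeneous elements, as an element of the direct sum of the pieces of the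
tensor product. -/
def tensorPiece (R : Type*) {S M : Type*} [CommRing R] [CommRing S] [CommRing M] [Algebra R S]
    [Algebra R M] (𝓢 : ℤ → AddSubgroup S) (𝓜 : ℤ → AddSubgroup M) (i j : ℤ) :
    𝓢 i →+ 𝓜 j →+ DirectSum ℤ fun n => tensorGrading R 𝓢 𝓜 n :=
  AddMonoidHom.mk' (fun s => AddMonoidHom.mk' (fun m =>
      DirectSum.of (fun n => tensorGrading R 𝓢 𝓜 n) (i + j)
        ⟨(s : S) ⊗ₜ[R] (m : M), tmul_mem_tensorGrading rfl s.2 m.2⟩)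
      fun m m' => by
        rw [← map_add]
        exact congrArg _ (Subtype.ext (TensorProduct.tmul_add _ _ _)))
    fun s s' => by
      ext1 m
      change DirectSum.of (fun n => tensorGrading R 𝓢 𝓜 n) (i + j) _ =
        DirectSum.of (fun n => tensorGrading R 𝓢 𝓜 n) (i + j) _ +
        DirectSum.of (fun n => tensorGrading R 𝓢 𝓜 n) (i + j) _
      rw [← map_add]
      exact congrArg _ (Subtype.ext (TensorProduct.add_tmul _ _ _))

/-- The decomposition of `s ⊗ₜ m` into homogeneous components, as a biadditive map. -/
def tensorDecomposeAux (R : Type*) {S M : Type*} [CommRing R] [CommRing S] [CommRing M]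
    [Algebra R S] [Algebra R M] (𝓢 : ℤ → AddSubgroup S) (𝓜 : ℤ → AddSubgroup M) [GradedRing 𝓢]
    [GradedRing 𝓜] : S →+ M →+ DirectSum ℤ fun n => tensorGrading R 𝓢 𝓜 n :=
  ((AddMonoidHom.compHom (M := M) (N := DirectSum ℤ fun j => 𝓜 j)
      (P := DirectSum ℤ fun n => tensorGrading R 𝓢 𝓜 n)).flip
        (DirectSum.decomposeAddEquiv 𝓜).toAddMonoidHom).comp
    ((DirectSum.toAddMonoid fun i => AddMonoidHom.mk' (fun s => DirectSum.toAddMonoid fun j =>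
      tensorPiece R 𝓢 𝓜 i j s) fun s s' => by ext; simp).comp
      (DirectSum.decomposeAddEquiv 𝓢).toAddMonoidHom)

theorem tensorDecomposeAux_of_mem {i j : ℤ} {s : S} (hs : s ∈ 𝓢 i) {m : M} (hm : m ∈ 𝓜 j) :
    tensorDecomposeAux R 𝓢 𝓜 s m = DirectSum.of (fun n => tensorGrading R 𝓢 𝓜 n) (i + j)
      ⟨s ⊗ₜ[R] m, tmul_mem_tensorGrading rfl hs hm⟩ := by
  simp only [tensorDecomposeAux, AddMonoidHom.comp_apply, AddMonoidHom.flip_apply,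
    AddMonoidHom.compHom_apply_apply, AddEquiv.coe_toAddMonoidHom,
    DirectSum.decomposeAddEquiv_apply]
  rw [DirectSum.decompose_of_mem _ hs, DirectSum.decompose_of_mem _ hm, DirectSum.toAddMonoid_of]
  simp only [AddMonoidHom.mk'_apply]
  rw [DirectSum.toAddMonoid_of]
  rfl

theorem tensorDecomposeAux_balanced (hS : ∀ n, ∀ r ∈ 𝓡 n, algebraMap R S r ∈ 𝓢 n)
    (hM : ∀ n, ∀ r ∈ 𝓡 n, algebraMap R M r ∈ 𝓜 n) (r : R) (s : S) (m : M) :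
    tensorDecomposeAux R 𝓢 𝓜 (r • s) m = tensorDecomposeAux R 𝓢 𝓜 s (r • m) := by
  induction r using DirectSum.Decomposition.inductionOn 𝓡 with
  | zero => simp
  | add r r' h h' => simp only [add_smul, map_add, AddMonoidHom.add_apply, h, h']
  | @homogeneous k r =>
    induction s using DirectSum.Decomposition.inductionOn 𝓢 with
    | zero => simp
    | add r r' h h' => simp only [smul_add, map_add, AddMonoidHom.add_apply, h, h']
    | @homogeneous i s =>
      induction m using DirectSum.Decomposition.inductionOn 𝓜 with
      | zero => simp
      | add r r' h h' => simp only [smul_add, map_add, h, h']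
      | @homogeneous j m =>
        have h1 : (r : R) • (s : S) ∈ 𝓢 (i + k) := by
          rw [Algebra.smul_def, mul_comm]
          exact SetLike.GradedMul.mul_mem s.2 (hS _ _ r.2)
        have h2 : (r : R) • (m : M) ∈ 𝓜 (k + j) := by
          rw [Algebra.smul_def]
          exact SetLike.GradedMul.mul_mem (hM _ _ r.2) m.2
        rw [tensorDecomposeAux_of_mem h1 m.2, tensorDecomposeAux_of_mem s.2 h2]
        apply DirectSum.of_eq_of_gradedMonoid_eq
        exact Sigma.subtype_ext (add_assoc i k j) (TensorProduct.smul_tmul _ _ _)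

theorem coe_tensorDecomposeAux (s : S) (m : M) :
    DirectSum.coeAddMonoidHom (tensorGrading R 𝓢 𝓜) (tensorDecomposeAux R 𝓢 𝓜 s m) = s ⊗ₜ m := by
  induction s using DirectSum.Decomposition.inductionOn 𝓢 with
  | zero => simp
  | add r r' h h' => simp only [map_add, AddMonoidHom.add_apply, h, h', add_tmul]
  | @homogeneous i s =>
    induction m using DirectSum.Decomposition.inductionOn 𝓜 with
    | zero => simp
    | add r r' h h' => simp only [map_add, h, h', tmul_add]
    | @homogeneous j m =>
      rw [tensorDecomposeAux_of_mem s.2 m.2, DirectSum.coeAddMonoidHom_of]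

/-- The total grading of the tensor product of two graded algebras over a graded ring. -/
@[reducible]
def tensorGradedRing (hS : ∀ n, ∀ r ∈ 𝓡 n, algebraMap R S r ∈ 𝓢 n)
    (hM : ∀ n, ∀ r ∈ 𝓡 n, algebraMap R M r ∈ 𝓜 n) : GradedRing (tensorGrading R 𝓢 𝓜) :=
  let D : S ⊗[R] M →+ DirectSum ℤ fun n => tensorGrading R 𝓢 𝓜 n :=
    TensorProduct.liftAddHom (tensorDecomposeAux R 𝓢 𝓜) (tensorDecomposeAux_balanced hS hM)
  let _ : DirectSum.Decomposition (tensorGrading R 𝓢 𝓜) :=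
    DirectSum.Decomposition.ofAddHom (tensorGrading R 𝓢 𝓜) D (by
      ext x
      induction x with
      | zero => simp
      | add x y hx hy => rw [map_add, hx, hy, map_add]
      | tmul s m => exact coe_tensorDecomposeAux s m) (by
      ext n ⟨x, hx⟩ : 2
      simp only [AddMonoidHom.comp_apply, DirectSum.coeAddMonoidHom_of, AddMonoidHom.id_apply]
      induction hx using AddSubgroup.closure_induction with
      | mem x hx =>
        obtain ⟨i, j, rfl, s, hs, m, hm, rfl⟩ := hx
        exact tensorDecomposeAux_of_mem hs hm
      | zero => exact (map_zero D).trans (map_zero _).symm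
      | add x y hx hy h h' =>
        refine (map_add D x y).trans ?_
        rw [h, h', ← map_add]
        rfl
      | neg x hx h =>
        refine (map_neg D x).trans ?_
        rw [h, ← map_neg]
        rfl)
  { }

end TensorGrading

/-- The ring map out of a tensor product defined by two ring maps that agree on the base. -/
theorem exists_tensorLift {R S M T : Type*} [CommRing R] [CommRing S] [CommRing M] [CommRing T]
    [Algebra R S] [Algebra R M] (f : S →+* T) (g : M →+* T)
    (h : f.comp (algebraMap R S) = g.comp (algebraMap R M)) :
    ∃ k : S ⊗[R] M →+* T, ∀ s m, k (s ⊗ₜ m) = f s * g m := by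
  let _ : Algebra R T := (f.comp (algebraMap R S)).toAlgebra
  let f' : S →ₐ[R] T := { f with commutes' := fun _ => rfl }
  let g' : M →ₐ[R] T := { g with commutes' := fun r => (RingHom.congr_fun h r).symm }
  exact ⟨(Algebra.TensorProduct.lift f' g' fun _ _ => mul_comm _ _).toRingHom,
    fun s m => Algebra.TensorProduct.lift_tmul _ _ _ s m⟩

end StackCohomology

/-! ### Fibre powers of a map of graded rings and the Amitsur complex -/

namespace StackCohomology

section Cech

variable {R S : Type} [CommRing R] [CommRing S] [Algebra R S]

/-- The `m + 1` coprojections `S → S ⊗[R] K`, where `K` comes with `m` maps `u i : S → K`. -/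
def coprojections {K : Type} [CommRing K] [Algebra R K] {m : ℕ} (u : Fin m → S →+* K) :
    Fin (m + 1) → S →+* S ⊗[R] K :=
  Fin.cons Algebra.TensorProduct.includeLeftRingHom fun i =>
    (Algebra.TensorProduct.includeRight : K →ₐ[R] S ⊗[R] K).toRingHom.comp (u i)

/-- The `m`-fold tensor power `K` of a graded algebra `S` over the graded ring `R`, described by
its universal property, with the differential `d` of the Amitsur complex from `K` to the
next tensor power `S ⊗[R] K`. The ring maps out of `K` are the `m`-tuples of ring maps out of `S`
that agree on `R`, and `map_d` says that `d` is the alternating sum of the coface maps: after a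
ring map `g` out of `S ⊗[R] K`, the `i`-th coface map becomes the map `F i` that belongs to the
tuple from which the `i`-th entry is omitted. -/
structure CechModel (𝓡 : ℤ → AddSubgroup R) (𝓢 : ℤ → AddSubgroup S) (m : ℕ) where
  K : Type
  [ring : CommRing K]
  [alg : Algebra R K]
  grading : ℤ → AddSubgroup K
  [graded : GradedRing grading]
  algebraMap_mem : ∀ n, ∀ r ∈ 𝓡 n, algebraMap R K r ∈ grading n
  u : Fin m → S →+* K
  u_comp : ∀ i, (u i).comp (algebraMap R S) = algebraMap R K
  u_mem : ∀ i n, ∀ s ∈ 𝓢 n, u i s ∈ grading n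
  hom_ext : ∀ {T : Type} [CommRing T] (f g : K →+* T),
    f.comp (algebraMap R K) = g.comp (algebraMap R K) →
    (∀ i, f.comp (u i) = g.comp (u i)) → f = g
  exists_desc : ∀ {T : Type} [CommRing T] (q : R →+* T) (p : Fin m → S →+* T),
    (∀ i, (p i).comp (algebraMap R S) = q) →
    ∃ f : K →+* T, f.comp (algebraMap R K) = q ∧ ∀ i, f.comp (u i) = p i
  mem_of_comp_mem : ∀ {T : Type} [CommRing T] (𝓣 : ℤ → AddSubgroup T) [SetLike.GradedMonoid 𝓣]
    (f : K →+* T), (∀ n, ∀ r ∈ 𝓡 n, f (algebraMap R K r) ∈ 𝓣 n) →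
    (∀ i n, ∀ s ∈ 𝓢 n, f (u i s) ∈ 𝓣 n) → ∀ n, ∀ x ∈ grading n, f x ∈ 𝓣 n
  d : K →ₗ[R] S ⊗[R] K
  d_mem : ∀ n, ∀ x ∈ grading n, d x ∈ tensorGrading R 𝓢 grading n
  map_d : ∀ {T : Type} [CommRing T] (g : S ⊗[R] K →+* T) (F : Fin (m + 1) → K →+* T),
    (∀ i, (F i).comp (algebraMap R K) = g.comp (algebraMap R (S ⊗[R] K))) →
    (∀ i j, (F i).comp (u j) = g.comp (coprojections u (i.succAbove j))) →
    ∀ x, g (d x) = ∑ i : Fin (m + 1), (-1 : ℤ) ^ (i : ℕ) • F i x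

attribute [instance] CechModel.ring CechModel.alg CechModel.graded

variable {𝓡 : ℤ → AddSubgroup R} {𝓢 : ℤ → AddSubgroup S} {m : ℕ}

theorem CechModel.ringHom_ext (M : CechModel 𝓡 𝓢 m) {T : Type} [CommRing T]
    (f g : S ⊗[R] M.K →+* T)
    (hfg : f.comp (algebraMap R (S ⊗[R] M.K)) = g.comp (algebraMap R (S ⊗[R] M.K)))
    (hu : ∀ i, f.comp (coprojections M.u i) = g.comp (coprojections M.u i)) : f = g := by
  have hr := M.hom_ext
    (f.comp (Algebra.TensorProduct.includeRight : M.K →ₐ[R] S ⊗[R] M.K).toRingHom)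
    (g.comp (Algebra.TensorProduct.includeRight : M.K →ₐ[R] S ⊗[R] M.K).toRingHom) (by
      have : (Algebra.TensorProduct.includeRight : M.K →ₐ[R] S ⊗[R] M.K).toRingHom.comp
          (algebraMap R M.K) = algebraMap R (S ⊗[R] M.K) :=
        AlgHom.comp_algebraMap (Algebra.TensorProduct.includeRight : M.K →ₐ[R] S ⊗[R] M.K)
      rw [RingHom.comp_assoc, RingHom.comp_assoc, this, hfg]) (fun i => hu i.succ)
  refine RingHom.ext fun x => ?_
  induction x with
  | zero => simp
  | add x y hx hy => rw [map_add, map_add, hx, hy]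
  | tmul s x =>
    have h1 := RingHom.congr_fun (hu 0) s
    have h2 := RingHom.congr_fun hr x
    have h3 : s ⊗ₜ[R] x = (s ⊗ₜ 1) * (1 ⊗ₜ x) := by simp
    rw [h3, map_mul, map_mul]
    exact congrArg₂ (· * ·) h1 h2

variable [GradedRing 𝓡] [GradedRing 𝓢]

/-- The zeroth tensor power is the base ring. -/
def CechModel.zero : CechModel 𝓡 𝓢 0 where
  K := R
  grading := 𝓡
  algebraMap_mem _ _ hr := hr
  u := Fin.elim0
  u_comp i := i.elim0
  u_mem i := i.elim0
  hom_ext f g hfg _ := RingHom.ext fun r => RingHom.congr_fun hfg r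
  exists_desc q p _ := ⟨q, RingHom.ext fun _ => rfl, fun i => i.elim0⟩
  mem_of_comp_mem 𝓣 _ f hf _ n x hx := hf n x hx
  d := TensorProduct.mk R S R 1
  d_mem n x hx := tmul_mem_tensorGrading (zero_add n) SetLike.GradedOne.one_mem hx
  map_d g F hF _ x := by
    have h1 := RingHom.congr_fun (hF 0) x
    simp only [RingHom.comp_apply, Algebra.algebraMap_self, RingHom.id_apply] at h1
    rw [Fin.sum_univ_one, h1]
    rw [Algebra.TensorProduct.algebraMap_apply']
    simp

/-- Passage to the next tensor power. -/
def CechModel.succ (M : CechModel 𝓡 𝓢 m) (h : ∀ n, ∀ r ∈ 𝓡 n, algebraMap R S r ∈ 𝓢 n) :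
    CechModel 𝓡 𝓢 (m + 1) where
  K := S ⊗[R] M.K
  grading := tensorGrading R 𝓢 M.grading
  graded := tensorGradedRing h M.algebraMap_mem
  algebraMap_mem n r hr := by
    rw [Algebra.TensorProduct.algebraMap_apply]
    exact tmul_mem_tensorGrading (add_zero n) (h n r hr) SetLike.GradedOne.one_mem
  u := coprojections M.u
  u_comp i := by
    refine Fin.cases ?_ (fun i => ?_) i
    · rfl
    · ext r
      have := RingHom.congr_fun (M.u_comp i) r
      simp only [RingHom.comp_apply] at this
      simp only [coprojections, Fin.cons_succ, RingHom.comp_apply, this]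
      exact AlgHom.commutes _ r
  u_mem i n s hs := by
    refine Fin.cases ?_ (fun i => ?_) i
    · exact tmul_mem_tensorGrading (add_zero n) hs SetLike.GradedOne.one_mem
    · exact tmul_mem_tensorGrading (zero_add n) SetLike.GradedOne.one_mem (M.u_mem i n s hs)
  hom_ext := M.ringHom_ext
  exists_desc q p hp := by
    obtain ⟨f, hf, hu⟩ := M.exists_desc q (fun i => p i.succ) (fun i => hp _)
    obtain ⟨k, hk⟩ := exists_tensorLift (p 0) f ((hp 0).trans hf.symm)
    refine ⟨k, ?_, fun i => ?_⟩
    · ext r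
      rw [RingHom.comp_apply, Algebra.TensorProduct.algebraMap_apply, hk, map_one, mul_one]
      exact RingHom.congr_fun (hp 0) r
    · refine Fin.cases ?_ (fun i => ?_) i
      · ext s
        exact (hk s 1).trans (by simp)
      · ext s
        rw [← hu i]
        exact (hk 1 _).trans (by simp)
  mem_of_comp_mem {T _} 𝓣 _ f hf hu n x hx := by
    have key := M.mem_of_comp_mem 𝓣
      (f.comp (Algebra.TensorProduct.includeRight : M.K →ₐ[R] S ⊗[R] M.K).toRingHom)
      (fun n r hr => by
        have := hf n r hr
        rwa [Algebra.TensorProduct.algebraMap_apply'] at this) (fun i => hu i.succ)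
    induction hx using AddSubgroup.closure_induction with
    | mem x hx =>
      obtain ⟨i, j, rfl, s, hs, y, hy, rfl⟩ := hx
      have h3 : s ⊗ₜ[R] y = (s ⊗ₜ 1) * (1 ⊗ₜ y) := by simp
      rw [h3, map_mul]
      exact SetLike.GradedMul.mul_mem (hu 0 i s hs) (key j y hy)
    | zero => rw [map_zero]; exact zero_mem _
    | add x y _ _ hx hy => rw [map_add]; exact add_mem hx hy
    | neg x _ hx => rw [map_neg]; exact neg_mem hx
  d := TensorProduct.mk R S (S ⊗[R] M.K) 1 - M.d.lTensor S
  d_mem n x hx := by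
    refine sub_mem (tmul_mem_tensorGrading (zero_add n) SetLike.GradedOne.one_mem hx) ?_
    induction hx using AddSubgroup.closure_induction with
    | mem x hx =>
      obtain ⟨i, j, rfl, s, hs, y, hy, rfl⟩ := hx
      exact tmul_mem_tensorGrading rfl hs (M.d_mem j y hy)
    | zero => rw [map_zero]; exact zero_mem _
    | add x y _ _ hx hy => rw [map_add]; exact add_mem hx hy
    | neg x _ hx => rw [map_neg]; exact neg_mem hx
  map_d {T _} g F hF hu x := by
    let ι : M.K →+* S ⊗[R] M.K :=
      (Algebra.TensorProduct.includeRight : M.K →ₐ[R] S ⊗[R] M.K).toRingHom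
    let ι' : S ⊗[R] M.K →+* S ⊗[R] (S ⊗[R] M.K) :=
      (Algebra.TensorProduct.includeRight : S ⊗[R] M.K →ₐ[R] S ⊗[R] (S ⊗[R] M.K)).toRingHom
    have hι : ι.comp (algebraMap R M.K) = algebraMap R _ :=
      AlgHom.comp_algebraMap (Algebra.TensorProduct.includeRight : M.K →ₐ[R] S ⊗[R] M.K)
    have hι' : ι'.comp (algebraMap R _) = algebraMap R _ := AlgHom.comp_algebraMap
      (Algebra.TensorProduct.includeRight : S ⊗[R] M.K →ₐ[R] S ⊗[R] (S ⊗[R] M.K))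
    -- The `0`-th summand is `1 ⊗ x`, and the others assemble to `(id ⊗ d) x`
    have h0 : F 0 = g.comp ι' := by
      refine M.ringHom_ext _ _ ?_ fun i => ?_
      · rw [RingHom.comp_assoc, hι', hF]
      · exact hu 0 i
    rw [Fin.sum_univ_succ, h0]
    change g (ι' x - M.d.lTensor S x) = _
    rw [map_sub, sub_eq_add_neg]
    congr 1
    · simp
    induction x with
    | zero => simp
    | add x y hx hy =>
      rw [map_add, map_add, neg_add, hx, hy, ← Finset.sum_add_distrib]
      exact Finset.sum_congr rfl fun i _ => by rw [map_add, smul_add]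
    | tmul s x =>
      have hs : ∀ j : Fin (m + 1), F j.succ (s ⊗ₜ 1) = g (s ⊗ₜ 1) := fun j =>
        RingHom.congr_fun (hu j.succ 0) s
      have hd := M.map_d (g.comp ι') (fun j => (F j.succ).comp ι) (fun j => by
        rw [RingHom.comp_assoc, RingHom.comp_assoc, hι, hι', hF]) (fun j k => by
        have := hu j.succ k.succ
        rw [Fin.succ_succAbove_succ] at this
        exact this) x
      have h1 : s ⊗ₜ[R] M.d x = (s ⊗ₜ 1) * ι' (M.d x) := by simp [ι']
      have h2 : s ⊗ₜ[R] x = (s ⊗ₜ 1) * ι x := by simp [ι]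
      rw [LinearMap.lTensor_tmul, h1, map_mul]
      rw [RingHom.comp_apply] at hd
      rw [hd, Finset.mul_sum, ← Finset.sum_neg_distrib]
      refine Finset.sum_congr rfl fun j _ => ?_
      rw [h2, map_mul, hs, Fin.val_succ, pow_succ, mul_smul_comm]
      simp

theorem exists_cechModel (h : ∀ n, ∀ r ∈ 𝓡 n, algebraMap R S r ∈ 𝓢 n) (m : ℕ) :
    Nonempty (CechModel 𝓡 𝓢 m) := by
  induction m with
  | zero => exact ⟨.zero⟩
  | succ m ih => exact ih.map fun M => M.succ h

/-- The Amitsur complex of a pure ring map is exact: by the recursion `d x = 1 ⊗ x - (id ⊗ d) x`,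
a cocycle lies in the image of the preceding differential after tensoring with `S`. -/
theorem CechModel.exists_of_d_eq_zero (M : CechModel 𝓡 𝓢 m)
    (h : ∀ n, ∀ r ∈ 𝓡 n, algebraMap R S r ∈ 𝓢 n)
    (hpure : ∀ (N : Type) [AddCommGroup N] [Module R N],
      Function.Injective (TensorProduct.mk R S N 1))
    {x : S ⊗[R] M.K} (hx : (M.succ h).d x = 0) : ∃ y, M.d y = x := by
  have h1 : (1 : S) ⊗ₜ[R] x = M.d.lTensor S x := sub_eq_zero.1 hx
  -- The class of `x` in the cokernel of `d` becomes zero after tensoring with `S`.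
  have h2 := congrArg ((LinearMap.range M.d).mkQ.lTensor S) h1
  rw [← LinearMap.comp_apply, ← LinearMap.lTensor_comp, LinearMap.range_mkQ_comp,
    LinearMap.lTensor_zero] at h2
  have h3 := hpure _ (h2.trans (map_zero (TensorProduct.mk R S _ 1)).symm)
  exact (Submodule.Quotient.mk_eq_zero _).1 h3

end Cech

end StackCohomology

/-! ### Affine schemes with an action of the multiplicative group, mapping to the plane -/

namespace StackCohomology

/-- The graded ring that underlies a graded algebra. -/
@[reducible]
def gradedRingToAddSubgroup {R T : Type*} [CommRing R] [CommRing T] [Algebra R T]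
    (𝒜 : ℤ → Submodule R T) [GradedAlgebra 𝒜] : GradedRing fun n => (𝒜 n).toAddSubgroup where
  one_mem := (SetLike.GradedOne.one_mem : (1 : T) ∈ 𝒜 0)
  mul_mem {i j} _ _ ha hb := (SetLike.GradedMul.mul_mem ha hb : _ ∈ 𝒜 (i + j))
  decompose' := DirectSum.Decomposition.decompose' (ℳ := 𝒜)
  left_inv := DirectSum.Decomposition.left_inv (ℳ := 𝒜)
  right_inv := DirectSum.Decomposition.right_inv (ℳ := 𝒜)

/-- A `ℤ`-graded ring with elements `A` and `B` of degrees `1` and `3`: a `𝔾ₘ`-equivariant map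
from an affine scheme with an action of `𝔾ₘ` to the plane. -/
structure GradedPair where
  T : Type
  [ring : CommRing T]
  grading : ℤ → AddSubgroup T
  [graded : GradedRing grading]
  A : T
  B : T
  A_mem : A ∈ grading 1
  B_mem : B ∈ grading 3

namespace GradedPair

attribute [instance] ring graded

/-- The maps of graded rings that respect the elements `A` and `B`. -/
structure IsMap (G G' : GradedPair) (f : G.T →+* G'.T) : Prop where
  mem : ∀ n, ∀ t ∈ G.grading n, f t ∈ G'.grading n
  map_A : f G.A = G'.A
  map_B : f G.B = G'.B

theorem IsMap.comp {G G' G'' : GradedPair} {g : G'.T →+* G''.T} {f : G.T →+* G'.T}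
    (hg : IsMap G' G'' g) (hf : IsMap G G' f) : IsMap G G'' (g.comp f) :=
  ⟨fun n t ht => hg.mem n _ (hf.mem n t ht), by simp [hf.map_A, hg.map_A],
    by simp [hf.map_B, hg.map_B]⟩

end GradedPair

namespace Mbar

instance gradedRing_toAddSubgroup (Y : Mbar) :
    GradedRing fun n => (Y.grading n).toAddSubgroup :=
  gradedRingToAddSubgroup Y.grading

/-- The graded ring of functions on the torsor. -/
abbrev toPair (Y : Mbar) : GradedPair where
  T := Y.T
  grading n := (Y.grading n).toAddSubgroup
  A := Y.A
  B := Y.B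
  A_mem := Y.A_mem
  B_mem := Y.B_mem

theorem isMap_total {Y Z : Mbar} (f : Z ⟶ Y) : GradedPair.IsMap Y.toPair Z.toPair f.total :=
  ⟨f.total_mem, f.total_A, f.total_B⟩

/-- A morphism of the stack is determined by an arbitrary graded ring map that respects `A`
and `B`. -/
theorem exists_hom {Y Z : Mbar} {g : Y.T →+* Z.T}
    (hg : GradedPair.IsMap Y.toPair Z.toPair g) : ∃ f : Z ⟶ Y, f.total = g := by
  have h : ∀ r, ∃ s, algebraMap Z.R Z.T s = g (algebraMap Y.R Y.T r) := fun r =>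
    Z.exists_of_mem_zero _ (hg.mem 0 _ (SetLike.algebraMap_mem_graded Y.grading r))
  choose b hb using h
  let β : Y.R →+* Z.R :=
    { toFun := b
      map_one' := Z.algebraMap_injective (by simp [hb])
      map_mul' := fun x y => Z.algebraMap_injective (by simp [hb])
      map_zero' := Z.algebraMap_injective (by simp [hb])
      map_add' := fun x y => Z.algebraMap_injective (by simp [hb]) }
  have := span_two_isPrime
  have hβ : β.comp (algebraMap Z2 Y.R) = algebraMap Z2 Z.R :=
    IsLocalization.ringHom_ext (Ideal.span {(2 : ℤ)}).primeCompl (RingHom.ext_int _ _)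
  exact ⟨⟨{ β with commutes' := RingHom.congr_fun hβ }, g, fun r => (hb r).symm, hg.mem,
    hg.map_A, hg.map_B⟩, rfl⟩

end Mbar

namespace GradedPair

/-- The homogeneous parts as modules over the degree zero part. -/
def submodule (G : GradedPair) (n : ℤ) : Submodule (G.grading 0) G.T :=
  { (G.grading n) with
    smul_mem' := fun r t ht => by
      have := SetLike.GradedMul.mul_mem (A := G.grading) r.2 ht
      rwa [zero_add] at this }

/-- A strongly graded `ℤ_(2)`-algebra in which `A` and `B` generate the unit ideal is the ring of
functions on a torsor over the spectrum of its degree zero part. -/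
def torsor (G : GradedPair) (c : Z2 →+* G.T) (hc : ∀ x, c x ∈ G.grading 0)
    (hone : ∀ n, (1 : G.T) ∈ G.submodule n * G.submodule (-n))
    (hspan : Ideal.span {G.A, G.B} = ⊤) : Mbar where
  R := G.grading 0
  T := G.T
  algR := (RingHom.codRestrict c (SetLike.GradeZero.subring G.grading) hc).toAlgebra
  grading := G.submodule
  graded :=
    { one_mem := (SetLike.GradedOne.one_mem : (1 : G.T) ∈ G.grading 0)
      mul_mem := fun {i j} _ _ ha hb =>
        (SetLike.GradedMul.mul_mem ha hb : _ ∈ G.grading (i + j))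
      decompose' := DirectSum.Decomposition.decompose' (ℳ := G.grading)
      left_inv := DirectSum.Decomposition.left_inv (ℳ := G.grading)
      right_inv := DirectSum.Decomposition.right_inv (ℳ := G.grading) }
  algebraMap_injective := Subtype.val_injective
  exists_of_mem_zero t ht := ⟨⟨t, ht⟩, rfl⟩
  one_mem_mul := hone
  A := G.A
  B := G.B
  A_mem := G.A_mem
  B_mem := G.B_mem
  span_eq_top := hspan

/-- A graded ring that receives a map from the functions on a torsor is itself the ring of
functions on a torsor. -/
def toMbar (G : GradedPair) {Y : Mbar} {f : Y.T →+* G.T} (hf : IsMap Y.toPair G f) : Mbar :=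
  G.torsor ((f.comp (algebraMap Y.R Y.T)).comp (algebraMap Z2 Y.R))
    (fun _ => hf.mem 0 _ (SetLike.algebraMap_mem_graded Y.grading _))
    (fun n => by
      have : ∀ w ∈ Y.grading n * Y.grading (-n), f w ∈ G.submodule n * G.submodule (-n) := by
        intro w hw
        induction hw using Submodule.mul_induction_on' with
        | mem_mul_mem u hu v hv =>
          rw [map_mul]
          exact Submodule.mul_mem_mul (hf.mem n u hu) (hf.mem (-n) v hv)
        | add x _ y _ hx hy => rw [map_add]; exact add_mem hx hy
      have h := this 1 (Y.one_mem_mul n)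
      rwa [map_one] at h)
    (by
      have h := congrArg (Ideal.map f) Y.span_eq_top
      have h1 : f Y.A = G.A := hf.map_A
      have h2 : f Y.B = G.B := hf.map_B
      rwa [Ideal.map_span, Ideal.map_top, Set.image_pair, h1, h2] at h)

/-- The functor of points of the quotient stack of an affine scheme by `𝔾ₘ`, relative to `M`. -/
def points (G : GradedPair) : Mbarᵒᵖ ⥤ Type 1 where
  obj Z := ULift.{1} {f : G.T →+* Z.unop.T // IsMap G Z.unop.toPair f}
  map g := ↾fun f => ⟨⟨g.unop.total.comp f.down.1, (Mbar.isMap_total g.unop).comp f.down.2⟩⟩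
  map_id _ := rfl
  map_comp _ _ := rfl

theorem points_ext {G : GradedPair} {Z : Mbarᵒᵖ} {x y : G.points.obj Z}
    (h : ∀ t, x.down.1 t = y.down.1 t) : x = y :=
  ULift.ext _ _ (Subtype.ext (RingHom.ext h))

/-- The map of functors of points which is induced by a map of graded rings. -/
def pointsMap {G G' : GradedPair} {f : G.T →+* G'.T} (hf : IsMap G G' f) :
    G'.points ⟶ G.points where
  app _ := ↾fun x => ⟨⟨x.down.1.comp f, x.down.2.comp hf⟩⟩
  naturality _ _ _ := rfl

/-- The universal point of the functor of points of a torsor. -/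
def idPoint (Y : Mbar) : Y.toPair.points.obj (op Y) :=
  ⟨⟨RingHom.id Y.T, fun _ _ h => h, rfl, rfl⟩⟩

theorem isUniversal_idPoint (Y : Mbar) : sections.IsUniversal (idPoint Y) := by
  intro Z q
  obtain ⟨f, hf⟩ := Mbar.exists_hom q.down.2
  refine ⟨f, points_ext fun t => RingHom.congr_fun hf t, fun g hg => ?_⟩
  refine Mbar.hom_ext _ _ (RingHom.ext fun t => ?_)
  rw [hf, ← hg]
  rfl

/-- A homogeneous element defines a section of `𝒪(n)` over the quotient stack. -/
def toSection (G : GradedPair) (n : ℤ) (t : G.grading n) :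
    sections G.points (Mbar.twist n).obj :=
  ⟨fun _ x => ULift.up ⟨x.down.1 t, x.down.2.mem n t t.2⟩, fun _ _ _ _ => rfl⟩

end GradedPair

end StackCohomology

/-! ### Čech complexes of the line bundles -/

namespace StackCohomology

universe w v u

namespace GradedPair

variable {G G' : GradedPair} [Algebra G.T G'.T] {m : ℕ}

/-- The tensor power as a graded ring with two elements. -/
abbrev ofCechModel (M : CechModel G.grading G'.grading m) : GradedPair where
  T := M.K
  grading := M.grading
  A := algebraMap G.T M.K G.A
  B := algebraMap G.T M.K G.B
  A_mem := M.algebraMap_mem 1 _ G.A_mem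
  B_mem := M.algebraMap_mem 3 _ G.B_mem

theorem isMap_algebraMap (M : CechModel G.grading G'.grading m) :
    IsMap G (ofCechModel M) (algebraMap G.T M.K) :=
  ⟨M.algebraMap_mem, rfl, rfl⟩

theorem isMap_u (M : CechModel G.grading G'.grading m) (h : IsMap G G' (algebraMap G.T G'.T))
    (i : Fin m) : IsMap G' (ofCechModel M) (M.u i) :=
  ⟨M.u_mem i, by rw [← h.map_A]; exact RingHom.congr_fun (M.u_comp i) _,
    by rw [← h.map_B]; exact RingHom.congr_fun (M.u_comp i) _⟩

/-- A point of the tensor power is a tuple of points. -/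
def toFibrePower (M : CechModel G.grading G'.grading m) (h : IsMap G G' (algebraMap G.T G'.T)) :
    (ofCechModel M).points ⟶ fibrePower (pointsMap h) m where
  app _ := ↾fun x => ⟨(⟨⟨x.down.1.comp (algebraMap G.T M.K), x.down.2.comp (isMap_algebraMap M)⟩⟩,
    fun i => ⟨⟨x.down.1.comp (M.u i), x.down.2.comp (isMap_u M h i)⟩⟩), fun i =>
      points_ext fun t => congrArg x.down.1 (RingHom.congr_fun (M.u_comp i) t)⟩
  naturality _ _ _ := rfl

theorem toFibrePower_bijective (M : CechModel G.grading G'.grading m)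
    (h : IsMap G G' (algebraMap G.T G'.T)) (Z : Mbarᵒᵖ) :
    Function.Bijective ((toFibrePower M h).app Z) := by
  constructor
  · intro x y hxy
    have h1 := congrArg (fun z => z.1.1.down.1) hxy
    have h2 := fun i => congrArg (fun z => (z.1.2 i).down.1) hxy
    have := M.hom_ext x.down.1 y.down.1 h1 h2
    exact points_ext fun t => RingHom.congr_fun this t
  · intro x
    have hx : ∀ i, (x.1.2 i).down.1.comp (algebraMap G.T G'.T) = x.1.1.down.1 := fun i =>
      congrArg (fun z => z.down.1) (x.2 i)
    obtain ⟨f, hf, hu⟩ := M.exists_desc x.1.1.down.1 (fun i => (x.1.2 i).down.1) hx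
    refine ⟨⟨⟨f, M.mem_of_comp_mem Z.unop.toPair.grading f ?_ ?_, ?_, ?_⟩⟩, ?_⟩
    · intro n r hr
      rw [← RingHom.comp_apply, hf]
      exact x.1.1.down.2.mem n r hr
    · intro i n s hs
      rw [← RingHom.comp_apply, hu]
      exact (x.1.2 i).down.2.mem n s hs
    · exact (RingHom.congr_fun hf _).trans x.1.1.down.2.map_A
    · exact (RingHom.congr_fun hf _).trans x.1.1.down.2.map_B
    · exact fibrePower.hext (points_ext fun t => RingHom.congr_fun hf t)
        fun i => points_ext fun t => RingHom.congr_fun (hu i) t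

end GradedPair

/-- Additive maps that preserve degrees commute with the projections to homogeneous parts. -/
theorem coe_decompose_map {ι A B : Type*} [DecidableEq ι] [AddCommGroup A] [AddCommGroup B]
    (𝒜 : ι → AddSubgroup A) (ℬ : ι → AddSubgroup B) [DirectSum.Decomposition 𝒜]
    [DirectSum.Decomposition ℬ] (d : A →+ B) (hd : ∀ n, ∀ x ∈ 𝒜 n, d x ∈ ℬ n) (x : A) (n : ι) :
    d (DirectSum.decompose 𝒜 x n) = DirectSum.decompose ℬ (d x) n := by
  induction x using DirectSum.Decomposition.inductionOn 𝒜 with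
  | zero => simp
  | @homogeneous i m =>
    have hm := hd i m m.2
    by_cases h : i = n
    · subst h
      rw [DirectSum.decompose_of_mem_same _ m.2, DirectSum.decompose_of_mem_same _ hm]
    · rw [DirectSum.decompose_of_mem_ne _ m.2 h, DirectSum.decompose_of_mem_ne _ hm h, map_zero]
  | add x y hx hy => simp [DirectSum.decompose_add, hx, hy]

theorem sections.IsUniversal.map_of_bijective {C : Type u} [Category.{v} C] {P Q : Cᵒᵖ ⥤ Type w}
    {Y : C} {p : P.obj (op Y)} (hp : IsUniversal p) (π : P ⟶ Q)
    (hπ : ∀ Z, Function.Bijective (π.app Z)) : IsUniversal (π.app _ p) := by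
  intro Z q
  obtain ⟨x, rfl⟩ := (hπ _).2 q
  obtain ⟨f, hf, hu⟩ := hp x
  refine ⟨f, ?_, fun g hg => hu g ((hπ _).1 ?_)⟩
  · rw [← hf]
    exact (NatTrans.naturality_apply π f.op p).symm
  · rw [← hg]
    exact NatTrans.naturality_apply π g.op p

theorem sections.pullback_surjective_of_bijective {C : Type u} [Category.{v} C] {P Q : Cᵒᵖ ⥤ Type w}
    {G : Cᵒᵖ ⥤ AddCommGrpCat.{w}} (π : P ⟶ Q) (hπ : ∀ Z, Function.Bijective (π.app Z)) :
    Function.Surjective (pullback G π) := by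
  intro s
  let e := fun Z => Equiv.ofBijective _ (hπ Z)
  refine ⟨⟨fun Z q => s.1 Z ((e Z).symm q), fun Z W f q => ?_⟩, sections.ext fun Z p => ?_⟩
  · refine (map_apply s f _).trans (congrArg (s.1 W) ((e W).eq_symm_apply.2 ?_))
    refine (NatTrans.naturality_apply π f _).trans ?_
    exact congrArg _ ((e Z).apply_symm_apply q)
  · exact congrArg _ ((e Z).symm_apply_apply p)

namespace GradedPair

variable {G : GradedPair} {Y : Mbar} [Algebra G.T Y.T]
  (h : IsMap G Y.toPair (algebraMap G.T Y.T))

/-- The fibre powers of a torsor over a quotient stack are torsors. -/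
theorem exists_isUniversal_fibrePower (m : ℕ) : ∃ (Z : Mbar)
    (p : (fibrePower (pointsMap h) (m + 1)).obj (op Z)), sections.IsUniversal p := by
  obtain ⟨M⟩ := exists_cechModel (𝓡 := G.grading) (𝓢 := Y.toPair.grading) h.mem (m + 1)
  let Z := (ofCechModel (G' := Y.toPair) M).toMbar (Y := Y) (f := M.u 0) (isMap_u M h 0)
  exact ⟨Z, _, (isUniversal_idPoint Z).map_of_bijective
    (toFibrePower (G' := Y.toPair) M h) (toFibrePower_bijective M h)⟩

/-- Descent along pure maps: a Čech cocycle of a line bundle is the differential of a homogeneous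
element of the preceding tensor power. -/
theorem exists_toSection_of_cechD_eq_zero (hpure : ∀ (N : Type) [AddCommGroup N] [Module G.T N],
    Function.Injective (TensorProduct.mk G.T Y.T N 1)) {n : ℤ} {m : ℕ}
    (M : CechModel G.grading Y.toPair.grading m)
    (c : sections (fibrePower (pointsMap h) (m + 1)) (Mbar.twist n).obj)
    (hc : cechD (pointsMap h) (Mbar.twist n).obj (m + 1) c = 0) :
    ∃ x : M.grading n, ∀ b, sections.pullback _ (toFibrePower (G' := Y.toPair) M h) b =
      toSection (ofCechModel (G' := Y.toPair) M) n x → cechD (pointsMap h) _ m b = c := by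
  let M₁ := M.succ h.mem
  let M₂ := M₁.succ h.mem
  let Z₁ : Mbar := (ofCechModel (G' := Y.toPair) M₁).toMbar (Y := Y) (f := M₁.u 0)
      (isMap_u M₁ h 0)
  let Z₂ : Mbar := (ofCechModel (G' := Y.toPair) M₂).toMbar (Y := Y) (f := M₂.u 0)
      (isMap_u M₂ h 0)
  -- The value of the cochain at the universal point, which determines the cochain.
  let y : M₁.grading n := (c.1 (op Z₁) ((toFibrePower (G' := Y.toPair) M₁ h).app _ (idPoint Z₁))).down
  have hcy : ∀ (Z : Mbar) (x : (ofCechModel (G' := Y.toPair) M₁).points.obj (op Z)),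
      ((c.1 (op Z) ((toFibrePower (G' := Y.toPair) M₁ h).app _ x)).down : Z.T) = x.down.1 y := by
    intro Z x
    obtain ⟨f, hf, -⟩ := isUniversal_idPoint Z₁ x
    have h1 := sections.map_apply c f.op ((toFibrePower (G' := Y.toPair) M₁ h).app _ (idPoint Z₁))
    have h2 := congrArg (c.1 (op Z)) (NatTrans.naturality_apply
      (toFibrePower (G' := Y.toPair) M₁ h) f.op (idPoint Z₁))
    have h3 := congrArg (fun z => c.1 (op Z) ((toFibrePower (G' := Y.toPair) M₁ h).app _ z)) hf
    have h4 := congrArg (fun z => (ULift.down z).1) (h1.trans (h2.symm.trans h3))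
    refine h4.symm.trans ?_
    exact RingHom.congr_fun (congrArg (fun z => z.down.1) hf) (y : M₁.K)
  have hsum : ∀ (k : ℕ) (s : sections (fibrePower (pointsMap h) k) (Mbar.twist n).obj) (Z : Mbar)
      (x : (fibrePower (pointsMap h) (k + 1)).obj (op Z)),
      (((cechD (pointsMap h) (Mbar.twist n).obj k s).1 (op Z) x).down : Z.T) =
        ∑ i : Fin (k + 1), (-1 : ℤ) ^ (i : ℕ) •
          ((s.1 (op Z) ((fibrePower.face _ k i).app _ x)).down : Z.T) := by
    intro k s Z x
    rw [cechD_apply]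
    let ψ : ULift.{1} (Z.grading n) →+ Z.T :=
      (Z.grading n).toAddSubgroup.subtype.comp AddEquiv.ulift.toAddMonoidHom
    refine (map_sum ψ _ _).trans (Finset.sum_congr rfl fun i _ => map_zsmul ψ _ _)
  -- The cocycle condition at the universal point of the next tensor power.
  have hd : M₁.d y = 0 := by
    let p := (toFibrePower (G' := Y.toPair) M₂ h).app _ (idPoint Z₂)
    have hF := fun i => (toFibrePower_bijective (G' := Y.toPair) M₁ h (op Z₂)).2 ((fibrePower.face _ _ i).app _ p)
    choose F hF using hF
    have h1 := M₁.map_d (RingHom.id _) (fun i => (F i).down.1)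
      (fun i => congrArg (fun z => z.1.1.down.1) (hF i))
      (fun i j => congrArg (fun z => (z.1.2 j).down.1) (hF i)) y
    refine h1.trans ?_
    have h2 := hsum (m + 1) c Z₂ p
    rw [hc] at h2
    refine Eq.trans ?_ h2.symm
    refine Finset.sum_congr rfl fun i _ => ?_
    rw [← hF, hcy]
    rfl
  obtain ⟨x, hx⟩ := M.exists_of_d_eq_zero h.mem hpure hd
  -- A homogeneous preimage, since the differential preserves degrees.
  have hxn : M.d (DirectSum.decompose M.grading x n : M.K) = (y : M₁.K) := by
    have h1 := coe_decompose_map M.grading M₁.grading M.d.toAddMonoidHom M.d_mem x n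
    have h2 : M.d.toAddMonoidHom x = (y : M₁.K) := hx
    exact h1.trans ((congrArg (fun z => (DirectSum.decompose M₁.grading z n : M₁.K)) h2).trans
      (DirectSum.decompose_of_mem_same _ y.2))
  refine ⟨DirectSum.decompose M.grading x n, fun b hb => sections.ext fun Z z => ?_⟩
  obtain ⟨g, rfl⟩ := (toFibrePower_bijective (G' := Y.toPair) M₁ h Z).2 z
  have hF := fun i => (toFibrePower_bijective (G' := Y.toPair) M h Z).2
    ((fibrePower.face _ _ i).app _ ((toFibrePower (G' := Y.toPair) M₁ h).app _ g))
  choose F hF using hF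
  refine ULift.ext _ _ (Subtype.ext ?_)
  refine (hsum m b Z.unop _).trans (Eq.trans ?_ (hcy Z.unop g).symm)
  have h1 := M.map_d g.down.1 (fun i => (F i).down.1)
      (fun i => congrArg (fun z => z.1.1.down.1) (hF i))
      (fun i j => congrArg (fun z => (z.1.2 j).down.1) (hF i)) (DirectSum.decompose M.grading x n)
  rw [hxn] at h1
  refine Eq.trans ?_ h1.symm
  refine Finset.sum_congr rfl fun i _ => ?_
  congr 1
  have h2 := congrArg (fun s => (ULift.down (s.1 Z (F i))).1) hb
  refine Eq.trans ?_ h2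
  exact congrArg (fun z => (ULift.down (b.1 Z z)).1) (hF i).symm

/-- The Čech complexes of the line bundles for pure maps are exact in positive degrees. -/
theorem cechExact_twist (hpure : ∀ (N : Type) [AddCommGroup N] [Module G.T N],
    Function.Injective (TensorProduct.mk G.T Y.T N 1)) (n : ℤ) :
    CechExact (pointsMap h) (Mbar.twist n).obj := by
  intro m c hc
  obtain ⟨M⟩ := exists_cechModel (𝓡 := G.grading) (𝓢 := Y.toPair.grading) h.mem m
  obtain ⟨x, hx⟩ := exists_toSection_of_cechD_eq_zero h hpure M c hc
  obtain ⟨b, hb⟩ := sections.pullback_surjective_of_bijective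
    (toFibrePower (G' := Y.toPair) M h) (toFibrePower_bijective (G' := Y.toPair) M h)
    (toSection (ofCechModel (G' := Y.toPair) M) n x)
  exact ⟨b, hx b hb⟩

/-- The sections of a line bundle over a quotient stack which is covered by a torsor along a pure
map are the homogeneous elements. -/
theorem toSection_surjective (hpure : ∀ (N : Type) [AddCommGroup N] [Module G.T N],
    Function.Injective (TensorProduct.mk G.T Y.T N 1)) (n : ℤ)
    (hinj : Function.Injective (sections.pullback (Mbar.twist n).obj (pointsMap h))) :
    Function.Surjective (G.toSection n) := by
  intro s
  let M : CechModel G.grading Y.toPair.grading 0 := .zero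
  let s' : sections (fibrePower (pointsMap h) 0) (Mbar.twist n).obj :=
    sections.pullback _ (fibrePower.toBase (pointsMap h) 0) s
  obtain ⟨x, hx⟩ := exists_toSection_of_cechD_eq_zero h hpure M (cechD (pointsMap h) _ 0 s')
    (cechD_cechD s')
  refine ⟨x, hinj (sections.ext fun Z p => ?_)⟩
  have h1 := hx (sections.pullback _ (fibrePower.toBase (pointsMap h) 0) (G.toSection n x))
    (sections.ext fun _ _ => rfl)
  have h2 := congrFun (congrFun (congrArg Subtype.val h1) Z)
    ((fibrePower.toOne (pointsMap h)).app Z p)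
  rw [cechD_zero_apply, cechD_zero_apply] at h2
  exact h2

end GradedPair

end StackCohomology

/-! ### Étale covers by a single object -/

namespace StackCohomology

section PiGrading

variable {ι : Type} {T : ι → Type} [∀ i, CommRing (T i)]

/-- The componentwise grading of a product. -/
def piGrading (𝒯 : ∀ i, ℤ → AddSubgroup (T i)) (n : ℤ) : AddSubgroup (∀ i, T i) :=
  AddSubgroup.pi Set.univ fun i => 𝒯 i n

variable {𝒯 : ∀ i, ℤ → AddSubgroup (T i)}

theorem mem_piGrading {n : ℤ} {t : ∀ i, T i} : t ∈ piGrading 𝒯 n ↔ ∀ i, t i ∈ 𝒯 i n := by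
  simp [piGrading, AddSubgroup.mem_pi]

variable [Fintype ι] [DecidableEq ι]

/-- The inclusion of the homogeneous elements of a factor. -/
def piGradingSingle (𝒯 : ∀ i, ℤ → AddSubgroup (T i)) (i : ι) (n : ℤ) :
    𝒯 i n →+ piGrading 𝒯 n :=
  ((AddMonoidHom.single T i).comp (𝒯 i n).subtype).codRestrict _ fun t => mem_piGrading.2 fun j => by
    by_cases h : j = i
    · subst h
      simp
    · simp [h]

variable [∀ i, GradedRing (𝒯 i)]

/-- The decomposition into homogeneous components in a product of graded rings. -/
def piDecompose (𝒯 : ∀ i, ℤ → AddSubgroup (T i)) [∀ i, GradedRing (𝒯 i)] :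
    (∀ i, T i) →+ DirectSum ℤ fun n => piGrading 𝒯 n :=
  ∑ i, ((DirectSum.map (piGradingSingle 𝒯 i)).comp
    (DirectSum.decomposeAddEquiv (𝒯 i)).toAddMonoidHom).comp (Pi.evalAddMonoidHom T i)

instance piGrading.gradedRing : GradedRing (piGrading 𝒯) :=
  let _ : DirectSum.Decomposition (piGrading 𝒯) :=
    DirectSum.Decomposition.ofAddHom (piGrading 𝒯) (piDecompose 𝒯) (by
      have h : ∀ i, (DirectSum.coeAddMonoidHom (piGrading 𝒯)).comp
          (DirectSum.map (piGradingSingle 𝒯 i)) =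
          (AddMonoidHom.single T i).comp (DirectSum.coeAddMonoidHom (𝒯 i)) := by
        intro i
        ext n t : 2
        simp [piGradingSingle]
      refine AddMonoidHom.ext fun t => ?_
      simp only [piDecompose, AddMonoidHom.comp_apply, AddMonoidHom.finsetSum_apply, map_sum]
      refine Eq.trans (Finset.sum_congr rfl fun i _ => ?_) (Finset.univ_sum_single t)
      refine (DFunLike.congr_fun (h i) _).trans ?_
      exact congrArg (Pi.single i) (DirectSum.Decomposition.left_inv (ℳ := 𝒯 i) (t i))) (by
      ext n t : 2
      simp only [piDecompose, AddMonoidHom.comp_apply, AddMonoidHom.finsetSum_apply,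
        DirectSum.coeAddMonoidHom_of, AddMonoidHom.id_apply]
      have h : ∀ i, DirectSum.map (piGradingSingle 𝒯 i)
          ((DirectSum.decomposeAddEquiv (𝒯 i)).toAddMonoidHom (Pi.evalAddMonoidHom T i t.1)) =
          DirectSum.of (fun n => piGrading 𝒯 n) n
            (piGradingSingle 𝒯 i n ⟨t.1 i, mem_piGrading.1 t.2 i⟩) := by
        intro i
        have h1 := DirectSum.decompose_of_mem (𝒯 i) (mem_piGrading.1 t.2 i)
        refine (congrArg (DirectSum.map (piGradingSingle 𝒯 i)) h1).trans ?_
        rw [DirectSum.map_of]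
      rw [Finset.sum_congr rfl fun i _ => h i, ← map_sum]
      congr 1
      refine Subtype.ext ?_
      rw [AddSubgroup.val_finsetSum]
      exact Finset.univ_sum_single t.1)
  { one_mem := mem_piGrading.2 fun _ => SetLike.GradedOne.one_mem
    mul_mem := fun _ _ _ _ ha hb => mem_piGrading.2 fun i =>
      SetLike.GradedMul.mul_mem (mem_piGrading.1 ha i) (mem_piGrading.1 hb i) }

end PiGrading

namespace Mbar

/-- The disjoint union of the total spaces of a finite family of torsors. -/
abbrev piPair {ι : Type} [Fintype ι] [DecidableEq ι] (Y : ι → Mbar) : GradedPair where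
  T := ∀ i, (Y i).T
  grading := piGrading fun i => (Y i).toPair.grading
  graded := piGrading.gradedRing
  A := fun i => (Y i).A
  B := fun i => (Y i).B
  A_mem := mem_piGrading.2 fun i => (Y i).A_mem
  B_mem := mem_piGrading.2 fun i => (Y i).B_mem

variable {X : Mbar} {ι : Type} {Y : ι → Mbar} {f : ∀ i, Y i ⟶ X}

theorem faithfullyFlat_pi [Finite ι] (hf : IsEtaleCover Y f) :
    (RingHom.pi fun i => (f i).total).FaithfullyFlat := by
  classical
  have := Fintype.ofFinite ι
  let _ : ∀ i, Algebra X.T (Y i).T := fun i => (f i).total.toAlgebra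
  let P := ∀ i, (Y i).T
  have : ∀ i, Module.Flat X.T (Y i).T := fun i => flat_total (f i) (hf.etale i)
  have : Module.Flat X.T P :=
    Module.Flat.of_linearEquiv (DirectSum.linearEquivFunOnFintype X.T ι (fun i => (Y i).T)).symm
  refine (RingHom.faithfullyFlat_algebraMap_iff (R := X.T) (S := P)).2
    (Module.FaithfullyFlat.of_comap_surjective fun x => ?_)
  obtain ⟨i, y, hy⟩ := hf.surjective (PrimeSpectrum.comap (algebraMap X.R X.T) x)
  obtain ⟨z, hz⟩ := exists_comap_total (f i) x y hy.symm
  exact ⟨PrimeSpectrum.comap (Pi.evalRingHom _ i) z, hz⟩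

/-- A finite étale cover factors through the disjoint union of its members. -/
theorem exists_disjointUnion [Finite ι] (hf : IsEtaleCover Y f) :
    ∃ (U : Mbar) (π : U ⟶ X) (j : ∀ i, Y i ⟶ U), (∀ i, j i ≫ π = f i) ∧ π.total.FaithfullyFlat ∧
      IsEtaleCover Y j ∧ (∀ i, Function.Surjective (j i).total) ∧
      ∀ i i', i ≠ i' → ∀ (Z : Mbar) (a : Z ⟶ Y i) (b : Z ⟶ Y i'), a ≫ j i = b ≫ j i' →
        (1 : Z.T) = 0 := by
  classical
  have := Fintype.ofFinite ι
  have hp : GradedPair.IsMap X.toPair (piPair Y) (RingHom.pi fun i => (f i).total) :=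
    ⟨fun n t ht => mem_piGrading.2 fun i => (f i).total_mem n t ht,
      funext fun i => (f i).total_A, funext fun i => (f i).total_B⟩
  let U : Mbar := (piPair Y).toMbar hp
  obtain ⟨π, hπ⟩ := exists_hom (Y := X) (Z := U) hp
  have hj : ∀ i, ∃ j : Y i ⟶ U, j.total = Pi.evalRingHom (fun i => (Y i).T) i := fun i =>
    exists_hom (Y := U) (Z := Y i) ⟨fun n t ht => mem_piGrading.1 ht i, rfl, rfl⟩
  choose j hj using hj
  let e : ∀ i, U.R := fun i => ⟨Pi.single i 1, mem_piGrading.2 fun k => by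
    by_cases h : k = i
    · subst h
      rw [Pi.single_eq_same]
      exact SetLike.GradedOne.one_mem
    · rw [Pi.single_eq_of_ne h]
      exact zero_mem _⟩
  have hbase : ∀ i (r : U.R), algebraMap (Y i).R (Y i).T ((j i).base r) =
      (algebraMap U.R U.T r : ∀ i, (Y i).T) i := fun i r => by
    rw [← (j i).total_algebraMap, hj]
    rfl
  have hloc : ∀ i, let _ := (j i).base.toRingHom.toAlgebra
      IsLocalization.Away (e i) (Y i).R := by
    intro i
    let _ := (j i).base.toRingHom.toAlgebra
    have hs : ∀ t : ∀ i, (Y i).T, (Pi.single i 1 : ∀ i, (Y i).T) * t = Pi.single i (t i) :=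
      fun t => funext fun k => by
        by_cases h : k = i
        · subst h
          simp
        · simp [h]
    refine IsLocalization.away_of_isIdempotentElem_of_mul ?_ (fun x y => ?_) fun r => ?_
    · refine U.algebraMap_injective ?_
      rw [map_mul]
      exact (hs _).trans (congrArg _ (Pi.single_eq_same (M := fun i => (Y i).T) i 1))
    · have h1 : ∀ r : U.R, algebraMap U.R U.T (e i * r) =
          (Pi.single i (algebraMap (Y i).R (Y i).T ((j i).base r)) : ∀ i, (Y i).T) := fun r => by
        rw [map_mul, hbase]
        exact hs _
      change (j i).base x = (j i).base y ↔ _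
      rw [← (Y i).algebraMap_injective.eq_iff, ← U.algebraMap_injective.eq_iff, h1, h1]
      exact (Pi.single_injective (M := fun i => (Y i).T) i).eq_iff.symm
    · refine ⟨⟨Pi.single i (algebraMap (Y i).R (Y i).T r), mem_piGrading.2 fun k => ?_⟩, ?_⟩
      · by_cases h : k = i
        · subst h
          rw [Pi.single_eq_same]
          exact SetLike.algebraMap_mem_graded (Y k).grading r
        · rw [Pi.single_eq_of_ne h]
          exact zero_mem _
      · refine (Y i).algebraMap_injective ?_
        exact (hbase i _).trans (Pi.single_eq_same (M := fun i => (Y i).T) i _)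
  refine ⟨U, π, j, fun i => ?_, ?_, ⟨fun i => ?_, fun x => ?_⟩, fun i => ?_, ?_⟩
  · refine hom_ext _ _ ?_
    rw [comp_total, hj, hπ]
    rfl
  · rw [hπ]
    exact faithfullyFlat_pi hf
  · let _ := (j i).base.toRingHom.toAlgebra
    have := hloc i
    exact Algebra.Etale.of_isLocalizationAway (e i)
  · have hsum : ∑ i, e i = 1 := by
      refine U.algebraMap_injective ?_
      rw [map_sum, map_one]
      exact Finset.univ_sum_single (1 : ∀ i, (Y i).T)
    have : ∃ i, e i ∉ x.asIdeal := by
      by_contra! h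
      exact x.2.ne_top ((Ideal.eq_top_iff_one _).2 (hsum ▸ sum_mem fun i _ => h i))
    obtain ⟨i, hi⟩ := this
    let _ := (j i).base.toRingHom.toAlgebra
    have := hloc i
    have h1 := PrimeSpectrum.localization_away_comap_range (Y i).R (e i)
    have h2 : x ∈ Set.range (PrimeSpectrum.comap (algebraMap U.R (Y i).R)) := by
      rw [h1]
      exact hi
    obtain ⟨y, hy⟩ := h2
    exact ⟨i, y, hy⟩
  · rw [hj]
    exact Function.surjective_eval i
  · intro i i' hne Z a b hab
    have h1 := congrArg (fun h => Hom.total h (Pi.single i 1 : ∀ i, (Y i).T)) hab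
    rw [comp_total, comp_total, hj, hj] at h1
    have h2 : a.total ((Pi.single i 1 : ∀ i, (Y i).T) i) =
      b.total ((Pi.single i 1 : ∀ i, (Y i).T) i') := h1
    rwa [Pi.single_eq_same, Pi.single_eq_of_ne hne.symm, map_one, map_zero] at h2

end Mbar

end StackCohomology

/-! ### The covers that compute the cohomology of the line bundles -/

namespace StackCohomology

/-- A map of graded rings is pure if the maps `N → S ⊗[R] N` are injective for all modules `N`
over the source `R`. -/
def IsPureMap {R S : Type} [CommRing R] [CommRing S] (k : R →+* S) : Prop :=
  let _ := k.toAlgebra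
  ∀ (N : Type) [AddCommGroup N] [Module R N], Function.Injective (TensorProduct.mk R S N 1)

theorem _root_.RingHom.FaithfullyFlat.isPureMap {R S : Type} [CommRing R] [CommRing S]
    {k : R →+* S} (hk : k.FaithfullyFlat) : IsPureMap k := by
  let _ := k.toAlgebra
  intro N _ _
  have : Module.FaithfullyFlat R S := hk
  exact Module.FaithfullyFlat.tensorProduct_mk_injective N

/-- The covers of quotient stacks by torsors which are locally surjective and pure. -/
inductive torsorCover : MorphismProperty (Mbarᵒᵖ ⥤ Type 1)
  | of {G : GradedPair} {Y : Mbar} {k : G.T →+* Y.T} (hk : GradedPair.IsMap G Y.toPair k)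
    (hpure : IsPureMap k)
    (hsurj : Presheaf.IsLocallySurjective Mbar.etaleTopology (GradedPair.pointsMap hk)) :
    torsorCover (GradedPair.pointsMap hk)

theorem isCechAcyclic_twist (n : ℤ) : IsCechAcyclic torsorCover (Mbar.twist n).obj := by
  rintro P Q π ⟨hk, hpure, -⟩
  rename_i G Y k
  let _ := k.toAlgebra
  exact GradedPair.cechExact_twist (G := G) (Y := Y) hk hpure n

namespace Mbar

variable {X : Mbar} {ι : Type} {Y : ι → Mbar} {f : ∀ i, Y i ⟶ X}

theorem generate_mem_etaleTopology [Finite ι] (hf : IsEtaleCover Y f) :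
    Sieve.generate (Presieve.ofArrows Y f) ∈ etaleTopology X :=
  ⟨ι, inferInstance, Y, f, hf, fun i => Sieve.le_generate _ _ _ (.mk i)⟩

theorem existsUnique_amalgamation [Finite ι] (hf : IsEtaleCover Y f)
    (G : Sheaf etaleTopology AddCommGrpCat.{1}) (x : ∀ i, G.obj.obj (op (Y i)))
    (hx : ∀ i j (Z : Mbar) (a : Z ⟶ Y i) (b : Z ⟶ Y j), a ≫ f i = b ≫ f j →
      G.obj.map a.op (x i) = G.obj.map b.op (x j)) :
    ∃! t : G.obj.obj (op X), ∀ i, G.obj.map (f i).op t = x i := by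
  have h := (Presheaf.isSheaf_iff_isSheaf_forget _ _ (forget AddCommGrpCat.{1})).1 G.property
  rw [isSheaf_iff_isSheaf_of_type] at h
  have h1 := (Presieve.isSheafFor_iff_generate _).2 (h _ (generate_mem_etaleTopology hf))
  exact (Presieve.isSheafFor_arrows_iff _ _).1 h1 x hx

theorem ext_of_isEtaleCover [Finite ι] (hf : IsEtaleCover Y f)
    (G : Sheaf etaleTopology AddCommGrpCat.{1}) {a b : G.obj.obj (op X)}
    (h : ∀ i, G.obj.map (f i).op a = G.obj.map (f i).op b) : a = b := by
  obtain ⟨t, -, ht⟩ := existsUnique_amalgamation hf G (fun i => G.obj.map (f i).op b)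
    fun i j Z p q hpq => by
      rw [← ConcreteCategory.comp_apply, ← Functor.map_comp, ← op_comp, hpq, op_comp,
        Functor.map_comp, ConcreteCategory.comp_apply]
  exact (ht a h).trans (ht b fun _ => rfl).symm

/-- A torsor with vanishing functions is covered by the empty family. -/
theorem subsingleton_obj (G : Sheaf etaleTopology AddCommGrpCat.{1}) (h : (1 : X.T) = 0) :
    Subsingleton (G.obj.obj (op X)) := by
  have hR : Subsingleton X.R := by
    refine subsingleton_of_zero_eq_one (X.algebraMap_injective ?_)
    rw [map_zero, map_one, h]
  have hf : IsEtaleCover (X := X) (fun e : Empty => e.elim) (fun e => e.elim) :=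
    ⟨fun e => e.elim, fun x => (x.2.ne_top (Ideal.eq_top_of_unit_mem _ 0 0
      (zero_mem _) (Subsingleton.elim _ _))).elim⟩
  obtain ⟨t, -, ht⟩ := existsUnique_amalgamation hf G (fun e => e.elim) (fun e => e.elim)
  exact ⟨fun a b => (ht a fun e => e.elim).trans (ht b fun e => e.elim).symm⟩

/-- A morphism through which an étale cover factors is locally surjective. -/
theorem isLocallySurjective_pointsMap [Finite ι] (hf : IsEtaleCover Y f) {U : Mbar} (π : U ⟶ X)
    (j : ∀ i, Y i ⟶ U) (hj : ∀ i, j i ≫ π = f i) :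
    Presheaf.IsLocallySurjective etaleTopology (GradedPair.pointsMap (isMap_total π)) where
  imageSieve_mem {Z} s := by
    obtain ⟨g, hg, -⟩ := GradedPair.isUniversal_idPoint X s
    choose W p q hpq het hsu _ using fun i => exists_pullback g (f i)
    refine ⟨ι, inferInstance, W, p, ⟨fun i => het i (hf.etale i), fun y => ?_⟩, fun i => ?_⟩
    · obtain ⟨i, u, hu⟩ := hf.surjective (PrimeSpectrum.comap g.base.toRingHom y)
      exact ⟨i, hsu i y u hu.symm⟩
    · refine ⟨⟨⟨(q i ≫ j i).total, isMap_total _⟩⟩, ?_⟩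
      rw [← hg]
      refine GradedPair.points_ext fun t => ?_
      have h : (q i ≫ j i) ≫ π = p i ≫ g := by rw [Category.assoc, hj, hpq]
      exact RingHom.congr_fun (congrArg Hom.total h) t

theorem exists_lift_of_epi {G G' : Sheaf etaleTopology AddCommGrpCat.{1}} (g : G ⟶ G') [Epi g]
    (x : G'.obj.obj (op X)) : ∃ (P Q : Mbarᵒᵖ ⥤ Type 1) (π : P ⟶ Q) (_ : torsorCover π)
      (q : Q.obj (op X)) (t : sections Q G'.obj) (s : sections P G.obj), t.1 _ q = x ∧
        sections.push P g.hom s = sections.pullback G'.obj π t := by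
  have := (Sheaf.isLocallySurjective_iff_epi' (φ := g)).2 inferInstance
  obtain ⟨ι, _, Y, f, hf, hS⟩ := Presheaf.imageSieve_mem etaleTopology g.hom x
  choose s hs using hS
  obtain ⟨U, π, j, hj, hflat, hcov, hsurj, hdisj⟩ := exists_disjointUnion hf
  obtain ⟨t, ht, -⟩ := existsUnique_amalgamation hcov G s fun i i' Z a b hab => by
    by_cases h : i = i'
    · subst h
      have : a = b := hom_ext _ _ (RingHom.ext fun z => by
        obtain ⟨z, rfl⟩ := hsurj i z
        exact RingHom.congr_fun (congrArg Hom.total hab) z)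
      rw [this]
    · have := subsingleton_obj G (hdisj i i' h Z a b hab)
      exact Subsingleton.elim _ _
  obtain ⟨t', ht'⟩ := (GradedPair.isUniversal_idPoint U).exists_section (G := G.obj) t
  obtain ⟨x', hx'⟩ := (GradedPair.isUniversal_idPoint X).exists_section (G := G'.obj) x
  refine ⟨_, _, _, .of (isMap_total π) hflat.isPureMap (isLocallySurjective_pointsMap hf π j hj),
    GradedPair.idPoint X, x', t', hx', (GradedPair.isUniversal_idPoint U).ext ?_⟩
  rw [sections.push_apply, ht', sections.pullback_apply]
  have hidpt : (GradedPair.pointsMap (isMap_total π)).app (op U) (GradedPair.idPoint U) =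
    X.toPair.points.map π.op (GradedPair.idPoint X) := rfl
  rw [hidpt, ← sections.map_apply, hx']
  -- Both sides agree on the members of the cover
  refine ext_of_isEtaleCover hcov G' fun i => ?_
  rw [← NatTrans.naturality_apply, ht, hs, ← ConcreteCategory.comp_apply, ← Functor.map_comp,
    ← op_comp, hj]

end Mbar

theorem isCechClass_torsorCover : IsCechClass Mbar.etaleTopology torsorCover where
  locallySurjective := by
    rintro P Q π ⟨hk, hpure, hsurj⟩
    exact hsurj
  exists_universal := by
    rintro P Q π ⟨hk, -, -⟩ m
    rename_i G Y k
    let _ := k.toAlgebra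
    exact GradedPair.exists_isUniversal_fibrePower (G := G) (Y := Y) hk m
  exists_lift _ _ g _ _ x := Mbar.exists_lift_of_epi g x

end StackCohomology

/-! ### Zariski covers and cube roots -/

namespace StackCohomology

namespace Mbar

/-- Étale algebras over the base define étale covers. -/
theorem exists_isEtaleCover (X : Mbar) {ι : Type} (S : ι → Type) [∀ i, CommRing (S i)]
    [∀ i, Algebra X.R (S i)] [∀ i, Algebra.Etale X.R (S i)]
    (hS : ∀ x : PrimeSpectrum X.R, ∃ i, ∃ y : PrimeSpectrum (S i),
      PrimeSpectrum.comap (algebraMap X.R (S i)) y = x) :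
    ∃ (Y : ι → Mbar) (f : ∀ i, Y i ⟶ X) (e : ∀ i, S i →+* (Y i).R), IsEtaleCover Y f ∧
      ∀ i r, e i (algebraMap X.R (S i) r) = (f i).base r := by
  let _ : ∀ i, Algebra Z2 (S i) := fun i =>
    ((algebraMap X.R (S i)).comp (algebraMap Z2 X.R)).toAlgebra
  have : ∀ i, IsScalarTower Z2 X.R (S i) := fun i => .of_algebraMap_eq fun _ => rfl
  let f : ∀ i, X.baseChange (S i) ⟶ X := fun i =>
    { base := IsScalarTower.toAlgHom Z2 X.R (S i)
      total := (Algebra.TensorProduct.includeRight : X.T →ₐ[X.R] S i ⊗[X.R] X.T).toRingHom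
      total_algebraMap := fun r => by
        refine (AlgHom.commutes (Algebra.TensorProduct.includeRight :
          X.T →ₐ[X.R] S i ⊗[X.R] X.T) r).trans ?_
        rfl
      total_mem := fun n t ht => Submodule.tmul_mem_baseChange_of_mem _ ht
      total_A := rfl
      total_B := rfl }
  refine ⟨fun i => X.baseChange (S i), f, fun i => RingHom.id _, ⟨fun i => ?_, hS⟩, fun i r => rfl⟩
  have : (algebraMap X.R (S i)).Etale := RingHom.etale_algebraMap.2 inferInstance
  exact this

/-- The cover by the loci where the members of a family that generates the unit ideal are
invertible. -/
theorem exists_isEtaleCover_isUnit (X : Mbar) {ι : Type} (r : ι → X.R)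
    (hr : Ideal.span (Set.range r) = ⊤) :
    ∃ (Y : ι → Mbar) (f : ∀ i, Y i ⟶ X), IsEtaleCover Y f ∧ ∀ i, IsUnit ((f i).base (r i)) := by
  have : ∀ i, Algebra.Etale X.R (Localization.Away (r i)) := fun i =>
    Algebra.Etale.of_isLocalizationAway (r i)
  obtain ⟨Y, f, e, hf, he⟩ := exists_isEtaleCover X (fun i => Localization.Away (r i)) (by
    intro x
    have : ∃ i, r i ∉ x.asIdeal := by
      by_contra! h
      refine x.2.ne_top (top_le_iff.1 (hr ▸ Ideal.span_le.2 ?_))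
      rintro _ ⟨i, rfl⟩
      exact h i
    obtain ⟨i, hi⟩ := this
    have h1 := PrimeSpectrum.localization_away_comap_range (Localization.Away (r i)) (r i)
    have h2 : x ∈ Set.range (PrimeSpectrum.comap
        (algebraMap X.R (Localization.Away (r i)))) := by
      rw [h1]
      exact hi
    exact ⟨i, h2⟩)
  refine ⟨Y, f, hf, fun i => ?_⟩
  rw [← he]
  exact (IsLocalization.Away.algebraMap_isUnit (r i)).map (e i)

theorem isUnit_three : IsUnit (3 : Z2) := by
  have := span_two_isPrime
  have h := IsLocalization.map_units Z2
    (⟨3, by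
      rw [Ideal.mem_primeCompl_iff, Ideal.mem_span_singleton]
      decide⟩ : (Ideal.span {(2 : ℤ)}).primeCompl)
  simpa using h

open Polynomial in
/-- The polynomial `X ^ 3 - b` is separable if `3` and `b` are invertible. -/
theorem derivative_X_pow_three_sub_C {R : Type} [CommRing R] (b : Rˣ) {c : R} (hc : 3 * c = 1) :
    derivative (X ^ 3 - C (b : R)) * (X * C (c * (b⁻¹ : Rˣ))) +
      (X ^ 3 - C (b : R)) * (- C ((b⁻¹ : Rˣ) : R)) = 1 ^ 0 := by
  have h1 : (C (b : R) * C ((b⁻¹ : Rˣ) : R) : R[X]) = 1 := by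
    rw [← C_mul, b.mul_inv, C_1]
  have h2 : (3 * C c : R[X]) = 1 := by
    rw [← C_1, ← hc, C_mul]
    rfl
  rw [derivative_sub, derivative_X_pow, derivative_C, C_mul]
  have h3 : (C ((3 : ℕ) : R) : R[X]) = 3 := map_ofNat C 3
  rw [h3]
  linear_combination (X ^ 3 * C ((b⁻¹ : Rˣ) : R)) * h2 + h1

open Polynomial in
/-- The extension of a ring by a cube root of a unit, where `c` is the inverse of `3`. -/
noncomputable def cubeRootPair {R : Type} [CommRing R] (b : Rˣ) {c : R} (hc : 3 * c = 1) :
    StandardEtalePair R where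
  f := X ^ 3 - C (b : R)
  monic_f := monic_X_pow_sub_C _ three_ne_zero
  g := 1
  cond := ⟨_, _, 0, derivative_X_pow_three_sub_C b hc⟩

theorem hasMap_cubeRootPair_iff {R S : Type} [CommRing R] [CommRing S] [Algebra R S] (b : Rˣ)
    {c : R} (hc : 3 * c = 1) {z : S} :
    (cubeRootPair b hc).HasMap z ↔ z ^ 3 = algebraMap R S b := by
  simp [StandardEtalePair.HasMap, cubeRootPair, sub_eq_zero]

theorem exists_comap_cubeRootPair {R : Type} [CommRing R] (b : Rˣ) {c : R} (hc : 3 * c = 1)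
    (x : PrimeSpectrum R) : ∃ y : PrimeSpectrum (cubeRootPair b hc).Ring,
      PrimeSpectrum.comap (algebraMap R (cubeRootPair b hc).Ring) y = x := by
  let K := AlgebraicClosure x.asIdeal.ResidueField
  let g : R →+* K := (algebraMap x.asIdeal.ResidueField K).comp
    (algebraMap R x.asIdeal.ResidueField)
  let _ := g.toAlgebra
  obtain ⟨z, hz⟩ := IsAlgClosed.exists_pow_nat_eq (g b) (n := 3) (by norm_num)
  let l := (cubeRootPair b hc).lift z ((hasMap_cubeRootPair_iff b hc).2 hz)
  refine ⟨⟨RingHom.ker l.toRingHom, RingHom.ker_isPrime _⟩, ?_⟩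
  ext r
  change l (algebraMap R _ r) = 0 ↔ _
  rw [l.commutes]
  change algebraMap x.asIdeal.ResidueField K (algebraMap R _ r) = 0 ↔ _
  rw [map_eq_zero, Ideal.algebraMap_residueField_eq_zero]

/-- Étale locally, units have cube roots. -/
theorem exists_cubeRoot (X : Mbar) (b : X.Rˣ) : ∃ (Y : Mbar) (f : Y ⟶ X) (x : Y.R),
    IsEtaleCover (fun _ : Unit => Y) (fun _ => f) ∧ x ^ 3 = f.base b := by
  obtain ⟨c, hc⟩ : ∃ c : X.R, 3 * c = 1 := by
    obtain ⟨c, hc⟩ := (isUnit_three.map (algebraMap Z2 X.R)).exists_right_inv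
    exact ⟨c, by rwa [map_ofNat] at hc⟩
  obtain ⟨Y, f, e, hf, he⟩ := exists_isEtaleCover X (fun _ : Unit => (cubeRootPair b hc).Ring)
    fun x => ⟨(), exists_comap_cubeRootPair b hc x⟩
  refine ⟨Y (), f (), e () (cubeRootPair b hc).X, hf, ?_⟩
  rw [← he, ← map_pow, (hasMap_cubeRootPair_iff b hc).1 (cubeRootPair b hc).hasMap_X]

/-- A homogeneous unit has a homogeneous inverse. -/
theorem exists_mem_mul_eq_one (X : Mbar) {n : ℤ} {t : X.T} (ht : t ∈ X.grading n)
    (h : IsUnit t) : ∃ v ∈ X.grading (-n), t * v = 1 := by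
  obtain ⟨v, hv⟩ := h.exists_right_inv
  refine ⟨DirectSum.decompose X.grading v (-n), SetLike.coe_mem _, ?_⟩
  have h1 := DirectSum.coe_decompose_mul_add_of_left_mem X.grading ht (b := v) (j := -n)
  rw [hv, add_neg_cancel, DirectSum.decompose_of_mem_same _ SetLike.GradedOne.one_mem] at h1
  exact h1.symm

/-- Locally, the torsor is trivial. -/
theorem exists_isEtaleCover_mul_eq_one (X : Mbar) : ∃ (ι : Type) (_ : Finite ι) (Y : ι → Mbar)
    (f : ∀ i, Y i ⟶ X), IsEtaleCover Y f ∧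
      ∀ i, ∃ u ∈ (Y i).grading 1, IsUnit u := by
  let s : Set X.R := {r | ∃ u ∈ X.grading 1, ∃ v, algebraMap X.R X.T r = u * v}
  have h : ∀ w ∈ X.grading 1 * X.grading (-1), ∃ r ∈ Ideal.span s, algebraMap X.R X.T r = w := by
    intro w hw
    induction hw using Submodule.mul_induction_on' with
    | mem_mul_mem u hu v hv =>
      have h0 : u * v ∈ X.grading 0 := by simpa using SetLike.mul_mem_graded hu hv
      obtain ⟨r, hr⟩ := X.exists_of_mem_zero _ h0
      exact ⟨r, Ideal.subset_span ⟨u, hu, v, hr⟩, hr⟩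
    | add x _ y _ hx hy =>
      obtain ⟨a, ha, rfl⟩ := hx
      obtain ⟨b, hb, rfl⟩ := hy
      exact ⟨a + b, add_mem ha hb, map_add _ _ _⟩
  obtain ⟨r, hr, h1⟩ := h 1 (X.one_mem_mul 1)
  have hr1 : r = 1 := X.algebraMap_injective (by rw [h1, map_one])
  obtain ⟨s', hs', htop⟩ := (Ideal.span_eq_top_iff_finite s).1
    ((Ideal.eq_top_iff_one _).2 (hr1 ▸ hr))
  obtain ⟨Y, f, hf, hu⟩ := exists_isEtaleCover_isUnit X (fun i : s' => (i : X.R)) (by simpa using htop)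
  refine ⟨s', inferInstance, Y, f, hf, fun i => ?_⟩
  obtain ⟨u, hu1, v, huv⟩ := hs' i.2
  refine ⟨(f i).total u, (f i).total_mem 1 u hu1, isUnit_of_mul_isUnit_left (y := (f i).total v) ?_⟩
  rw [← map_mul, ← huv, (f i).total_algebraMap]
  exact (hu i).map _

/-- Locally, one of `A` and `B` is invertible. -/
theorem exists_isEtaleCover_isUnit_A_or_B (X : Mbar) : ∃ (Y : Bool → Mbar) (f : ∀ i, Y i ⟶ X),
    IsEtaleCover Y f ∧ IsUnit (Y true).A ∧ IsUnit (Y false).B := by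
  obtain ⟨a, b, hab⟩ := Ideal.mem_span_pair.1
    (X.span_eq_top ▸ Submodule.mem_top : (1 : X.T) ∈ Ideal.span {X.A, X.B})
  have ha := DirectSum.coe_decompose_mul_add_of_right_mem X.grading X.A_mem (a := a) (i := -1)
  have hb := DirectSum.coe_decompose_mul_add_of_right_mem X.grading X.B_mem (a := b) (i := -3)
  rw [neg_add_cancel] at ha hb
  obtain ⟨r, hr⟩ := X.exists_of_mem_zero _
    (SetLike.coe_mem (DirectSum.decompose X.grading (a * X.A) 0))
  obtain ⟨s, hs⟩ := X.exists_of_mem_zero _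
    (SetLike.coe_mem (DirectSum.decompose X.grading (b * X.B) 0))
  have hrs : r + s = 1 := by
    apply X.algebraMap_injective
    rw [map_add, hr, hs, ← Submodule.coe_add, ← DirectSum.add_apply, ← DirectSum.decompose_add,
      hab, map_one (algebraMap X.R X.T), DirectSum.decompose_of_mem_same _ SetLike.GradedOne.one_mem]
  obtain ⟨Y, f, hf, hu⟩ := exists_isEtaleCover_isUnit X (fun i : Bool => if i then r else s) (by
    refine (Ideal.eq_top_iff_one _).2 (hrs ▸ add_mem ?_ ?_)
    · exact Ideal.subset_span ⟨true, rfl⟩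
    · exact Ideal.subset_span ⟨false, rfl⟩)
  refine ⟨Y, f, hf, ?_, ?_⟩
  · have h1 := (hu true).map (algebraMap _ (Y true).T)
    rw [if_pos rfl, ← (f true).total_algebraMap, hr, ha, map_mul, (f true).total_A] at h1
    exact isUnit_of_mul_isUnit_right h1
  · have h1 := (hu false).map (algebraMap _ (Y false).T)
    rw [if_neg Bool.false_ne_true, ← (f false).total_algebraMap, hs, hb, map_mul,
      (f false).total_B] at h1
    exact isUnit_of_mul_isUnit_right h1

end Mbar

end StackCohomology

/-! ### Charts given by monoid algebras -/

namespace StackCohomology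

section Power

variable {T : Type} [CommRing T]

/-- The integral powers of an element: those with negative exponent are formed with the inverse of
the element, and have their expected meaning only if the element is a unit. -/
noncomputable def intPow (a : T) (i : ℤ) : T := a ^ i.toNat * Ring.inverse a ^ (-i).toNat

theorem intPow_unit (u : Tˣ) (i : ℤ) : intPow (u : T) i = ((u ^ i : Tˣ) : T) := by
  rw [intPow, Ring.inverse_unit]
  obtain ⟨n, rfl | rfl⟩ := i.eq_nat_or_neg <;> simp

theorem intPow_natCast (a : T) (n : ℕ) : intPow a n = a ^ n := by
  simp [intPow]

theorem intPow_add {a : T} {i j : ℤ} (hi : IsUnit a ∨ 0 ≤ i) (hj : IsUnit a ∨ 0 ≤ j) :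
    intPow a (i + j) = intPow a i * intPow a j := by
  by_cases h : IsUnit a
  · obtain ⟨u, rfl⟩ := h
    rw [intPow_unit, intPow_unit, intPow_unit, zpow_add, Units.val_mul]
  · lift i to ℕ using hi.resolve_left h
    lift j to ℕ using hj.resolve_left h
    rw [← Nat.cast_add, intPow_natCast, intPow_natCast, intPow_natCast, pow_add]

theorem Mbar.intPow_mem {Z : Mbar} {a : Z.T} {d i : ℤ} (ha : a ∈ Z.grading d)
    (hi : IsUnit a ∨ 0 ≤ i) : intPow a i ∈ Z.grading (d * i) := by
  have hnat : ∀ (b : Z.T) (k : ℤ), b ∈ Z.grading k → ∀ n : ℕ, b ^ n ∈ Z.grading (k * n) := by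
    intro b k hb n
    have := SetLike.pow_mem_graded n hb
    rwa [nsmul_eq_mul, mul_comm] at this
  obtain ⟨n, rfl | rfl⟩ := i.eq_nat_or_neg
  · rw [intPow_natCast]
    exact hnat a d ha n
  · by_cases h : IsUnit a
    · obtain ⟨v, hv, h1⟩ := Z.exists_mem_mul_eq_one ha h
      have hinv : Ring.inverse a = v := by
        rw [← one_mul (Ring.inverse a), ← h1, mul_right_comm, Ring.mul_inverse_cancel a h, one_mul]
      have := hnat v (-d) hv n
      rw [neg_mul, ← mul_neg] at this
      simpa [intPow, hinv] using this
    · have h0 : n = 0 := by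
        have := hi.resolve_left h
        omega
      subst h0
      simpa [intPow] using (SetLike.GradedOne.one_mem : (1 : Z.T) ∈ Z.grading 0)

end Power

/-- The exponents `(i, j)` of the monomials `aⁱ bʲ` on the chart where `a` is inverted if `α` holds,
and `b` is inverted if `β` holds. -/
def exponents (α β : Prop) : AddSubmonoid (ℤ × ℤ) where
  carrier := {m | (α ∨ 0 ≤ m.1) ∧ (β ∨ 0 ≤ m.2)}
  add_mem' ha hb := ⟨by
    rcases ha.1 with h | h
    · exact .inl h
    · exact hb.1.imp_right (add_nonneg h), by
    rcases ha.2 with h | h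
    · exact .inl h
    · exact hb.2.imp_right (add_nonneg h)⟩
  zero_mem' := ⟨.inr le_rfl, .inr le_rfl⟩

variable {α β : Prop} {d e : ℕ}

/-- The degree of the monomials, where `a` has degree `1` and `b` has degree `d`. -/
def exponents.degree (α β : Prop) (d : ℕ) : exponents α β →+ ℤ where
  toFun m := m.1.1 + d * m.1.2
  map_zero' := by simp
  map_add' x y := by simp; ring

/-- The ring of functions on the chart. -/
abbrev ChartRing (α β : Prop) : Type := AddMonoidAlgebra Z2 (exponents α β)

/-- The homogeneous functions on the chart. -/
noncomputable abbrev chartGrading (α β : Prop) (d : ℕ) (n : ℤ) : AddSubgroup (ChartRing α β) :=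
  (AddMonoidAlgebra.gradeBy Z2 (exponents.degree α β d) n).toAddSubgroup

noncomputable instance : GradedRing (chartGrading α β d) :=
  gradedRingToAddSubgroup (AddMonoidAlgebra.gradeBy Z2 (exponents.degree α β d))

/-- The monomials. -/
noncomputable def monomial (m : exponents α β) : ChartRing α β := AddMonoidAlgebra.single m 1

theorem monomial_mem (m : exponents α β) :
    (monomial m : ChartRing α β) ∈ chartGrading α β d (exponents.degree α β d m) :=
  AddMonoidAlgebra.single_mem_gradeBy _ _ _

theorem monomial_add (m m' : exponents α β) :
    (monomial (m + m') : ChartRing α β) = monomial m * monomial m' := by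
  simp [monomial, AddMonoidAlgebra.single_mul_single]

theorem monomial_zero : (monomial 0 : ChartRing α β) = 1 := rfl

theorem monomial_nsmul (m : exponents α β) (n : ℕ) :
    (monomial (n • m) : ChartRing α β) = monomial m ^ n := by
  simp [monomial, AddMonoidAlgebra.single_pow]

/-- The exponent of `aⁱ bʲ`, for `i, j ≥ 0`. -/
abbrev exponents.ofNat (i j : ℕ) : exponents α β :=
  ⟨(i, j), .inr (Nat.cast_nonneg i), .inr (Nat.cast_nonneg j)⟩

/-- The chart with coordinates `a = A` and `b`, where `B = bᵉ`. -/
noncomputable abbrev chart (α β : Prop) {d e : ℕ} (h : d * e = 3) : GradedPair where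
  T := ChartRing α β
  grading := chartGrading α β d
  A := monomial (exponents.ofNat 1 0)
  B := monomial (exponents.ofNat 0 e)
  A_mem := by
    convert! monomial_mem (d := d) (exponents.ofNat 1 0 : exponents α β) using 2
  B_mem := by
    convert! monomial_mem (d := d) (exponents.ofNat 0 e : exponents α β) using 2
    simp only [exponents.degree, AddMonoidHom.coe_mk, ZeroHom.coe_mk, Nat.cast_zero, zero_add]
    exact_mod_cast h.symm

theorem chart_ringHom_ext {T : Type} [CommRing T] {f g : ChartRing α β →+* T}
    (h : ∀ m, f (monomial m) = g (monomial m)) : f = g := by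
  have := span_two_isPrime
  refine AddMonoidAlgebra.ringHom_ext' ?_ ?_
  · exact IsLocalization.ringHom_ext (Ideal.span {(2 : ℤ)}).primeCompl (RingHom.ext_int _ _)
  · exact MonoidHom.ext fun m => h m.toAdd

theorem chart_isUnit_A (h : d * e = 3) (hα : α) : IsUnit (chart α β h).A := by
  refine IsUnit.of_mul_eq_one (monomial ⟨(-1, 0), .inl hα, .inr le_rfl⟩) ?_
  rw [← monomial_add, ← monomial_zero]
  exact congrArg monomial (Subtype.ext (by ext <;> simp))

theorem chart_isUnit_B (h : d * e = 3) (hβ : β) : IsUnit (chart α β h).B := by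
  refine IsUnit.of_mul_eq_one (monomial ⟨(0, -e), .inr le_rfl, .inl hβ⟩) ?_
  rw [← monomial_add, ← monomial_zero]
  exact congrArg monomial (Subtype.ext (by ext <;> simp))

theorem single_eq_algebraMap_mul_monomial (m : exponents α β) (r : Z2) :
    (AddMonoidAlgebra.single m r : ChartRing α β) = algebraMap Z2 _ r * monomial m := by
  rw [monomial, AddMonoidAlgebra.coe_algebraMap]
  simp [AddMonoidAlgebra.single_mul_single]

theorem sum_monomial (t : ChartRing α β) :
    t = ∑ m ∈ t.coeff.support, algebraMap Z2 _ (t.coeff m) * monomial m := by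
  conv_lhs => rw [← AddMonoidAlgebra.sum_coeff_single t]
  exact Finset.sum_congr rfl fun m _ => single_eq_algebraMap_mul_monomial m _

/-- Ring maps that preserve the degrees of monomials are graded. -/
theorem map_mem_of_monomial {Z : Mbar} (f : ChartRing α β →+* Z.T)
    (hf : ∀ m, f (monomial m) ∈ Z.grading (exponents.degree α β d m)) {n : ℤ} {t : ChartRing α β}
    (ht : t ∈ chartGrading α β d n) : f t ∈ Z.grading n := by
  have := span_two_isPrime
  have hc : f.comp (algebraMap Z2 _) = (algebraMap Z.R Z.T).comp (algebraMap Z2 Z.R) :=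
    IsLocalization.ringHom_ext (Ideal.span {(2 : ℤ)}).primeCompl (RingHom.ext_int _ _)
  rw [sum_monomial t, map_sum]
  refine sum_mem fun m hm => ?_
  have h1 : f (algebraMap Z2 _ (t.coeff m)) ∈ Z.grading 0 := by
    rw [← RingHom.comp_apply, hc]
    exact SetLike.algebraMap_mem_graded Z.grading _
  have h2 := SetLike.mul_mem_graded h1 (hf m)
  rw [zero_add, ht m hm] at h2
  rwa [map_mul]

theorem monomial_ofNat (h : d * e = 3) (i j : ℕ) :
    (monomial (exponents.ofNat i (e * j)) : ChartRing α β) =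
      (chart α β h).A ^ i * (chart α β h).B ^ j := by
  rw [← monomial_nsmul, ← monomial_nsmul, ← monomial_add]
  exact congrArg monomial (Subtype.ext (by ext <;> simp [mul_comm]))

/-- The points of a chart. -/
theorem exists_isMap_chart (h : d * e = 3) {Z : Mbar} {b : Z.T} (hb : b ∈ Z.grading d)
    (hbe : b ^ e = Z.B) (hα : α → IsUnit Z.A) (hβ : β → IsUnit b) :
    ∃ f : ChartRing α β →+* Z.T, GradedPair.IsMap (chart α β h) Z.toPair f := by
  have hA : ∀ m : exponents α β, IsUnit Z.A ∨ 0 ≤ m.1.1 := fun m => m.2.1.imp_left hα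
  have hB : ∀ m : exponents α β, IsUnit b ∨ 0 ≤ m.1.2 := fun m => m.2.2.imp_left hβ
  let φ : Multiplicative (exponents α β) →* Z.T :=
    { toFun := fun m => intPow Z.A m.toAdd.1.1 * intPow b m.toAdd.1.2
      map_one' := by simp [intPow]
      map_mul' := fun x y => by
        have h1 := intPow_add (hA x.toAdd) (hA y.toAdd)
        have h2 := intPow_add (hB x.toAdd) (hB y.toAdd)
        simp only [toAdd_mul, AddSubmonoid.coe_add, Prod.fst_add, Prod.snd_add, h1, h2]
        ring }
  let c : Z2 →+* Z.T := (algebraMap Z.R Z.T).comp (algebraMap Z2 Z.R)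
  let f : ChartRing α β →+* Z.T :=
    AddMonoidAlgebra.liftNCRingHom c φ fun _ _ => mul_comm _ _
  have hf : ∀ m r, f (AddMonoidAlgebra.single m r) = c r * φ (Multiplicative.ofAdd m) :=
    fun m r => AddMonoidAlgebra.liftNCRingHom_single _ _ _ _ _
  have hf1 : ∀ m, f (monomial m) = intPow Z.A m.1.1 * intPow b m.1.2 := fun m => by
    rw [monomial, hf, map_one, one_mul]
    rfl
  refine ⟨f, fun n t ht => ?_, ?_, ?_⟩
  · refine map_mem_of_monomial f (fun m => ?_) ht
    rw [hf1]
    have h1 := Z.intPow_mem Z.A_mem (hA m)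
    have h2 := Z.intPow_mem hb (hB m)
    rw [one_mul] at h1
    exact SetLike.mul_mem_graded h1 h2
  · refine (hf1 _).trans ?_
    simp [intPow]
  · refine (hf1 _).trans ?_
    simp [intPow, hbe]

/-- A chart has at most one point over each torsor. -/
theorem subsingleton_points_chart (h : 3 * 1 = 3) (Z : Mbarᵒᵖ) :
    Subsingleton ((chart α β h).points.obj Z) := by
  refine ⟨fun x y => GradedPair.points_ext fun t => ?_⟩
  have hx := x.down.2
  have hy := y.down.2
  refine RingHom.congr_fun (chart_ringHom_ext fun m => ?_) t
  have hA : IsUnit (Z.unop.A ^ (-m.1.1).toNat) := by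
    rcases m.2.1 with hα | hα
    · exact (hx.map_A ▸ (chart_isUnit_A h hα).map x.down.1).pow _
    · rw [Int.toNat_eq_zero.2 (by omega), pow_zero]
      exact isUnit_one
  have hB : IsUnit (Z.unop.B ^ (-m.1.2).toNat) := by
    rcases m.2.2 with hα | hα
    · exact (hx.map_B ▸ (chart_isUnit_B h hα).map x.down.1).pow _
    · rw [Int.toNat_eq_zero.2 (by omega), pow_zero]
      exact isUnit_one
  -- Every monomial is determined by `A` and `B` after clearing its negative exponents.
  have h1 : (monomial m * ((chart α β h).A ^ (-m.1.1).toNat * (chart α β h).B ^ (-m.1.2).toNat) :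
      ChartRing α β) = (chart α β h).A ^ m.1.1.toNat * (chart α β h).B ^ m.1.2.toNat := by
    rw [← monomial_ofNat, ← monomial_ofNat, ← monomial_add]
    refine congrArg monomial (Subtype.ext (Prod.ext ?_ ?_))
    · change m.1.1 + ((-m.1.1).toNat : ℤ) = (m.1.1.toNat : ℤ)
      omega
    · change m.1.2 + ((1 * (-m.1.2).toNat : ℕ) : ℤ) = ((1 * m.1.2.toNat : ℕ) : ℤ)
      omega
  have key : ∀ f : ChartRing α β →+* Z.unop.T, GradedPair.IsMap (chart α β h) Z.unop.toPair f →
      f (monomial m) * (Z.unop.A ^ (-m.1.1).toNat * Z.unop.B ^ (-m.1.2).toNat) =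
        Z.unop.A ^ m.1.1.toNat * Z.unop.B ^ m.1.2.toNat := by
    intro f hf
    have h2 := congrArg f h1
    have hfA : f (chart α β h).A = Z.unop.A := hf.map_A
    have hfB : f (chart α β h).B = Z.unop.B := hf.map_B
    rwa [map_mul, map_mul, map_mul, map_pow, map_pow, map_pow, map_pow, hfA, hfB] at h2
  exact (hA.mul hB).mul_right_cancel ((key _ hx).trans (key _ hy).symm)

end StackCohomology

/-! ### The cover of the stack by the charts -/

namespace StackCohomology

variable {α β : Prop} {d e : ℕ}

/-- The chart as a torsor, if all degrees contain invertible monomials. -/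
noncomputable def chartTorsor (h : d * e = 3) (hαβ : α ∨ β)
    (hu : ∀ n, ∃ m m' : exponents α β, exponents.degree α β d m = n ∧
      exponents.degree α β d m' = -n ∧ m + m' = 0) : Mbar :=
  (chart α β h).torsor (algebraMap Z2 (ChartRing α β))
    (fun r => SetLike.algebraMap_mem_graded
      (AddMonoidAlgebra.gradeBy Z2 (exponents.degree α β d)) r)
    (fun n => by
      obtain ⟨m, m', rfl, h', h0⟩ := hu n
      have h1 := Submodule.mul_mem_mul (M := (chart α β h).submodule (exponents.degree α β d m))
        (N := (chart α β h).submodule (-exponents.degree α β d m)) (monomial_mem m)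
        (h' ▸ monomial_mem m')
      rw [← monomial_add, h0] at h1
      exact h1)
    (by
      rcases hαβ with hα | hβ
      · exact Ideal.eq_top_of_isUnit_mem _ (Ideal.subset_span (.inl rfl)) (chart_isUnit_A h hα)
      · exact Ideal.eq_top_of_isUnit_mem _ (Ideal.subset_span (.inr rfl)) (chart_isUnit_B h hβ))

/-- The charts on which `A` is inverted. -/
noncomputable def torsorA (β : Prop) : Mbar :=
  chartTorsor (α := True) (β := β) (show 3 * 1 = 3 from rfl) (.inl trivial) fun n =>
    ⟨⟨(n, 0), .inl trivial, .inr le_rfl⟩, ⟨(-n, 0), .inl trivial, .inr le_rfl⟩,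
      by simp [exponents.degree], by simp [exponents.degree], Subtype.ext (by simp)⟩

/-- The chart with coordinates `A` and `b`, where `b` is invertible and `B = b³`. -/
noncomputable def cubeRootTorsor : Mbar :=
  chartTorsor (α := False) (β := True) (show 1 * 3 = 3 from rfl) (.inr trivial) fun n =>
    ⟨⟨(0, n), .inr le_rfl, .inl trivial⟩, ⟨(0, -n), .inr le_rfl, .inl trivial⟩,
      by simp [exponents.degree], by simp [exponents.degree], Subtype.ext (by simp)⟩

/-- The locus in the stack where `A` is invertible if `α` holds, and `B` is invertible if `β`
holds. -/
noncomputable abbrev locus (α β : Prop) : Mbarᵒᵖ ⥤ Type 1 :=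
  (chart α β (show 3 * 1 = 3 from rfl)).points

/-- The tautological point of the locus where `A` is invertible. -/
noncomputable def pointA (β : Prop) : (locus True β).obj (op (torsorA β)) :=
  GradedPair.idPoint (torsorA β)

/-- The multiplication of the second exponent by `3`. -/
def exponents.triple (α β : Prop) : exponents α β →+ exponents α β where
  toFun m := ⟨(m.1.1, 3 * m.1.2), m.2.1, m.2.2.imp_right (by simp)⟩
  map_zero' := rfl
  map_add' x y := Subtype.ext (Prod.ext rfl (mul_add _ _ _))

theorem exponents.triple_injective : Function.Injective (exponents.triple α β) := by
  intro x y h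
  have h1 := congrArg (fun m => m.1.1) h
  have h2 := congrArg (fun m => m.1.2) h
  simp only [triple, AddMonoidHom.coe_mk, ZeroHom.coe_mk] at h1 h2
  exact Subtype.ext (Prod.ext h1 (by omega))

/-- The substitution `b = c³`. -/
noncomputable def cube (α β : Prop) : ChartRing α β →+* ChartRing α β :=
  AddMonoidAlgebra.mapDomainRingHom Z2 (exponents.triple α β)

theorem cube_monomial (m : exponents α β) : cube α β (monomial m) =
    monomial (exponents.triple α β m) :=
  AddMonoidAlgebra.mapDomain_single

theorem isMap_cube : GradedPair.IsMap (chart False True (show 3 * 1 = 3 from rfl))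
    cubeRootTorsor.toPair (cube False True) where
  mem n t ht := map_mem_of_monomial (Z := cubeRootTorsor) (cube False True) (fun m => by
    have h1 : exponents.degree False True 1 (exponents.triple False True m) =
        exponents.degree False True 3 m := by
      simp [exponents.degree, exponents.triple]
    have h2 : cube False True (monomial m) ∈
        chartGrading False True 1 (exponents.degree False True 3 m) := by
      rw [cube_monomial, ← h1]
      exact monomial_mem _
    exact h2) ht
  map_A := cube_monomial _
  map_B := cube_monomial _

theorem isPureMap_of_retraction {R S : Type} [CommRing R] [CommRing S] (k : R →+* S)
    (ρ : S →+ R) (hρ : ∀ r s, ρ (k r * s) = r * ρ s) (h1 : ρ 1 = 1) : IsPureMap k := by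
  let _ := k.toAlgebra
  intro N _ _
  let ρ' : S →ₗ[R] R := { ρ with map_smul' := hρ }
  have h1' : ρ' 1 = 1 := h1
  refine Function.LeftInverse.injective (g := fun x => TensorProduct.lid R N (ρ'.rTensor N x))
    fun n => ?_
  simp [h1']

theorem comapDomain_single_of_notMem_range {R M N : Type*} [Semiring R] {f : M → N}
    {hf : Function.Injective f} {n : N} (hn : n ∉ Set.range f) (r : R) :
    AddMonoidAlgebra.comapDomain f hf (AddMonoidAlgebra.single n r) = 0 := by
  ext
  simp [hn]

/-- The ring map `b ↦ c³` has a linear retraction, since the powers of `c` are a basis. -/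
theorem isPureMap_cube : IsPureMap (cube α β) := by
  refine isPureMap_of_retraction _ (AddMonoidAlgebra.comapDomainAddMonoidHom
    (exponents.triple α β) exponents.triple_injective) (fun r s => ?_) ?_
  · induction r using AddMonoidAlgebra.induction_linear with
    | zero => simp
    | add x y hx hy => rw [map_add, add_mul, map_add, hx, hy, add_mul]
    | single m a =>
      induction s using AddMonoidAlgebra.induction_linear with
      | zero => simp
      | add x y hx hy => rw [mul_add, map_add, hx, hy, map_add, mul_add]
      | single m' a' =>
        have h1 : cube α β (AddMonoidAlgebra.single m a) =
            AddMonoidAlgebra.single (exponents.triple α β m) a :=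
          AddMonoidAlgebra.mapDomain_single
        rw [h1, AddMonoidAlgebra.single_mul_single]
        simp only [AddMonoidAlgebra.comapDomainAddMonoidHom_apply]
        by_cases hm : m' ∈ Set.range (exponents.triple α β)
        · obtain ⟨y, rfl⟩ := hm
          rw [← map_add, AddMonoidAlgebra.comapDomain_single_map,
            AddMonoidAlgebra.comapDomain_single_map, AddMonoidAlgebra.single_mul_single]
        · have hm' : exponents.triple α β m + m' ∉ Set.range (exponents.triple α β) := by
            rintro ⟨z, hz⟩
            have h2 := congrArg (fun x => x.1.2) hz
            have h3 : 3 * z.1.2 = 3 * m.1.2 + m'.1.2 := h2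
            refine hm ⟨⟨(m'.1.1, z.1.2 - m.1.2), m'.2.1, m'.2.2.imp_right fun h0 => ?_⟩,
              Subtype.ext (Prod.ext rfl ?_)⟩
            · change 0 ≤ z.1.2 - m.1.2
              omega
            · change 3 * (z.1.2 - m.1.2) = m'.1.2
              omega
          rw [comapDomain_single_of_notMem_range hm', comapDomain_single_of_notMem_range hm,
            mul_zero]
  · exact AddMonoidAlgebra.comapDomain_single_map (exponents.triple α β)
      exponents.triple_injective (0 : exponents α β) (1 : Z2)

/-- An object on which `B` is invertible and the torsor is trivial has an étale cover on which `B`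
has a homogeneous cube root. -/
theorem Mbar.exists_cubeRoot_B (X : Mbar) (hB : IsUnit X.B) {u : X.T} (hu : u ∈ X.grading 1)
    (hu1 : IsUnit u) : ∃ (Y : Mbar) (f : Y ⟶ X), IsEtaleCover (fun _ : Unit => Y) (fun _ => f) ∧
      ∃ b ∈ Y.grading 1, b ^ 3 = Y.B := by
  obtain ⟨v, hv, huv⟩ := X.exists_mem_mul_eq_one hu hu1
  have h0 : X.B * v ^ 3 ∈ X.grading 0 := by
    have := SetLike.mul_mem_graded X.B_mem (SetLike.pow_mem_graded 3 hv)
    simpa using this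
  obtain ⟨r, hr⟩ := X.exists_of_mem_zero _ h0
  have hr1 : IsUnit (algebraMap X.R X.T r) := by
    rw [hr]
    exact hB.mul ((IsUnit.of_mul_eq_one u (by rw [mul_comm, huv])).pow 3)
  obtain ⟨w, hw, hrw⟩ := X.exists_mem_mul_eq_one (SetLike.algebraMap_mem_graded X.grading r) hr1
  rw [neg_zero] at hw
  obtain ⟨s, rfl⟩ := X.exists_of_mem_zero w hw
  have hrs : r * s = 1 := X.algebraMap_injective (by rw [map_mul, hrw, map_one])
  obtain ⟨Y, f, x, hf, hx⟩ := X.exists_cubeRoot (Units.mkOfMulEqOne r s hrs)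
  refine ⟨Y, f, hf, algebraMap Y.R Y.T x * f.total u, ?_, ?_⟩
  · have := SetLike.mul_mem_graded (SetLike.algebraMap_mem_graded Y.grading x)
      (f.total_mem 1 u hu)
    rwa [zero_add] at this
  · rw [mul_pow, ← map_pow, hx, ← f.total_algebraMap, Units.val_mkOfMulEqOne, hr, ← map_pow,
      ← map_mul, mul_assoc, ← mul_pow, mul_comm v, huv, one_pow, mul_one, f.total_B]

/-- The cube root of the invertible function `B` exists étale locally. -/
theorem isLocallySurjective_cube : Presheaf.IsLocallySurjective Mbar.etaleTopology
    (GradedPair.pointsMap isMap_cube) where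
  imageSieve_mem {Z} x := by
    have hB : IsUnit Z.B := by
      have h1 : x.down.1 _ = Z.B := x.down.2.map_B
      rw [← h1]
      exact (chart_isUnit_B (α := False) (β := True) (show 3 * 1 = 3 from rfl) trivial).map
        x.down.1
    obtain ⟨ι, _, U, f, hf, hU⟩ := Z.exists_isEtaleCover_mul_eq_one
    refine Mbar.etaleTopology.transitive (Mbar.generate_mem_etaleTopology hf) _ ?_
    rintro W _ ⟨V, g, k, hk, rfl⟩
    obtain ⟨i⟩ := hk
    rw [Sieve.pullback_comp]
    refine Mbar.etaleTopology.pullback_stable g ?_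
    obtain ⟨u, hu, hu1⟩ := hU i
    obtain ⟨W', k, hk, b, hb, hb3⟩ := (U i).exists_cubeRoot_B ((f i).total_B ▸ hB.map _) hu hu1
    have hB' : IsUnit W'.B := (k ≫ f i).total_B ▸ hB.map (k ≫ f i).total
    obtain ⟨p, hp⟩ := exists_isMap_chart (α := False) (β := True) (show 1 * 3 = 3 from rfl) hb hb3
      False.elim fun _ => (isUnit_pow_iff three_ne_zero).1 (hb3 ▸ hB')
    have := subsingleton_points_chart (α := False) (β := True) (show 3 * 1 = 3 from rfl) (op W')
    exact ⟨Unit, inferInstance, fun _ => W', fun _ => k, hk, fun _ =>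
      ⟨⟨⟨p, hp⟩⟩, Subsingleton.elim _ _⟩⟩

end StackCohomology

/-! ### The Mayer–Vietoris cover by the loci where a coordinate is invertible -/

namespace StackCohomology

variable {α β : Prop}

/-- The quotient stack is covered by a torsor along a pure and locally surjective map. -/
def GradedPair.HasTorsorCover (G : GradedPair) : Prop :=
  ∃ (Y : Mbar) (k : G.T →+* Y.T) (hk : GradedPair.IsMap G Y.toPair k), IsPureMap k ∧
    Presheaf.IsLocallySurjective Mbar.etaleTopology (GradedPair.pointsMap hk)

open GradedPair

/-- Where `A` is invertible the stack is an affine scheme, and where `B` is invertible it is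
covered by adjoining a cube root of `B`. -/
theorem hasTorsorCover_chart (h : α ∨ β) :
    (chart α β (show 3 * 1 = 3 from rfl)).HasTorsorCover := by
  by_cases hα : α
  · obtain rfl : α = True := eq_true hα
    refine ⟨torsorA β, RingHom.id _, ⟨fun _ _ ht => ht, rfl, rfl⟩,
      isPureMap_of_retraction _ (AddMonoidHom.id _) (fun _ _ => rfl) rfl, ⟨fun {Z} x => ?_⟩⟩
    refine Mbar.etaleTopology.superset_covering ?_ (Mbar.etaleTopology.top_mem Z)
    exact fun W f _ => ⟨(chart True β rfl).points.map f.op x, rfl⟩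
  · obtain rfl : α = False := eq_false hα
    obtain rfl : β = True := eq_true (h.resolve_left hα)
    exact ⟨cubeRootTorsor, cube _ _, isMap_cube, isPureMap_cube, isLocallySurjective_cube⟩

theorem GradedPair.HasTorsorCover.toSection_surjective {G : GradedPair} (hG : G.HasTorsorCover)
    (n : ℤ) : Function.Surjective (G.toSection n) := by
  obtain ⟨Y, k, hk, hpure, hsurj⟩ := hG
  let _ := k.toAlgebra
  exact GradedPair.toSection_surjective hk hpure n (sections.pullback_injective _ (Mbar.twist n))

theorem GradedPair.HasTorsorCover.subsingleton_ext {G : GradedPair} (hG : G.HasTorsorCover)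
    (n : ℤ) (i : ℕ) :
    Subsingleton (Abelian.Ext.{1} (freeSheaf.{1} Mbar.etaleTopology G.points) (Mbar.twist n) (i + 1)) := by
  obtain ⟨Y, k, hk, hpure, hsurj⟩ := hG
  exact isCechClass_torsorCover.subsingleton_ext _ (.of hk hpure hsurj) i _ (isCechAcyclic_twist n)

/-- The restriction of functions to the locus where `A` and `B` are invertible. -/
noncomputable def chartMap (α β : Prop) : ChartRing α β →+* ChartRing True True :=
  AddMonoidAlgebra.mapDomainRingHom Z2
    (AddSubmonoid.inclusion (show exponents α β ≤ exponents True True from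
      fun _ _ => ⟨.inl trivial, .inl trivial⟩))

theorem chartMap_single (m : exponents α β) (r : Z2) :
    chartMap α β (AddMonoidAlgebra.single m r) =
      AddMonoidAlgebra.single ⟨m.1, .inl trivial, .inl trivial⟩ r :=
  AddMonoidAlgebra.mapDomain_single

theorem isMap_chartMap : GradedPair.IsMap (chart α β (show 3 * 1 = 3 from rfl))
    (chart True True (show 3 * 1 = 3 from rfl)) (chartMap α β) where
  mem n t ht := map_mem_of_monomial (Z := torsorA True) (chartMap α β) (fun m => by
    have h2 : chartMap α β (monomial m) ∈
        chartGrading True True 3 (exponents.degree α β 3 m) := by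
      rw [monomial, chartMap_single]
      exact monomial_mem _
    exact h2) ht
  map_A := chartMap_single _ _
  map_B := chartMap_single _ _

/-- The inclusion of the locus where `A` and `B` are invertible. -/
noncomputable abbrev locusMap (α β : Prop) : locus True True ⟶ locus α β :=
  pointsMap isMap_chartMap

theorem pullback_locusMap_toSection (n : ℤ)
    (t : (chart α β (show 3 * 1 = 3 from rfl)).grading n) :
    sections.pullback _ (locusMap α β) (toSection _ n t) =
      toSection (chart True True rfl) n ⟨chartMap α β t.1, isMap_chartMap.mem n _ t.2⟩ := rfl

theorem nonempty_locus_iff {Z : Mbar} : Nonempty ((locus α β).obj (op Z)) ↔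
    (α → IsUnit Z.A) ∧ (β → IsUnit Z.B) := by
  constructor
  · rintro ⟨x⟩
    have hA : x.down.1 _ = Z.A := x.down.2.map_A
    have hB : x.down.1 _ = Z.B := x.down.2.map_B
    exact ⟨fun h => hA ▸ (chart_isUnit_A (β := β) (show 3 * 1 = 3 from rfl) h).map x.down.1,
      fun h => hB ▸ (chart_isUnit_B (α := α) (show 3 * 1 = 3 from rfl) h).map x.down.1⟩
  · rintro ⟨hA, hB⟩
    obtain ⟨f, hf⟩ := exists_isMap_chart (show 3 * 1 = 3 from rfl) Z.B_mem (pow_one _) hA hB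
    exact ⟨⟨⟨f, hf⟩⟩⟩

/-- The loci where `A`, respectively `B`, is invertible cover the stack, since `A` and `B` generate
the unit ideal. -/
theorem isSubterminalCover_locusMap :
    IsSubterminalCover Mbar.etaleTopology (locusMap True False) (locusMap False True) where
  subsingleton₁ _ := subsingleton_points_chart rfl _
  subsingleton₂ _ := subsingleton_points_chart rfl _
  subsingleton₁₂ _ := subsingleton_points_chart rfl _
  nonempty₁₂ Z x y := nonempty_locus_iff.2 ⟨(nonempty_locus_iff.1 ⟨x⟩).1,
    (nonempty_locus_iff.1 ⟨y⟩).2⟩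
  exists_cover X := by
    obtain ⟨Y, f, hf, hA, hB⟩ := X.exists_isEtaleCover_isUnit_A_or_B
    refine ⟨_, Mbar.generate_mem_etaleTopology hf, ?_⟩
    rintro W _ ⟨V, g, _, ⟨i⟩, rfl⟩
    cases i with
    | true => exact .inl (nonempty_locus_iff.2 ⟨fun _ => g.total_A ▸ hA.map g.total, False.elim⟩)
    | false => exact .inr (nonempty_locus_iff.2 ⟨False.elim, fun _ => g.total_B ▸ hB.map g.total⟩)

theorem toSection_injective (n : ℤ) :
    Function.Injective (toSection (chart True True (show 3 * 1 = 3 from rfl)) n) := by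
  intro s t h
  exact Subtype.ext (congrArg (fun u => (u.1 (op (torsorA True)) (pointA True)).down.1) h)

theorem subsingleton_H_add_two (n : ℤ) (i : ℕ) : Subsingleton (Mbar.H (i + 2) n) :=
  isSubterminalCover_locusMap.subsingleton_H (Mbar.twist n) i
    ((hasTorsorCover_chart (.inl trivial)).subsingleton_ext n i)
    ((hasTorsorCover_chart (.inl trivial)).subsingleton_ext n (i + 1))
    ((hasTorsorCover_chart (.inr trivial)).subsingleton_ext n (i + 1))

/-- The class in `H¹` of a homogeneous function on the intersection of the two charts. -/
noncomputable def cechClass (n : ℤ) : chartGrading True True 3 n →+ Mbar.H 1 n where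
  toFun t := isSubterminalCover_locusMap.connecting (Mbar.twist n)
    (toSection (chart True True (show 3 * 1 = 3 from rfl)) n t)
  map_zero' := by
    rw [← map_zero (isSubterminalCover_locusMap.connecting (Mbar.twist n))]
    congr 1
    exact sections.ext fun Z x => ULift.ext _ _ (Subtype.ext (map_zero x.down.1))
  map_add' _ _ := by
    rw [← map_add]
    congr 1
    exact sections.ext fun Z x => ULift.ext _ _ (Subtype.ext (map_add x.down.1 _ _))

theorem cechClass_surjective (n : ℤ) : Function.Surjective (cechClass n) :=
  (isSubterminalCover_locusMap.connecting_surjective (Mbar.twist n)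
    ((hasTorsorCover_chart (.inl trivial)).subsingleton_ext n 0)
    ((hasTorsorCover_chart (.inr trivial)).subsingleton_ext n 0)).comp
    ((hasTorsorCover_chart (.inl trivial)).toSection_surjective n)

theorem cechClass_eq_zero_iff {n : ℤ} (t : chartGrading True True 3 n) :
    cechClass n t = 0 ↔ ∃ a ∈ chartGrading True False 3 n, ∃ b ∈ chartGrading False True 3 n,
      chartMap True False a + chartMap False True b = t := by
  refine (isSubterminalCover_locusMap.connecting_eq_zero_iff (Mbar.twist n) _).trans ?_
  have hadd : ∀ a b : chartGrading True True 3 n,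
      toSection (chart True True (show 3 * 1 = 3 from rfl)) n a +
        toSection (chart True True (show 3 * 1 = 3 from rfl)) n b =
      toSection (chart True True (show 3 * 1 = 3 from rfl)) n (a + b) := fun a b =>
    sections.ext fun Z x => ULift.ext _ _ (Subtype.ext (map_add x.down.1 _ _).symm)
  constructor
  · rintro ⟨s, s', h⟩
    obtain ⟨a, rfl⟩ := (hasTorsorCover_chart (.inl trivial)).toSection_surjective n s
    obtain ⟨b, rfl⟩ := (hasTorsorCover_chart (.inr trivial)).toSection_surjective n s'
    rw [pullback_locusMap_toSection, pullback_locusMap_toSection, hadd] at h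
    exact ⟨a, a.2, b, b.2, congrArg Subtype.val (toSection_injective n h)⟩
  · rintro ⟨a, ha, b, hb, h⟩
    refine ⟨toSection _ n ⟨a, ha⟩, toSection _ n ⟨b, hb⟩, ?_⟩
    rw [pullback_locusMap_toSection, pullback_locusMap_toSection, hadd]
    exact congrArg _ (Subtype.ext h)

end StackCohomology

/-! ### Laurent polynomials and the local cohomology module -/

namespace StackCohomology

open MvPolynomial

/-- The Laurent polynomials in `A` and `B`: the functions on the intersection of the charts. -/
abbrev Laurent : Type := ChartRing True True

namespace Laurent

/-- The exponent of the Laurent monomial `Aⁱ Bʲ`. -/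
abbrev exponent (i j : ℤ) : exponents True True := ⟨(i, j), .inl trivial, .inl trivial⟩

/-- The coefficient of `Aⁱ Bʲ`. -/
noncomputable def coefficient (i j : ℤ) : Laurent →+ Z2 where
  toFun t := t.coeff (exponent i j)
  map_zero' := rfl
  map_add' _ _ := rfl

theorem ext {s t : Laurent} (h : ∀ i j, coefficient i j s = coefficient i j t) : s = t :=
  AddMonoidAlgebra.coeff_injective (Finsupp.ext fun m => h m.1.1 m.1.2)

theorem coefficient_single (i j i' j' : ℤ) (r : Z2) :
    coefficient i j (AddMonoidAlgebra.single (exponent i' j') r) = if i' = i ∧ j' = j then r else 0 := by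
  classical
  refine Finsupp.single_apply.trans (if_congr ?_ rfl rfl)
  rw [Subtype.ext_iff, Prod.ext_iff]

theorem coefficient_single_mul (i j i' j' : ℤ) (r : Z2) (t : Laurent) :
    coefficient i j (AddMonoidAlgebra.single (exponent i' j') r * t) = r * coefficient (i - i') (j - j') t := by
  refine AddMonoidAlgebra.coeff_single_mul_eq_mul_coeff _ fun m _ => ?_
  rw [Subtype.ext_iff, Subtype.ext_iff, Prod.ext_iff, Prod.ext_iff]
  change i' + m.1.1 = i ∧ j' + m.1.2 = j ↔ m.1.1 = i - i' ∧ m.1.2 = j - j'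
  omega

theorem mem_grading_iff {n : ℤ} {t : Laurent} :
    t ∈ chartGrading True True 3 n ↔ ∀ i j, coefficient i j t ≠ 0 → i + 3 * j = n := by
  constructor
  · intro h i j hij
    exact h (exponent i j) (Finsupp.mem_support_iff.2 hij)
  · intro h m hm
    exact h m.1.1 m.1.2 (Finsupp.mem_support_iff.1 hm)

/-- The functions which extend to a chart. -/
theorem mem_range_chartMap_iff {α β : Prop} {t : Laurent} : t ∈ (chartMap α β).range ↔
    ∀ i j, coefficient i j t ≠ 0 → (α ∨ 0 ≤ i) ∧ (β ∨ 0 ≤ j) := by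
  constructor
  · rintro ⟨s, rfl⟩ i j h
    by_contra hij
    refine h ?_
    induction s using AddMonoidAlgebra.induction_linear with
    | zero => rw [map_zero, map_zero]
    | add x y hx hy =>
      by_cases h0 : coefficient i j (chartMap α β x) = 0
      · rw [map_add, map_add, h0, zero_add]
        refine hy fun h1 => h ?_
        rw [map_add, map_add, h0, h1, add_zero]
      · exact absurd (hx h0) h0
    | single m r =>
      rw [chartMap_single, coefficient_single, if_neg]
      rintro ⟨rfl, rfl⟩
      exact hij m.2
  · intro h
    rw [← AddMonoidAlgebra.sum_coeff_single t]
    refine sum_mem fun m hm => ⟨AddMonoidAlgebra.single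
      ⟨m.1, h m.1.1 m.1.2 (Finsupp.mem_support_iff.1 hm)⟩ _, chartMap_single _ _⟩

theorem coefficient_chartMap {α β : Prop} (s : ChartRing α β) (m : exponents α β) :
    coefficient m.1.1 m.1.2 (chartMap α β s) = s.coeff m := by
  have hinj : Function.Injective (AddSubmonoid.inclusion (show exponents α β ≤ exponents True True
      from fun _ _ => ⟨.inl trivial, .inl trivial⟩)) := AddSubmonoid.inclusion_injective _
  exact Finsupp.mapDomain_apply hinj _ m

theorem chartMap_injective {α β : Prop} : Function.Injective (chartMap α β) := by
  intro s t h
  refine AddMonoidAlgebra.coeff_injective (Finsupp.ext fun m => ?_)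
  rw [← coefficient_chartMap, h, coefficient_chartMap]

theorem mem_grading_of_chartMap_mem {α β : Prop} {n : ℤ} {s : ChartRing α β}
    (h : chartMap α β s ∈ chartGrading True True 3 n) : s ∈ chartGrading α β 3 n := by
  intro m hm
  exact mem_grading_iff.1 h _ _ (coefficient_chartMap s m ▸ Finsupp.mem_support_iff.1 hm)

/-- The sums of functions on the two charts are the Laurent polynomials without monomials `Aⁱ Bʲ`
with `i, j < 0`. -/
theorem exists_add_eq_iff {n : ℤ} {t : Laurent} (ht : t ∈ chartGrading True True 3 n) :
    (∃ a ∈ chartGrading True False 3 n, ∃ b ∈ chartGrading False True 3 n,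
      chartMap True False a + chartMap False True b = t) ↔
    ∀ i j, i < 0 → j < 0 → coefficient i j t = 0 := by
  constructor
  · rintro ⟨a, -, b, -, rfl⟩ i j hi hj
    have ha : coefficient i j (chartMap True False a) = 0 := by
      by_contra h
      have := mem_range_chartMap_iff.1 ⟨a, rfl⟩ i j h
      simp only [false_or] at this
      omega
    have hb : coefficient i j (chartMap False True b) = 0 := by
      by_contra h
      have := mem_range_chartMap_iff.1 ⟨b, rfl⟩ i j h
      simp only [false_or] at this
      omega
    rw [map_add, ha, hb, add_zero]
  · intro h
    let t₁ : Laurent := .ofCoeff (t.coeff.filter fun m => 0 ≤ m.1.2)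
    let t₂ : Laurent := .ofCoeff (t.coeff.filter fun m => ¬ 0 ≤ m.1.2)
    have h₁ : ∀ i j, coefficient i j t₁ = if 0 ≤ j then coefficient i j t else 0 := fun i j =>
      Finsupp.filter_apply (fun m : exponents True True => 0 ≤ m.1.2) t.coeff (exponent i j)
    have h₂ : ∀ i j, coefficient i j t₂ = if ¬ 0 ≤ j then coefficient i j t else 0 := fun i j =>
      Finsupp.filter_apply (fun m : exponents True True => ¬ 0 ≤ m.1.2) t.coeff (exponent i j)
    have h12 : t₁ + t₂ = t := ext fun i j => by
      rw [map_add, h₁, h₂]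
      split_ifs <;> simp
    obtain ⟨a, ha⟩ := (mem_range_chartMap_iff (α := True) (β := False) (t := t₁)).2 fun i j hij =>
      ⟨.inl trivial, .inr (by
        rw [h₁] at hij
        exact (ite_ne_right_iff.1 hij).1)⟩
    obtain ⟨b, hb⟩ := (mem_range_chartMap_iff (α := False) (β := True) (t := t₂)).2 fun i j hij =>
      ⟨.inr (by
        rw [h₂] at hij
        by_contra hi
        exact (ite_ne_right_iff.1 hij).2 (h i j (by omega)
          (by have := (ite_ne_right_iff.1 hij).1; omega))), .inl trivial⟩
    refine ⟨a, mem_grading_of_chartMap_mem ?_, b, mem_grading_of_chartMap_mem ?_, ?_⟩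
    · rw [ha, mem_grading_iff]
      intro i j hij
      rw [h₁] at hij
      exact mem_grading_iff.1 ht i j (ite_ne_right_iff.1 hij).2
    · rw [hb, mem_grading_iff]
      intro i j hij
      rw [h₂] at hij
      exact mem_grading_iff.1 ht i j (ite_ne_right_iff.1 hij).2
    · rw [ha, hb, h12]

/-- The inclusion of the polynomials. -/
noncomputable def ofPoly : PolyAB →+* Laurent :=
  eval₂Hom (algebraMap Z2 Laurent)
    ![AddMonoidAlgebra.single (exponent 1 0) 1, AddMonoidAlgebra.single (exponent 0 1) 1]

theorem ofPoly_monomial (u : Fin 2 →₀ ℕ) (r : Z2) : ofPoly (MvPolynomial.monomial u r) =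
    AddMonoidAlgebra.single (exponent (u 0) (u 1)) r := by
  rw [ofPoly, eval₂Hom_monomial, Finsupp.prod_fintype _ _ fun _ => pow_zero _, Fin.prod_univ_two,
    AddMonoidAlgebra.coe_algebraMap]
  simp only [Matrix.cons_val_zero, Matrix.cons_val_one, AddMonoidAlgebra.single_pow,
    AddMonoidAlgebra.single_mul_single, Function.comp_apply, one_pow, mul_one,
    Algebra.algebraMap_self, RingHom.id_apply]
  congr 1
  exact Subtype.ext (Prod.ext (by simp) (by simp))

/-- The exponent of `Aⁱ Bʲ` as a polynomial. -/
noncomputable def polyExponent (i j : ℕ) : Fin 2 →₀ ℕ := Finsupp.equivFunOnFinite.symm ![i, j]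

theorem polyExponent_eq (u : Fin 2 →₀ ℕ) : polyExponent (u 0) (u 1) = u := by
  ext i
  fin_cases i <;> rfl

theorem coefficient_ofPoly (f : PolyAB) (i j : ℕ) :
    coefficient i j (ofPoly f) = f.coeff (polyExponent i j) := by
  induction f using MvPolynomial.induction_on' with
  | monomial u r =>
    rw [ofPoly_monomial, coefficient_single, MvPolynomial.coeff_monomial]
    refine if_congr ⟨fun h => ?_, fun h => ?_⟩ rfl rfl
    · rw [← polyExponent_eq u, Nat.cast_inj.1 h.1, Nat.cast_inj.1 h.2]
    · subst h
      exact ⟨rfl, rfl⟩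
  | add p q hp hq => rw [map_add, map_add, hp, hq, MvPolynomial.coeff_add]

theorem ofPoly_injective : Function.Injective ofPoly := by
  intro f g h
  refine MvPolynomial.ext _ _ fun u => ?_
  rw [← polyExponent_eq u, ← coefficient_ofPoly, ← coefficient_ofPoly, h]

theorem mem_range_ofPoly_iff {t : Laurent} :
    t ∈ ofPoly.range ↔ ∀ i j, coefficient i j t ≠ 0 → 0 ≤ i ∧ 0 ≤ j := by
  constructor
  · rintro ⟨f, rfl⟩ i j h
    by_contra hij
    refine h ?_
    clear h
    induction f using MvPolynomial.induction_on' with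
    | monomial u r =>
      rw [ofPoly_monomial, coefficient_single, if_neg (by omega)]
    | add p q hp hq => rw [map_add, map_add, hp, hq, add_zero]
  · intro h
    rw [← AddMonoidAlgebra.sum_coeff_single t]
    refine sum_mem fun m hm => ?_
    obtain ⟨h0, h1⟩ := h m.1.1 m.1.2 (Finsupp.mem_support_iff.1 hm)
    refine ⟨MvPolynomial.monomial (polyExponent m.1.1.toNat m.1.2.toNat) (t.coeff m), ?_⟩
    rw [ofPoly_monomial]
    congr 1
    exact Subtype.ext (Prod.ext (Int.toNat_of_nonneg h0) (Int.toNat_of_nonneg h1))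

theorem weight_polyExponent (u : Fin 2 →₀ ℕ) :
    Finsupp.weight (![1, 3] : Fin 2 → ℤ) u = u 0 + 3 * u 1 := by
  rw [Finsupp.weight_apply, Finsupp.sum_fintype _ _ (by simp), Fin.sum_univ_two]
  simp [mul_comm]

theorem ofPoly_mem_grading_iff {n : ℤ} {f : PolyAB} :
    ofPoly f ∈ chartGrading True True 3 n ↔ f ∈ PolyAB.homogeneous n := by
  rw [mem_grading_iff]
  constructor
  · intro h u hu
    rw [weight_polyExponent]
    refine h _ _ ?_
    rwa [coefficient_ofPoly, polyExponent_eq]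
  · intro h i j hij
    obtain ⟨hi, hj⟩ := mem_range_ofPoly_iff.1 ⟨f, rfl⟩ i j hij
    lift i to ℕ using hi
    lift j to ℕ using hj
    rw [coefficient_ofPoly] at hij
    rw [← h hij, weight_polyExponent]
    rfl

noncomputable instance : Algebra PolyAB Laurent := ofPoly.toAlgebra

theorem algebraMap_eq : algebraMap PolyAB Laurent = ofPoly := rfl

theorem smul_eq (f : PolyAB) (t : Laurent) : f • t = ofPoly f * t := rfl

theorem ofPoly_X_zero_pow (k : ℕ) :
    ofPoly (X 0 ^ k) = AddMonoidAlgebra.single (exponent k 0) 1 := by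
  rw [X_pow_eq_monomial, ofPoly_monomial]
  simp

theorem ofPoly_X_one_pow (k : ℕ) :
    ofPoly (X 1 ^ k) = AddMonoidAlgebra.single (exponent 0 k) 1 := by
  rw [X_pow_eq_monomial, ofPoly_monomial]
  simp

theorem ofPoly_mul_pow (k : ℕ) :
    ofPoly ((X 0 * X 1) ^ k) = AddMonoidAlgebra.single (exponent k k) 1 := by
  rw [mul_pow, map_mul, ofPoly_X_zero_pow, ofPoly_X_one_pow, AddMonoidAlgebra.single_mul_single,
    mul_one]
  congr 1
  exact Subtype.ext (Prod.ext (add_zero _) (zero_add _))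

instance : IsLocalization.Away (X 0 * X 1 : PolyAB) Laurent where
  map_units := by
    rintro ⟨_, k, rfl⟩
    refine IsUnit.of_mul_eq_one (AddMonoidAlgebra.single (exponent (-k) (-k)) 1) ?_
    change ofPoly ((X 0 * X 1) ^ k) * _ = _
    rw [ofPoly_mul_pow, AddMonoidAlgebra.single_mul_single, mul_one, AddMonoidAlgebra.one_def]
    congr 1
    exact Subtype.ext (Prod.ext (add_neg_cancel _) (add_neg_cancel _))
  surj := by
    intro t
    obtain ⟨k, hk⟩ : ∃ k : ℕ, ∀ i j, coefficient i j t ≠ 0 → 0 ≤ i + k ∧ 0 ≤ j + k := by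
      refine ⟨∑ m ∈ t.coeff.support, (m.1.1.natAbs + m.1.2.natAbs), fun i j h => ?_⟩
      have := Finset.single_le_sum (f := fun m : exponents True True =>
        m.1.1.natAbs + m.1.2.natAbs) (fun _ _ => Nat.zero_le _)
        (Finsupp.mem_support_iff.2 h)
      simp only at this
      omega
    obtain ⟨f, hf⟩ : t * ofPoly ((X 0 * X 1) ^ k) ∈ ofPoly.range := by
      rw [mem_range_ofPoly_iff]
      intro i j h
      rw [ofPoly_mul_pow, mul_comm, coefficient_single_mul, one_mul] at h
      have := hk _ _ h
      omega
    exact ⟨⟨f, _, k, rfl⟩, hf.symm⟩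
  exists_of_eq h := ⟨1, congrArg _ (ofPoly_injective h)⟩

/-- The ring `ℤ_(2)[A, B][1/(AB)]` consists of the Laurent polynomials. -/
noncomputable def fractionsEquiv : Laurent ≃ₐ[PolyAB] PolyAB.Fractions :=
  IsLocalization.algEquiv (Submonoid.powers (X 0 * X 1 : PolyAB)) _ _

/-- The class of a Laurent polynomial in `ℤ_(2)[A, B]/(A^∞, B^∞)`. -/
noncomputable def torsionClass : Laurent →ₗ[PolyAB] PolyAB.TorsionQuotient :=
  PolyAB.partialFractions.mkQ.comp fractionsEquiv.toLinearMap

/-- The Laurent polynomials without monomials `Aⁱ Bʲ` with `i, j < 0`. -/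
noncomputable def polarFree : Submodule PolyAB Laurent where
  carrier := {t | ∀ i j, i < 0 → j < 0 → coefficient i j t = 0}
  zero_mem' _ _ _ _ := map_zero _
  add_mem' ha hb i j hi hj := by rw [map_add, ha i j hi hj, hb i j hi hj, add_zero]
  smul_mem' f t ht := by
    induction f using MvPolynomial.induction_on' with
    | monomial u r =>
      intro i j hi hj
      rw [smul_eq, ofPoly_monomial, coefficient_single_mul, ht _ _ (by omega) (by omega), mul_zero]
    | add p q hp hq =>
      intro i j hi hj
      rw [add_smul, map_add, hp i j hi hj, hq i j hi hj, add_zero]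

theorem torsionClass_eq_zero_iff {t : Laurent} :
    torsionClass t = 0 ↔ ∀ i j, i < 0 → j < 0 → coefficient i j t = 0 := by
  have hpart : PolyAB.partialFractions = polarFree.map fractionsEquiv.toLinearMap := by
    apply le_antisymm
    · refine Submodule.span_le.2 ?_
      rintro x (⟨k, r, hx⟩ | ⟨k, r, hx⟩)
      all_goals
        obtain ⟨t, rfl⟩ := fractionsEquiv.surjective x
        refine ⟨t, fun i j hi hj => ?_, rfl⟩
        rw [← map_smul, ← fractionsEquiv.commutes, fractionsEquiv.injective.eq_iff, smul_eq,
          algebraMap_eq] at hx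
        by_contra h
      · have h1 : coefficient (i + k) j (ofPoly r) = coefficient i j t := by
          rw [← hx, ofPoly_X_zero_pow, coefficient_single_mul, one_mul]
          simp
        have := mem_range_ofPoly_iff.1 ⟨r, rfl⟩ _ _ (h1 ▸ h)
        omega
      · have h1 : coefficient i (j + k) (ofPoly r) = coefficient i j t := by
          rw [← hx, ofPoly_X_one_pow, coefficient_single_mul, one_mul]
          simp
        have := mem_range_ofPoly_iff.1 ⟨r, rfl⟩ _ _ (h1 ▸ h)
        omega
    · rintro _ ⟨t, ht, rfl⟩
      rw [← AddMonoidAlgebra.sum_coeff_single t]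
      change fractionsEquiv (Finsupp.sum _ _) ∈ _
      rw [Finsupp.sum, map_sum]
      refine sum_mem fun m hm => Submodule.subset_span ?_
      have hm' : 0 ≤ m.1.1 ∨ 0 ≤ m.1.2 := by
        by_contra! h
        exact Finsupp.mem_support_iff.1 hm (ht m.1.1 m.1.2 h.1 h.2)
      rcases hm' with h | h
      · right
        obtain ⟨f, hf⟩ : ofPoly (X 1 ^ (-m.1.2).toNat) * AddMonoidAlgebra.single m (t.coeff m) ∈
            ofPoly.range := by
          rw [mem_range_ofPoly_iff]
          intro i j hij
          rw [ofPoly_X_one_pow, coefficient_single_mul, coefficient_single] at hij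
          have : m.1.1 = i - 0 ∧ m.1.2 = j - (-m.1.2).toNat :=
            (ite_ne_right_iff.1 (right_ne_zero_of_mul hij)).1
          omega
        refine ⟨(-m.1.2).toNat, f, ?_⟩
        rw [← map_smul, smul_eq, ← hf, ← fractionsEquiv.commutes, algebraMap_eq]
      · left
        obtain ⟨f, hf⟩ : ofPoly (X 0 ^ (-m.1.1).toNat) * AddMonoidAlgebra.single m (t.coeff m) ∈
            ofPoly.range := by
          rw [mem_range_ofPoly_iff]
          intro i j hij
          rw [ofPoly_X_zero_pow, coefficient_single_mul, coefficient_single] at hij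
          have : m.1.1 = i - (-m.1.1).toNat ∧ m.1.2 = j - 0 :=
            (ite_ne_right_iff.1 (right_ne_zero_of_mul hij)).1
          omega
        refine ⟨(-m.1.1).toNat, f, ?_⟩
        rw [← map_smul, smul_eq, ← hf, ← fractionsEquiv.commutes, algebraMap_eq]
  change Submodule.Quotient.mk (fractionsEquiv t) = (0 : PolyAB.TorsionQuotient) ↔ _
  rw [Submodule.Quotient.mk_eq_zero, hpart]
  exact Submodule.map_equiv_eq_comap_symm (e := fractionsEquiv.toLinearEquiv) polarFree ▸
    (by simp [polarFree])

theorem torsionClass_mem {n : ℤ} {t : Laurent} (ht : t ∈ chartGrading True True 3 n) :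
    torsionClass t ∈ PolyAB.torsionPiece n := by
  obtain ⟨⟨f, _, k, rfl⟩, hf⟩ := IsLocalization.surj (Submonoid.powers (X 0 * X 1 : PolyAB)) t
  have hf' : ((X 0 * X 1 : PolyAB) ^ k) • t = ofPoly f := (mul_comm _ _).trans hf
  refine AddSubgroup.subset_closure ⟨fractionsEquiv t, k, f, ofPoly_mem_grading_iff.1 ?_, ?_, rfl⟩
  · rw [← hf', mem_grading_iff]
    intro i j hij
    rw [smul_eq, ofPoly_mul_pow, coefficient_single_mul, one_mul] at hij
    have := mem_grading_iff.1 ht _ _ hij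
    omega
  · rw [← map_smul, hf', ← fractionsEquiv.commutes, algebraMap_eq]

theorem exists_torsionClass_eq {n : ℤ} {q : PolyAB.TorsionQuotient}
    (hq : q ∈ PolyAB.torsionPiece n) : ∃ t ∈ chartGrading True True 3 n, torsionClass t = q := by
  induction hq using AddSubgroup.closure_induction with
  | mem q hq =>
    obtain ⟨x, k, f, hf, hx, rfl⟩ := hq
    obtain ⟨t, rfl⟩ := fractionsEquiv.surjective x
    refine ⟨t, mem_grading_iff.2 fun i j hij => ?_, rfl⟩
    rw [← map_smul, ← fractionsEquiv.commutes, fractionsEquiv.injective.eq_iff, smul_eq,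
      algebraMap_eq, ofPoly_mul_pow] at hx
    have h1 : coefficient (i + k) (j + k) (ofPoly f) = coefficient i j t := by
      rw [← hx, coefficient_single_mul, one_mul]
      simp
    have := mem_grading_iff.1 (ofPoly_mem_grading_iff.2 hf) _ _ (h1 ▸ hij)
    omega
  | zero => exact ⟨0, zero_mem _, map_zero _⟩
  | add x y _ _ hx hy =>
    obtain ⟨a, ha, rfl⟩ := hx
    obtain ⟨b, hb, rfl⟩ := hy
    exact ⟨a + b, add_mem ha hb, map_add _ _ _⟩
  | neg x _ hx =>
    obtain ⟨a, ha, rfl⟩ := hx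
    exact ⟨-a, neg_mem ha, map_neg _ _⟩

end Laurent

end StackCohomology

/-! ### Global sections and products -/

namespace StackCohomology

open GradedPair Laurent

/-- `H⁰` is the group of global sections. -/
noncomputable def Mbar.globalEquiv (n : ℤ) :
    Mbar.H 0 n ≃+ sections terminalPresheaf (Mbar.twist n).obj :=
  Abelian.Ext.addEquiv₀.trans (constantSheafEquiv (Mbar.twist n))

theorem Mbar.sectionOf_eq {n : ℤ} (x : Mbar.H 0 n) (X : Mbar) :
    Mbar.sectionOf x X = ((Mbar.globalEquiv n x).1 (op X) PUnit.unit).down.1 := by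
  let α := (sheafificationAdjunction Mbar.etaleTopology AddCommGrpCat.{1}).homEquiv _ _
    (Abelian.Ext.addEquiv₀ x)
  have h1 : (constantSheafΓAdj Mbar.etaleTopology AddCommGrpCat.{1}).homEquiv _ _
      (Abelian.Ext.addEquiv₀ x) = Sheaf.ΓHomEquiv α := by
    refine congrArg _ ?_
    exact (Equiv.symm_apply_apply _ _).symm
  have h2 : Sheaf.ΓHomEquiv α ≫ (Mbar.twist n).ΓRes (op X) = α.app (op X) :=
    (Mbar.twist n).isLimitConeΓ.fac ⟨_, α⟩ (op X)
  have h3 := ConcreteCategory.congr_hom h2 (ULift.up (1 : ℤ))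
  rw [← h1] at h3
  exact congrArg (fun z => z.down.1) h3

theorem Mbar.ext_sectionOf {n : ℤ} {x y : Mbar.H 0 n}
    (h : ∀ X, Mbar.sectionOf x X = Mbar.sectionOf y X) : x = y := by
  apply (Mbar.globalEquiv n).injective
  refine sections.ext fun Z q => ULift.ext _ _ (Subtype.ext ?_)
  have := h Z.unop
  rwa [Mbar.sectionOf_eq, Mbar.sectionOf_eq] at this

/-- The value of a polynomial at `A` and `B`, as a ring map. -/
noncomputable def evalHom (X : Mbar) : PolyAB →+* X.T :=
  MvPolynomial.eval₂Hom ((algebraMap X.R X.T).comp (algebraMap Z2 X.R)) ![X.A, X.B]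

theorem evalHom_apply (f : PolyAB) (X : Mbar) : evalHom X f = PolyAB.eval f X := rfl

theorem polyAB_ringHom_ext {T : Type} [CommRing T] {f g : PolyAB →+* T}
    (hA : f (.X 0) = g (.X 0)) (hB : f (.X 1) = g (.X 1)) : f = g := by
  have := span_two_isPrime
  refine MvPolynomial.ringHom_ext' ?_ fun i => ?_
  · exact IsLocalization.ringHom_ext (Ideal.span {(2 : ℤ)}).primeCompl (RingHom.ext_int _ _)
  · fin_cases i
    exacts [hA, hB]

theorem total_comp_evalHom {X Y : Mbar} (f : X ⟶ Y) : f.total.comp (evalHom Y) = evalHom X :=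
  polyAB_ringHom_ext (by simp [evalHom, f.total_A]) (by simp [evalHom, f.total_B])

/-- Points of the intersection of the charts evaluate polynomials at `A` and `B`. -/
theorem map_ofPoly {X : Mbar} (x : (locus True True).obj (op X)) (f : PolyAB) :
    x.down.1 (ofPoly f) = PolyAB.eval f X := by
  rw [← evalHom_apply]
  refine RingHom.congr_fun (f := x.down.1.comp ofPoly) (polyAB_ringHom_ext ?_ ?_) f
  · have h : ofPoly (.X 0) = AddMonoidAlgebra.single (exponent 1 0) 1 := by
      rw [← pow_one (MvPolynomial.X 0), ofPoly_X_zero_pow, Nat.cast_one]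
    have h1 : x.down.1 (AddMonoidAlgebra.single (exponent 1 0) 1) = X.A := x.down.2.map_A
    rw [RingHom.comp_apply, h, h1]
    simp [evalHom]
  · have h : ofPoly (.X 1) = AddMonoidAlgebra.single (exponent 0 1) 1 := by
      rw [← pow_one (MvPolynomial.X 1), ofPoly_X_one_pow, Nat.cast_one]
    have h1 : x.down.1 (AddMonoidAlgebra.single (exponent 0 1) 1) = X.B := x.down.2.map_B
    rw [RingHom.comp_apply, h, h1]
    simp [evalHom]

theorem eval_mem {n : ℤ} {f : PolyAB} (hf : f ∈ PolyAB.homogeneous n) (X : Mbar) :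
    PolyAB.eval f X ∈ X.grading n := by
  rw [← evalHom_apply, f.as_sum, map_sum]
  refine sum_mem fun u hu => ?_
  have h1 := hf (MvPolynomial.mem_support_iff.1 hu)
  rw [weight_polyExponent] at h1
  rw [evalHom, MvPolynomial.eval₂Hom_monomial, Finsupp.prod_fintype _ _ fun _ => pow_zero _,
    Fin.prod_univ_two]
  have hA := SetLike.pow_mem_graded (u 0) X.A_mem
  have hB := SetLike.pow_mem_graded (u 1) X.B_mem
  have h := SetLike.mul_mem_graded (SetLike.algebraMap_mem_graded X.grading
    (algebraMap Z2 X.R (f.coeff u))) (SetLike.mul_mem_graded hA hB)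
  have h2 : 0 + (u 0 • (1 : ℤ) + u 1 • (3 : ℤ)) = n := by
    rw [← h1]
    simp [mul_comm]
  rw [h2] at h
  exact h

/-- The global section `f(A, B)` of `𝒪(n)`. -/
noncomputable def polySection (n : ℤ) :
    PolyAB.homogeneous n →+ sections terminalPresheaf (Mbar.twist n).obj where
  toFun f := ⟨fun Z _ => ULift.up ⟨PolyAB.eval f Z.unop, eval_mem f.2 Z.unop⟩, fun _ _ g _ =>
    ULift.ext _ _ (Subtype.ext (RingHom.congr_fun (total_comp_evalHom g.unop) f.1))⟩
  map_zero' := sections.ext fun Z _ => ULift.ext _ _ (Subtype.ext (map_zero (evalHom Z.unop)))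
  map_add' f g :=
    sections.ext fun Z _ => ULift.ext _ _ (Subtype.ext (map_add (evalHom Z.unop) f.1 g.1))

theorem pullback_polySection {n : ℤ} (f : PolyAB.homogeneous n) :
    sections.pullback _ (toTerminal (locus True True)) (polySection n f) =
      toSection (chart True True rfl) n ⟨ofPoly f, ofPoly_mem_grading_iff.2 f.2⟩ :=
  sections.ext fun Z x => ULift.ext _ _ (Subtype.ext (map_ofPoly (X := Z.unop) x f.1).symm)

theorem exists_chart_restriction {α β : Prop} (h : α ∨ β) {n : ℤ}
    (s : sections terminalPresheaf (Mbar.twist n).obj) :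
    ∃ a : (chart α β (show 3 * 1 = 3 from rfl)).grading n,
      sections.pullback _ (toTerminal (locus α β)) s = toSection _ n a ∧
      sections.pullback _ (toTerminal (locus True True)) s = toSection (chart True True rfl) n
        ⟨chartMap α β a.1, isMap_chartMap.mem n _ a.2⟩ := by
  obtain ⟨a, ha⟩ := (hasTorsorCover_chart h).toSection_surjective n
    (sections.pullback _ (toTerminal (locus α β)) s)
  refine ⟨a, ha.symm, ?_⟩
  rw [← pullback_locusMap_toSection, ha]
  rfl

/-- A section over the stack is determined by its restriction to the locus where `A` and `B` are
invertible, since the functions on the charts are Laurent polynomials. -/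
theorem pullback_toTerminal_injective (n : ℤ) : Function.Injective
    (sections.pullback (Mbar.twist n).obj (toTerminal (locus True True))) := by
  have key : ∀ {α β : Prop}, α ∨ β → ∀ s t,
      sections.pullback (Mbar.twist n).obj (toTerminal (locus True True)) s =
        sections.pullback _ (toTerminal (locus True True)) t →
      sections.pullback _ (toTerminal (locus α β)) s =
        sections.pullback _ (toTerminal (locus α β)) t := by
    intro α β hαβ s t h
    obtain ⟨a, ha, ha'⟩ := exists_chart_restriction hαβ s
    obtain ⟨b, hb, hb'⟩ := exists_chart_restriction hαβ t
    rw [ha', hb'] at h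
    have h1 : chartMap α β a.1 = chartMap α β b.1 :=
      congrArg Subtype.val (toSection_injective n h)
    rw [ha, hb, Subtype.ext (chartMap_injective h1)]
  intro s t h
  exact isSubterminalCover_locusMap.ext (Mbar.twist n) (key (.inl trivial) s t h)
    (key (.inr trivial) s t h)

theorem polySection_bijective (n : ℤ) : Function.Bijective (polySection n) := by
  constructor
  · intro f g h
    have h1 := congrArg (sections.pullback _ (toTerminal (locus True True))) h
    rw [pullback_polySection, pullback_polySection] at h1
    exact Subtype.ext (ofPoly_injective (congrArg Subtype.val (toSection_injective n h1)))
  · intro s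
    obtain ⟨a, -, ha⟩ := exists_chart_restriction (α := True) (β := False) (.inl trivial) s
    obtain ⟨b, -, hb⟩ := exists_chart_restriction (α := False) (β := True) (.inr trivial) s
    have hab : chartMap True False a.1 = chartMap False True b.1 :=
      congrArg Subtype.val (toSection_injective n (ha.symm.trans hb))
    obtain ⟨f, hf⟩ : chartMap True False a.1 ∈ ofPoly.range := mem_range_ofPoly_iff.2 fun i j h =>
      ⟨(mem_range_chartMap_iff.1 ⟨b.1, hab.symm⟩ i j h).1.resolve_left id,
        (mem_range_chartMap_iff.1 ⟨a.1, rfl⟩ i j h).2.resolve_left id⟩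
    have hfn : f ∈ PolyAB.homogeneous n :=
      ofPoly_mem_grading_iff.1 (hf ▸ isMap_chartMap.mem n _ a.2)
    refine ⟨⟨f, hfn⟩, pullback_toTerminal_injective n ?_⟩
    rw [pullback_polySection, ha]
    exact congrArg _ (Subtype.ext hf)

/-- Homogeneous polynomials are the elements of `H⁰`. -/
noncomputable def polyEquiv (n : ℤ) : PolyAB.homogeneous n ≃+ Mbar.H 0 n :=
  (AddEquiv.ofBijective (polySection n) (polySection_bijective n)).trans (Mbar.globalEquiv n).symm

theorem sectionOf_polyEquiv {n : ℤ} (f : PolyAB.homogeneous n) (X : Mbar) :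
    Mbar.sectionOf (polyEquiv n f) X = PolyAB.eval f X := by
  rw [Mbar.sectionOf_eq, polyEquiv, AddEquiv.trans_apply, AddEquiv.apply_symm_apply]
  rfl

theorem ofPoly_mul_mem {m n k : ℤ} (h : m + n = k) {f : PolyAB} (hf : f ∈ PolyAB.homogeneous m)
    {t : Laurent} (ht : t ∈ chartGrading True True 3 n) :
    ofPoly f * t ∈ chartGrading True True 3 k :=
  h ▸ SetLike.mul_mem_graded (A := chartGrading True True 3) (ofPoly_mem_grading_iff.2 hf) ht

theorem cup_cechClass {m n k : ℤ} (h : m + n = k) (f : PolyAB.homogeneous m)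
    (t : chartGrading True True 3 n) :
    Mbar.cup h (polyEquiv m f) (cechClass n t) =
      cechClass k ⟨ofPoly f * t, ofPoly_mul_mem h f.2 t.2⟩ := by
  refine (isSubterminalCover_locusMap.connecting_push _ _).symm.trans ?_
  refine congrArg (isSubterminalCover_locusMap.connecting (Mbar.twist k)) ?_
  refine sections.ext fun Z x => ULift.ext _ _ (Subtype.ext ?_)
  change Mbar.sectionOf (polyEquiv m f) Z.unop * x.down.1 t.1 = x.down.1 (ofPoly f * t.1)
  rw [sectionOf_polyEquiv, map_mul, map_ofPoly]

theorem cechClass_eq_zero_iff_coefficient {n : ℤ} (t : chartGrading True True 3 n) :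
    cechClass n t = 0 ↔ ∀ i j, i < 0 → j < 0 → coefficient i j t.1 = 0 :=
  (cechClass_eq_zero_iff t).trans (exists_add_eq_iff t.2)

/-- Surjections with the same kernel have isomorphic targets. -/
theorem _root_.AddMonoidHom.exists_addEquiv_of_surjective {G H K : Type*} [AddCommGroup G]
    [AddCommGroup H] [AddCommGroup K] {f : G →+ H} {g : G →+ K} (hf : Function.Surjective f)
    (hg : Function.Surjective g) (h : ∀ x, f x = 0 ↔ g x = 0) :
    ∃ e : H ≃+ K, ∀ x, e (f x) = g x := by
  have hker : f.ker = g.ker := AddSubgroup.ext h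
  refine ⟨(QuotientAddGroup.quotientKerEquivOfSurjective f hf).symm.trans
    ((QuotientAddGroup.quotientAddEquivOfEq hker).trans
      (QuotientAddGroup.quotientKerEquivOfSurjective g hg)), fun x => ?_⟩
  have : (QuotientAddGroup.quotientKerEquivOfSurjective f hf).symm (f x) = (x : G ⧸ f.ker) := by
    rw [AddEquiv.symm_apply_eq]
    rfl
  rw [AddEquiv.trans_apply, this]
  rfl

theorem exists_torsionPiece_equiv (n : ℤ) : ∃ θ : PolyAB.torsionPiece n ≃+ Mbar.H 1 n,
    ∀ t : chartGrading True True 3 n, θ ⟨torsionClass t, torsionClass_mem t.2⟩ = cechClass n t := by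
  let f : chartGrading True True 3 n →+ PolyAB.torsionPiece n :=
    { toFun := fun t => ⟨torsionClass t, torsionClass_mem t.2⟩
      map_zero' := Subtype.ext (map_zero torsionClass)
      map_add' := fun _ _ => Subtype.ext (map_add torsionClass _ _) }
  refine AddMonoidHom.exists_addEquiv_of_surjective (f := f) (g := cechClass n) ?_
    (cechClass_surjective n) fun t => ?_
  · rintro ⟨q, hq⟩
    obtain ⟨t, ht, rfl⟩ := exists_torsionClass_eq hq
    exact ⟨⟨t, ht⟩, rfl⟩
  · rw [cechClass_eq_zero_iff_coefficient, ← torsionClass_eq_zero_iff]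
    exact Subtype.ext_iff

/-! ### Duality -/

/-- Elements of `H¹(M, 𝒪(-4))` are detected by the coefficient of `A⁻¹ B⁻¹`. -/
theorem cechClass_eq_iff {s t : chartGrading True True 3 (-4)} :
    cechClass (-4) s = cechClass (-4) t ↔ coefficient (-1) (-1) s.1 = coefficient (-1) (-1) t.1 := by
  rw [← sub_eq_zero, ← map_sub, cechClass_eq_zero_iff_coefficient, ← sub_eq_zero (b := coefficient _ _ _)]
  constructor
  · intro h
    have := h (-1) (-1) (by norm_num) (by norm_num)
    rwa [AddSubgroup.coe_sub, map_sub] at this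
  · intro h i j hi hj
    by_contra h0
    have hij := mem_grading_iff.1 (s - t).2 i j h0
    obtain rfl : i = -1 := by omega
    obtain rfl : j = -1 := by omega
    rw [AddSubgroup.coe_sub, map_sub] at h0
    exact h0 h

theorem coefficient_ofPoly_mul (u : Fin 2 →₀ ℕ) (r : Z2) (t : Laurent) :
    coefficient (-1) (-1) (ofPoly (MvPolynomial.monomial u r) * t) =
      r * coefficient (-1 - u 0) (-1 - u 1) t := by
  rw [ofPoly_monomial, coefficient_single_mul]

/-- Additive maps between modules over a localization of `ℤ` are linear. -/
theorem map_Z2_smul {M N : Type*} [AddCommGroup M] [AddCommGroup N] [Module Z2 M] [Module Z2 N]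
    (ψ : M →+ N) (r : Z2) (x : M) : ψ (r • x) = r • ψ x := by
  have := span_two_isPrime
  obtain ⟨⟨a, s⟩, hs⟩ := IsLocalization.surj (Ideal.span {(2 : ℤ)}).primeCompl r
  have hu := IsLocalization.map_units Z2 s
  rw [eq_intCast] at hu hs
  rw [eq_intCast] at hs
  refine hu.smul_left_cancel.1 ?_
  rw [Int.cast_smul_eq_zsmul, ← map_zsmul, ← Int.cast_smul_eq_zsmul Z2 _ (r • x), smul_smul,
    mul_comm, hs, Int.cast_smul_eq_zsmul, map_zsmul, ← Int.cast_smul_eq_zsmul Z2 a, ← hs, mul_comm,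
    mul_smul, Int.cast_smul_eq_zsmul]

/-- The pairing of homogeneous polynomials with Laurent polynomials into the coefficient of
`A⁻¹ B⁻¹` is perfect modulo the functions on the charts. -/
theorem exists_coefficient_mul_eq {n k : ℤ} (h : n + k = -4) (ψ : PolyAB.homogeneous n →+ Z2) :
    ∃ t ∈ chartGrading True True 3 k, ∀ f : PolyAB.homogeneous n,
      coefficient (-1) (-1) (ofPoly f * t) = ψ f := by
  classical
  have hmem : ∀ (u : Fin 2 →₀ ℕ) (r : Z2), (u 0 : ℤ) + 3 * u 1 = n →
      MvPolynomial.monomial u r ∈ PolyAB.homogeneous n := fun u r hu =>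
    MvPolynomial.isWeightedHomogeneous_monomial _ _ _ ((weight_polyExponent u).trans hu)
  -- The coefficient of `A⁻¹⁻ⁱ B⁻¹⁻ʲ` is the value of `ψ` at the dual monomial `Aⁱ Bʲ`.
  let c : (Fin 2 →₀ ℕ) → Z2 := fun u =>
    if hu : (u 0 : ℤ) + 3 * u 1 = n then ψ ⟨MvPolynomial.monomial u 1, hmem u 1 hu⟩ else 0
  let S : Finset (Fin 2 →₀ ℕ) := (Finset.range (n.toNat + 1) ×ˢ Finset.range (n.toNat + 1)).image
    fun p => polyExponent p.1 p.2
  let t : Laurent := ∑ u ∈ S, AddMonoidAlgebra.single (exponent (-1 - u 0) (-1 - u 1)) (c u)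
  have ht : ∀ u : Fin 2 →₀ ℕ, coefficient (-1 - u 0) (-1 - u 1) t = c u := by
    intro u
    have h1 : ∀ v : Fin 2 →₀ ℕ, coefficient (-1 - u 0) (-1 - u 1)
        (AddMonoidAlgebra.single (exponent (-1 - v 0) (-1 - v 1)) (c v)) =
          if v = u then c v else 0 := fun v => by
      rw [coefficient_single]
      refine if_congr ⟨fun h => ?_, fun h => ?_⟩ rfl rfl
      · rw [← polyExponent_eq u, ← polyExponent_eq v]
        congr 1 <;> omega
      · subst h
        exact ⟨rfl, rfl⟩
    rw [map_sum, Finset.sum_congr rfl fun v _ => h1 v, Finset.sum_ite_eq']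
    refine ite_eq_left_iff.2 fun hu => ?_
    refine (show c u = 0 from dif_neg fun hu' => hu ?_).symm
    refine Finset.mem_image.2 ⟨(u 0, u 1), Finset.mem_product.2 ⟨?_, ?_⟩, polyExponent_eq u⟩
    · exact Finset.mem_range.2 (by simp only; omega)
    · exact Finset.mem_range.2 (by simp only; omega)
  refine ⟨t, sum_mem fun u _ => ?_, fun f => ?_⟩
  · by_cases hu : (u 0 : ℤ) + 3 * u 1 = n
    · refine mem_grading_iff.2 fun i j hij => ?_
      rw [coefficient_single] at hij
      have := (ite_ne_right_iff.1 hij).1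
      omega
    · have hc : c u = 0 := dif_neg hu
      rw [hc, AddMonoidAlgebra.single_zero]
      exact zero_mem _
  · have hf : f = ∑ u ∈ f.1.support.attach, (f.1.coeff u.1) •
        (⟨MvPolynomial.monomial u.1 1, hmem u.1 1 ((weight_polyExponent u.1).symm.trans
          (f.2 (MvPolynomial.mem_support_iff.1 u.2)))⟩ : PolyAB.homogeneous n) := by
      apply Subtype.ext
      rw [AddSubmonoidClass.coe_finsetSum]
      conv_lhs => rw [f.1.as_sum, ← Finset.sum_attach]
      refine Finset.sum_congr rfl fun u _ => ?_
      rw [Submodule.coe_smul, MvPolynomial.smul_monomial, smul_eq_mul, mul_one]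
    conv_rhs => rw [hf, map_sum]
    conv_lhs => rw [f.1.as_sum, ← Finset.sum_attach, map_sum, Finset.sum_mul, map_sum]
    refine Finset.sum_congr rfl fun u _ => ?_
    rw [coefficient_ofPoly_mul, ht, map_Z2_smul, smul_eq_mul]
    exact congrArg _ (dif_pos ((weight_polyExponent u.1).symm.trans
          (f.2 (MvPolynomial.mem_support_iff.1 u.2))))

theorem cechClass_eq_of_forall_coefficient {n k : ℤ} (h : n + k = -4)
    {s t : chartGrading True True 3 k}
    (hst : ∀ f : PolyAB.homogeneous n, coefficient (-1) (-1) (ofPoly f * s.1) =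
      coefficient (-1) (-1) (ofPoly f * t.1)) : cechClass k s = cechClass k t := by
  rw [← sub_eq_zero, ← map_sub, cechClass_eq_zero_iff_coefficient]
  intro i j hi hj
  by_contra h0
  have hij := mem_grading_iff.1 (s - t).2 i j h0
  let u := polyExponent (-1 - i).toNat (-1 - j).toNat
  have hu0 : (u 0 : ℤ) = -1 - i := Int.toNat_of_nonneg (by omega)
  have hu1 : (u 1 : ℤ) = -1 - j := Int.toNat_of_nonneg (by omega)
  have h1 := hst ⟨MvPolynomial.monomial u 1, MvPolynomial.isWeightedHomogeneous_monomial _ _ _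
    ((weight_polyExponent u).trans (by omega))⟩
  rw [coefficient_ofPoly_mul, coefficient_ofPoly_mul, hu0, hu1, sub_sub_cancel, sub_sub_cancel,
    one_mul, one_mul] at h1
  rw [AddSubgroup.coe_sub, map_sub, h1, sub_self] at h0
  exact h0 rfl

theorem existsUnique_cup_eq {n k : ℤ} (h : n + k = -4) (φ : Mbar.H 0 n →+ Mbar.H 1 (-4)) :
    ∃! y : Mbar.H 1 k, ∀ x : Mbar.H 0 n, Mbar.cup h x y = φ x := by
  -- The coefficient of `A⁻¹ B⁻¹` as an isomorphism from `H¹(M, 𝒪(-4))`.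
  let r : chartGrading True True 3 (-4) →+ Z2 :=
    (coefficient (-1) (-1)).comp (chartGrading True True 3 (-4)).subtype
  have hr : Function.Surjective r := fun a =>
    ⟨⟨AddMonoidAlgebra.single (exponent (-1) (-1)) a, mem_grading_iff.2 fun i j hij => by
      rw [coefficient_single] at hij
      have := (ite_ne_right_iff.1 hij).1
      omega⟩, by
      refine (coefficient_single _ _ _ _ _).trans ?_
      simp⟩
  obtain ⟨ρ, hρ⟩ := AddMonoidHom.exists_addEquiv_of_surjective (cechClass_surjective (-4)) hr
    fun t => by
      rw [← map_zero (cechClass (-4)), cechClass_eq_iff]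
      exact ⟨fun h => h.trans (map_zero _), fun h => h.trans (map_zero _).symm⟩
  have hcup : ∀ (f : PolyAB.homogeneous n) (t : chartGrading True True 3 k),
      ρ (Mbar.cup h (polyEquiv n f) (cechClass k t)) = coefficient (-1) (-1) (ofPoly f * t.1) :=
    fun f t => by
      rw [cup_cechClass, hρ]
      rfl
  obtain ⟨t, ht, htψ⟩ := exists_coefficient_mul_eq h
    ((ρ.toAddMonoidHom.comp φ).comp (polyEquiv n).toAddMonoidHom)
  refine ⟨cechClass k ⟨t, ht⟩, fun x => ?_, fun y hy => ?_⟩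
  · obtain ⟨f, rfl⟩ := (polyEquiv n).surjective x
    exact ρ.injective ((hcup f ⟨t, ht⟩).trans (htψ f))
  · obtain ⟨s, rfl⟩ := cechClass_surjective k y
    refine cechClass_eq_of_forall_coefficient h fun f => ?_
    rw [← hcup, hy]
    exact (htψ f).symm

theorem X_zero_smul_invAB : (MvPolynomial.X 0 : PolyAB) • PolyAB.invAB = 0 := by
  refine (Submodule.Quotient.mk_eq_zero _).2 (Submodule.subset_span (.inr ⟨1, 1, ?_⟩))
  rw [pow_one, smul_smul, mul_comm (MvPolynomial.X 1) (MvPolynomial.X 0), Algebra.smul_def, IsLocalization.Away.mul_invSelf, map_one]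

theorem X_one_smul_invAB : (MvPolynomial.X 1 : PolyAB) • PolyAB.invAB = 0 := by
  refine (Submodule.Quotient.mk_eq_zero _).2 (Submodule.subset_span (.inl ⟨1, 1, ?_⟩))
  rw [pow_one, smul_smul, Algebra.smul_def, IsLocalization.Away.mul_invSelf, map_one]

end StackCohomology

/-! ### The cohomology of the line bundles -/

open StackCohomology
theorem mainTheorem10 :
    (∀ (n : ℤ) (i : ℕ), 2 ≤ i → Subsingleton (Mbar.H i n)) ∧
    ∃ e : ∀ n : ℤ, PolyAB.homogeneous n ≃+ Mbar.H 0 n,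
      (∀ (n : ℤ) (f : PolyAB.homogeneous n) (X : Mbar),
        Mbar.sectionOf (e n f) X = PolyAB.eval f X) ∧
      (∀ (m n k : ℤ) (h : m + n = k) (f : PolyAB.homogeneous m) (g : PolyAB.homogeneous n),
        e k ⟨f * g, PolyAB.mul_mem h f.2 g.2⟩ = Mbar.cup h (e m f) (e n g)) ∧
      ∃ θ : ∀ n : ℤ, PolyAB.torsionPiece n ≃+ Mbar.H 1 n,
        (∀ (m n k : ℤ) (h : m + n = k) (f : PolyAB.homogeneous m) (q : PolyAB.torsionPiece n),
          θ k ⟨(f : PolyAB) • (q : PolyAB.TorsionQuotient), PolyAB.smul_mem h f.2 q.2⟩ =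
            Mbar.cup h (e m f) (θ n q)) ∧
        ∃ D : Mbar.H 1 (-4),
          D = θ (-4) ⟨PolyAB.invAB, PolyAB.invAB_mem⟩ ∧
          Mbar.cup (by norm_num : (1 : ℤ) + (-4) = -3) (e 1 ⟨_, PolyAB.A_mem⟩) D = 0 ∧
          Mbar.cup (by norm_num : (3 : ℤ) + (-4) = -1) (e 3 ⟨_, PolyAB.B_mem⟩) D = 0 ∧
          ∀ (n k : ℤ) (h : n + k = -4) (φ : Mbar.H 0 n →+ Mbar.H 1 (-4)),
            ∃! y : Mbar.H 1 k, ∀ x : Mbar.H 0 n, Mbar.cup h x y = φ x := by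
  choose θ hθ using exists_torsionPiece_equiv
  have hmod : ∀ (m n k : ℤ) (h : m + n = k) (f : PolyAB.homogeneous m)
      (q : PolyAB.torsionPiece n),
      θ k ⟨(f : PolyAB) • (q : PolyAB.TorsionQuotient), PolyAB.smul_mem h f.2 q.2⟩ =
        Mbar.cup h (polyEquiv m f) (θ n q) := by
    rintro m n k h f ⟨q, hq⟩
    obtain ⟨t, ht, rfl⟩ := Laurent.exists_torsionClass_eq hq
    rw [hθ n ⟨t, ht⟩, cup_cechClass, ← hθ]
    exact congrArg _ (Subtype.ext (map_smul Laurent.torsionClass f.1 t).symm)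
  refine ⟨fun n i hi => ?_, polyEquiv, fun n f X => sectionOf_polyEquiv f X,
    fun m n k h f g => Mbar.ext_sectionOf fun X => ?_, θ, hmod, _, rfl, ?_, ?_,
    fun n k h φ => existsUnique_cup_eq h φ⟩
  · obtain ⟨i, rfl⟩ := Nat.exists_eq_add_of_le' hi
    exact subsingleton_H_add_two n i
  · rw [Mbar.sectionOf_cup, sectionOf_polyEquiv, sectionOf_polyEquiv, sectionOf_polyEquiv]
    exact map_mul (evalHom X) f.1 g.1
  · rw [← hmod, ← map_zero (θ (-3))]
    exact congrArg _ (Subtype.ext X_zero_smul_invAB)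
  · rw [← hmod, ← map_zero (θ (-1))]
    exact congrArg _ (Subtype.ext X_one_smul_invAB)
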